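/- Conventions. A hyperbolic $3$-manifold is a quotient $M=\mathbb H^3/\Gamma$, where $\Gamma$ is a group of isometries of $\mathbb H^3$ acting freely and properly discontinuously. A graph is a finite graph, in which loops and multiple edges are allowed. A carrier graph in $M$ is a continuous map $f\colon X\to M$ from a connected graph $X$ such that $f_*\colon\pi_1(X)\to\pi_1(M)$ is surjective. The length of a path in $X$ is the length of its image in $M$ for the hyperbolic metric, and the length of $f\colon X\to M$ is the sum of the lengths of the edges of $X$. Two carrier graphs $f\colon X\to M$ and $f'\colon X'\to M$ are equivalent if there is a homotopy equivalence $h\colon X\to X'$ such that $f$ and $f'\circ h$ are freely homotopic; $f$ has minimal length if no equivalent carrier graph is shorter. Let $\tilde f\colon\tilde X\to\mathbb H^3$ be the lift of $f$ to the universal covers, where $\tilde X$ has the path (semi-)metric given by the lengths above. A map $\phi$ between (semi-)metric spaces is a $(K,C)$-quasi-isometric embedding if $\frac1K d(x,y)-C\le d(\phi(x),\phi(y))\le K\,d(x,y)+C$ for all $x,y$, and a quasi-isometric embedding if this holds for some $K\ge1$, $C\ge0$. For $A>0$, a connected subgraph $Y\subset X$, with universal cover $\tilde Y$, is $A$-quasi-convex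 if 1. the lift $\tilde f|_{\tilde Y}\colon\tilde Y\to\mathbb H^3$ of $f|_Y$ is an $(A,A)$-quasi-isometric embedding; 2. if $\pi_1(Y)\neq1$, every point of $\tilde Y$ is at distance at most $A$ from the axis (the set of points of least displacement in $\tilde Y$) of some non-trivial element of $\pi_1(Y)$; 3. for every non-trivial $\gamma\in\pi_1(Y)$, the translation length $\inf_{p\in\mathbb H^3}d(p,f_*(\gamma)p)$ of $f_*(\gamma)$ is at least $\frac1A$. Proposition. For every real $A>0$ and every integer $s>0$ there is a constant $L$ such that the following holds. Let $M$ be a hyperbolic $3$-manifold, let $f\colon X\to M$ be a carrier graph of minimal length with $s$ edges, and let $Y_1,\dots,Y_k$ ($k\ge0$) be pairwise disjoint connected $A$-quasi-convex subgraphs of $X$. Then - $\tilde f\colon\tilde X\to\mathbb H^3$ is a quasi-isometric embedding and $\pi_1(M)$ is free, or - some edge of $X$ which belongs to none of the $Y_i$ has length at most $L$. -/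

import Mathlib

open scoped ENNReal unitInterval Topology

noncomputable section

/-! ### Hyperbolic 3-space: the upper half-space model -/

/-- Hyperbolic 3-space `{(z, t) : z ∈ ℂ, t > 0}`. -/
@[ext]
structure HypSpace where
  z : ℂ
  t : ℝ
  t_pos : 0 < t

namespace HypSpace

/-- The underlying point of Euclidean 3-space. -/
def toE (p : HypSpace) : WithLp 2 (ℂ × ℝ) := WithLp.toLp 2 (p.z, p.t)

/-- The mirror image of the underlying point in the boundary plane. -/
def refl (p : HypSpace) : WithLp 2 (ℂ × ℝ) := WithLp.toLp 2 (p.z, -p.t)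

/-- The hyperbolic distance: `sinh (d(p,q)/2) = |p - q| / (2 √(t_p t_q))`, equivalently
`cosh d(p,q) = 1 + |p - q|² / (2 t_p t_q)`, where `|p - q|` is the Euclidean distance. -/
instance : Dist HypSpace :=
  ⟨fun p q => 2 * Real.arsinh (dist p.toE q.toE / (2 * √(p.t * q.t)))⟩

theorem dist_def (p q : HypSpace) :
    dist p q = 2 * Real.arsinh (dist p.toE q.toE / (2 * √(p.t * q.t))) := rfl

theorem toE_sq (p q : HypSpace) :
    dist p.toE q.toE ^ 2 = ‖p.z - q.z‖ ^ 2 + (p.t - q.t) ^ 2 := by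
  rw [WithLp.prod_dist_eq_of_L2, Real.sq_sqrt (by positivity)]
  simp [toE, dist_eq_norm]

theorem refl_sq (p q : HypSpace) :
    dist p.toE q.refl ^ 2 = ‖p.z - q.z‖ ^ 2 + (p.t + q.t) ^ 2 := by
  rw [WithLp.prod_dist_eq_of_L2, Real.sq_sqrt (by positivity)]
  simp [toE, refl, dist_eq_norm]

theorem dist_refl_self (p : HypSpace) : dist p.toE p.refl = 2 * p.t := by
  have h := p.t_pos
  rw [← sq_eq_sq₀ dist_nonneg (by positivity), refl_sq]
  simp; ring

theorem sinh_half (p q : HypSpace) :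
    Real.sinh (dist p q / 2) = dist p.toE q.toE / (2 * √(p.t * q.t)) := by
  rw [dist_def, mul_div_cancel_left₀ _ two_ne_zero, Real.sinh_arsinh]

theorem cosh_half (p q : HypSpace) :
    Real.cosh (dist p q / 2) = dist p.toE q.refl / (2 * √(p.t * q.t)) := by
  have hp := p.t_pos
  have hq := q.t_pos
  rw [← sq_eq_sq₀ (Real.cosh_pos _).le (by positivity), Real.cosh_sq', sinh_half, div_pow,
    div_pow, one_add_div (by positivity), mul_pow, Real.sq_sqrt (by positivity), toE_sq, refl_sq]
  congr 1
  ring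

theorem dist_comm' (p q : HypSpace) : dist p q = dist q p := by
  rw [dist_def, dist_def, dist_comm, mul_comm p.t]

theorem refl_comm (p q : HypSpace) : dist p.toE q.refl = dist q.toE p.refl := by
  rw [← sq_eq_sq₀ dist_nonneg dist_nonneg, refl_sq, refl_sq, norm_sub_rev, add_comm p.t]

theorem dist_triangle' (a b c : HypSpace) : dist a c ≤ dist a b + dist b c := by
  have ha := a.t_pos
  have hb := b.t_pos
  have hc := c.t_pos
  have key : dist a.toE c.toE * dist b.toE b.refl ≤
      dist a.toE b.toE * dist c.toE b.refl + dist b.toE c.toE * dist a.toE b.refl :=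
    EuclideanGeometry.mul_dist_le_mul_dist_add_mul_dist a.toE b.toE c.toE b.refl
  rw [← div_le_div_iff_of_pos_right (zero_lt_two' ℝ), ← Real.sinh_le_sinh, add_div, Real.sinh_add,
    sinh_half, sinh_half, sinh_half, cosh_half, cosh_half, refl_comm b c]
  rw [dist_refl_self] at key
  rw [Real.sqrt_mul ha.le, Real.sqrt_mul ha.le, Real.sqrt_mul hb.le]
  have e1 := Real.mul_self_sqrt hb.le
  have sa := Real.sqrt_pos.2 ha
  have sb := Real.sqrt_pos.2 hb
  have sc := Real.sqrt_pos.2 hc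
  rw [← e1] at key
  generalize √a.t = x at *
  generalize √b.t = y at *
  generalize √c.t = w at *
  rw [div_mul_div_comm, div_mul_div_comm, div_add_div _ _ (by positivity) (by positivity),
    div_le_div_iff₀ (by positivity) (by positivity)]
  nlinarith [mul_le_mul_of_nonneg_left key
    (show 0 ≤ 8 * x ^ 2 * y ^ 2 * w ^ 2 by positivity)]

instance : MetricSpace HypSpace where
  dist_self p := by simp [dist_def]
  dist_comm := dist_comm'
  dist_triangle := dist_triangle'
  eq_of_dist_eq_zero {p q} h := by
    have hp := p.t_pos
    have hq := q.t_pos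
    have h0 : dist p.toE q.toE = 0 := by
      have := sinh_half p q
      rw [h, zero_div, Real.sinh_zero, eq_comm, div_eq_zero_iff] at this
      exact this.resolve_right (by positivity)
    have h1 := toE_sq p q
    rw [h0] at h1
    have h2 : ‖p.z - q.z‖ = 0 := by nlinarith [norm_nonneg (p.z - q.z), sq_nonneg (p.t - q.t)]
    have h3 : p.t - q.t = 0 := by nlinarith [norm_nonneg (p.z - q.z), sq_nonneg (p.t - q.t)]
    exact HypSpace.ext (sub_eq_zero.1 (norm_eq_zero.1 h2)) (sub_eq_zero.1 h3)

instance : MulAction (HypSpace ≃ᵢ HypSpace) HypSpace where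
  smul g p := g p
  one_smul _ := rfl
  mul_smul _ _ _ := rfl

theorem smul_def (g : HypSpace ≃ᵢ HypSpace) (p : HypSpace) : g • p = g p := rfl

end HypSpace

/-! ### Hyperbolic 3-manifolds -/

/-- A (complete, connected) hyperbolic 3-manifold `ℍ³/Γ`, given by a group `Γ` of isometries of
`ℍ³` which acts freely and properly discontinuously. -/
structure HypManifold where
  Γ : Subgroup (HypSpace ≃ᵢ HypSpace)
  free : ∀ g ∈ Γ, ∀ p : HypSpace, g p = p → g = 1
  discrete : ∀ (p : HypSpace) (r : ℝ), {g | g ∈ Γ ∧ dist p (g p) ≤ r}.Finite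

namespace HypManifold

/-- The quotient space `ℍ³/Γ` (with the quotient topology). -/
abbrev Carrier (M : HypManifold) : Type := MulAction.orbitRel.Quotient M.Γ HypSpace

/-- The universal covering map `ℍ³ → ℍ³/Γ`. -/
def proj (M : HypManifold) : HypSpace → M.Carrier := Quotient.mk (MulAction.orbitRel M.Γ HypSpace)

theorem isQuotientCoveringMap (M : HypManifold) : IsQuotientCoveringMap M.proj M.Γ where
  toIsQuotientMap := isQuotientMap_quotient_mk'
  continuous_const_smul g := g.1.continuous
  apply_eq_iff_mem_orbit := Quotient.eq''
  disjoint p := by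
    obtain ⟨ε, hε, h⟩ : ∃ ε > 0, ∀ g ∈ M.Γ, dist p (g p) < ε → g = 1 := by
      have hfin : ((fun g : HypSpace ≃ᵢ HypSpace => dist p (g p)) ''
          {g | (g ∈ M.Γ ∧ dist p (g p) ≤ 1) ∧ g ≠ 1}).Finite :=
        ((M.discrete p 1).subset fun g hg => hg.1).image _
      have hn : (0 : ℝ) ∉ (fun g : HypSpace ≃ᵢ HypSpace => dist p (g p)) ''
          {g | (g ∈ M.Γ ∧ dist p (g p) ≤ 1) ∧ g ≠ 1} := by
        rintro ⟨g, ⟨⟨hg, -⟩, hg1⟩, h0⟩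
        exact hg1 (M.free g hg p (dist_eq_zero.1 h0).symm)
      obtain ⟨ε, hε, hb⟩ := Metric.isOpen_iff.1 hfin.isClosed.isOpen_compl 0 hn
      refine ⟨min ε 1, by positivity, fun g hg hd => ?_⟩
      by_contra hg1
      refine hb (?_ : dist p (g p) ∈ _) ⟨g, ⟨⟨hg, hd.le.trans (min_le_right _ _)⟩, hg1⟩, rfl⟩
      rw [Metric.mem_ball, Real.dist_eq, sub_zero, abs_of_nonneg dist_nonneg]
      exact hd.trans_le (min_le_left _ _)
    refine ⟨Metric.ball p (ε / 2), Metric.ball_mem_nhds _ (by positivity), ?_⟩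
    rintro ⟨g, hg⟩ ⟨_, ⟨q, hq, rfl⟩, hq'⟩
    have hq2 : dist (g q) p < ε / 2 := hq'
    have hq1 : dist (g p) (g q) < ε / 2 := by
      rw [g.isometry.dist_eq, dist_comm]; exact hq
    refine Subtype.ext (h g hg ?_)
    rw [dist_comm]
    linarith [dist_triangle (g p) (g q) p]

theorem isCoveringMap (M : HypManifold) : IsCoveringMap M.proj :=
  M.isQuotientCoveringMap.isCoveringMap

/-- The length of a path in `M` for the hyperbolic metric, that is, the metric for which
`ℍ³ → M` is a local isometry: the length (total variation) of a lift to `ℍ³`. All lifts of a given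
path have the same length. -/
def pathLength (M : HypManifold) (c : C(I, M.Carrier)) : ℝ≥0∞ :=
  ⨅ (b : C(I, HypSpace)) (_ : ∀ t, M.proj (b t) = c t), eVariationOn b Set.univ

end HypManifold

/-- The translation length of an isometry of `ℍ³`. -/
def translationLength (g : HypSpace ≃ᵢ HypSpace) : ℝ := ⨅ p : HypSpace, dist p (g p)

/-- `φ` is a `(K, C)`-quasi-isometric embedding for the (semi-)distance `d`:
`(1/K) d(x,y) - C ≤ d(φ x, φ y) ≤ K d(x,y) + C`. -/
def IsQIEmbedding {S : Type} (d : S → S → ℝ≥0∞) (φ : S → HypSpace) (K C : ℝ) : Prop :=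
  ∀ x y, ENNReal.ofReal (1 / K) * d x y ≤ edist (φ x) (φ y) + ENNReal.ofReal C ∧
    edist (φ x) (φ y) ≤ ENNReal.ofReal K * d x y + ENNReal.ofReal C

/-! ### Universal covers and lifts of maps into a hyperbolic manifold -/

/-- The universal cover of `T` (for `T` a connected graph): the set of homotopy classes, relative
to the endpoints, of paths which start at the base point. -/
def UnivCover {T : Type} [TopologicalSpace T] (x₀ : T) : Type :=
  Σ y : T, Path.Homotopic.Quotient x₀ y

section Lift

variable {T : Type} [TopologicalSpace T] {M : HypManifold}

/-- The action of `π₁(T, x₀)` on the universal cover by deck transformations. -/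
def deck {x₀ : T} (γ : FundamentalGroup T x₀) (a : UnivCover x₀) : UnivCover x₀ :=
  ⟨a.1, (FundamentalGroup.toPath γ).trans a.2⟩

/-- The lift of `f : T → M` to a map of universal covers `T̃ → ℍ³`, for a choice of a point of `ℍ³`
over the image of the base point: the class of a path `α` is sent to the endpoint of the lift of
`f ∘ α` which starts at the chosen point. -/
def univLift (f : C(T, M.Carrier)) {x₀ : T} (h₀ : M.proj ⁻¹' {f x₀}) (a : UnivCover x₀) :
    HypSpace :=
  (M.isCoveringMap.monodromy (a.2.map f) h₀).1

/-- The semi-distance on the universal cover of `T` induced by `f : T → M`: the infimum of the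
lengths of the paths which join two points, where the length of a path is that of its
image in `M`. A path in the universal cover from `a` to `b` is a path in `T` whose class `δ`
satisfies `a · δ = b`. -/
def coverDist (f : C(T, M.Carrier)) {x₀ : T} (a b : UnivCover x₀) : ℝ≥0∞ :=
  ⨅ (δ : Path a.1 b.1) (_ : a.2.trans (Path.Homotopic.Quotient.mk δ) = b.2),
    M.pathLength (f.comp δ.toContinuousMap)

/-- The axis of `γ ∈ π₁(T, x₀)` in the universal cover: the set of points with least
displacement. -/
def deckAxis (f : C(T, M.Carrier)) {x₀ : T} (γ : FundamentalGroup T x₀) : Set (UnivCover x₀) :=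
  {a | ∀ b, coverDist f a (deck γ a) ≤ coverDist f b (deck γ b)}

/-- The lift of `f : T → M` to universal covers is a quasi-isometric embedding. -/
def LiftIsQI (f : C(T, M.Carrier)) : Prop :=
  ∃ K C : ℝ, 1 ≤ K ∧ 0 ≤ C ∧ ∀ (x₀ : T) (h₀ : M.proj ⁻¹' {f x₀}),
    IsQIEmbedding (coverDist f (x₀ := x₀)) (univLift f h₀) K C

/-- The three conditions in the definition of `A`-quasi-convexity, for a map `f` of a connected
graph `T` to `M`. The second and the third one are about the non-trivial elements of `π₁(T)`, and
are void if there are none, i.e. if `T` is a tree. An element `g` of `Γ = π₁(M)` is `f_*(γ)` if the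
lift of `f` intertwines `γ` and `g`. -/
structure IsQuasiConvexMap (f : C(T, M.Carrier)) (A : ℝ) : Prop where
  qi : ∀ (x₀ : T) (h₀ : M.proj ⁻¹' {f x₀}),
    IsQIEmbedding (coverDist f (x₀ := x₀)) (univLift f h₀) A A
  near_axis : ∀ x₀ : T, Nontrivial (FundamentalGroup T x₀) → ∀ a : UnivCover x₀,
    ∃ γ : FundamentalGroup T x₀, γ ≠ 1 ∧ ∃ b ∈ deckAxis f γ, coverDist f a b ≤ ENNReal.ofReal A
  translation : ∀ (x₀ : T) (h₀ : M.proj ⁻¹' {f x₀}) (γ : FundamentalGroup T x₀), γ ≠ 1 →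
    ∀ g ∈ M.Γ, (∀ a : UnivCover x₀, univLift f h₀ (deck γ a) = g (univLift f h₀ a)) →
      1 / A ≤ translationLength g

end Lift

/-! ### Graphs -/

/-- A finite graph (loops and multiple edges are allowed); the edges carry an arbitrary
orientation. -/
structure FinGraph where
  V : Type
  E : Type
  [fintypeV : Fintype V]
  [fintypeE : Fintype E]
  src : E → V
  tgt : E → V

attribute [instance] FinGraph.fintypeV FinGraph.fintypeE

namespace FinGraph

/-- The disjoint union of a point for every vertex and an interval for every edge. -/
abbrev Pieces (X : FinGraph) : Type := (Σ _ : X.V, Unit) ⊕ (Σ _ : X.E, I)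

/-- The ends of the edges are glued to the vertices. -/
inductive Glue (X : FinGraph) : X.Pieces → X.Pieces → Prop
  | src (e : X.E) : Glue X (Sum.inr ⟨e, 0⟩) (Sum.inl ⟨X.src e, ()⟩)
  | tgt (e : X.E) : Glue X (Sum.inr ⟨e, 1⟩) (Sum.inl ⟨X.tgt e, ()⟩)

/-- The topological realization of a graph, with the quotient topology. -/
abbrev Space (X : FinGraph) : Type := Quot X.Glue

/-- A vertex, as a point of the realization. -/
def vertex (X : FinGraph) (v : X.V) : X.Space := Quot.mk _ (Sum.inl ⟨v, ()⟩)

/-- An edge, as a path in the realization. -/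
def edge (X : FinGraph) (e : X.E) : C(I, X.Space) where
  toFun t := Quot.mk _ (Sum.inr ⟨e, t⟩)
  continuous_toFun := continuous_quot_mk.comp (continuous_inr.comp continuous_sigmaMk)

/-- A subgraph: sets of vertices and edges, containing the endpoints of its edges. -/
structure Sub (X : FinGraph) where
  verts : Set X.V
  edges : Set X.E
  src_mem : ∀ e ∈ edges, X.src e ∈ verts
  tgt_mem : ∀ e ∈ edges, X.tgt e ∈ verts

/-- The subset of the realization covered by a subgraph. -/
def Sub.carrier {X : FinGraph} (Y : X.Sub) : Set X.Space :=
  X.vertex '' Y.verts ∪ ⋃ e ∈ Y.edges, Set.range (X.edge e)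

end FinGraph

/-! ### Carrier graphs -/

section Carrier

variable {M : HypManifold} {X X' : FinGraph}

/-- `f : X → M` is a carrier graph: `X` is connected and `f_* : π₁(X) → π₁(M)` is surjective. -/
def IsCarrierGraph (f : C(X.Space, M.Carrier)) : Prop :=
  ConnectedSpace X.Space ∧ ∀ x, Function.Surjective (FundamentalGroup.map f x)

/-- Equivalence of carrier graphs: there is a homotopy equivalence `h : X → X'` such that `f` and
`f' ∘ h` are freely homotopic. -/
def CarrierEquiv (f : C(X.Space, M.Carrier)) (f' : C(X'.Space, M.Carrier)) : Prop :=
  ∃ h : ContinuousMap.HomotopyEquiv X.Space X'.Space, f.Homotopic (f'.comp h.toFun)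

/-- The length of an edge of `X` with respect to `f : X → M`. -/
def edgeLength (f : C(X.Space, M.Carrier)) (e : X.E) : ℝ≥0∞ := M.pathLength (f.comp (X.edge e))

/-- The length of `f : X → M`: the sum of the lengths of the edges. -/
def graphLength (f : C(X.Space, M.Carrier)) : ℝ≥0∞ := ∑ e, edgeLength f e

/-- `f : X → M` is a carrier graph of minimal length in its equivalence class. -/
def IsMinimalLength (f : C(X.Space, M.Carrier)) : Prop :=
  IsCarrierGraph f ∧ ∀ (X' : FinGraph) (f' : C(X'.Space, M.Carrier)),
    IsCarrierGraph f' → CarrierEquiv f f' → graphLength f ≤ graphLength f'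

/-- `Y` is a connected `A`-quasi-convex subgraph of `f : X → M`. -/
def IsQuasiConvexSub (f : C(X.Space, M.Carrier)) (Y : X.Sub) (A : ℝ) : Prop :=
  IsConnected Y.carrier ∧ IsQuasiConvexMap (f.restrict Y.carrier) A

end Carrier

end

noncomputable section

/-! ### Geometry of hyperbolic space -/

namespace HypSpace

/-! Assume that all edges outside the `Y i` are long. After one-vertex subgraphs have been added for
the vertices in no `Y i`, every path class between vertices is an alternating product of blocks
(classes of paths inside one subgraph) and outer edges. Choose such a word with as few outer edges
as possible. The claim is that its lift to hyperbolic space runs almost straight: only a bounded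
distance is lost at every junction, and the long edges more than pay for it. Hence the length of a
class is bounded linearly by the displacement of its lift (`exists_long_edges_const`). This is the
nontrivial half of the quasi-isometry inequality. It also shows that a class with an outer edge in
its shortest word has positive displacement, while a nontrivial loop inside a block has displacement
at least `1 / A`. So `f` is injective on fundamental groups; being surjective as well, it identifies
the fundamental group of the manifold with that of a finite graph, which is free
(`isFreeGroup_fundamentalGroup`).

The passage from local to global is Gromov hyperbolicity: `four_point`, deduced from Ptolemy's
inequality, shows that errors at consecutive junctions do not accumulate when the edges between them
are long.

The local estimates come from minimality, in the form that no edge gets shorter when its ends slide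
along the rest of the graph (`IsMinimalLength.edgeLen_le_disp_slide`); subdivision allows sliding to
interior points of edges, and even of a piece of an edge along the remaining piece.

At a junction of an edge and a block, sliding along the block shows that no point of the block is
nearer to the far end of the edge than the attaching point. The lift of a nearly shortest
representative of the block class is a quasi-geodesic which never gets closer to that far end than
at its start, so it moves away at full rate (`exists_dist_ge_of_quasigeodesic`, proved with the
visual metric seen from the far end); this is `exists_efficient_const`.

For two outer edges joined by a block (`exists_edge_pair_const`), a long block is handled by the
four point condition. If the block is short, inefficiency forces the two edges to fellow-travel up
to some fixed depth `D`. For different edges, or one edge traversed twice in the same direction,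
sliding along the parallel strand would then save length. For an edge traversed back and forth
around a loop, the isometry of the loop moves both ends of a segment of length `D` a bounded amount,
hence moves its midpoint very little (`exists_midpoint_close`), against the lower bound on
translation lengths; a trivial loop would give a word with fewer outer edges.

Throughout, universal covers are replaced by homotopy classes of paths: `disp` is the distance
between the end points of a lift, and `classLen` the infimum of the lengths in the class. -/

theorem sinh_half_mul (p q : HypSpace) :
    Real.sinh (dist p q / 2) * (2 * (√p.t * √q.t)) = dist p.toE q.toE := by
  have hp := Real.sqrt_pos.2 p.t_pos
  have hq := Real.sqrt_pos.2 q.t_pos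
  rw [sinh_half, Real.sqrt_mul p.t_pos.le]
  field_simp

theorem cosh_half_mul (p q : HypSpace) :
    Real.cosh (dist p q / 2) * (2 * (√p.t * √q.t)) = dist p.toE q.refl := by
  have hp := Real.sqrt_pos.2 p.t_pos
  have hq := Real.sqrt_pos.2 q.t_pos
  rw [cosh_half, Real.sqrt_mul p.t_pos.le]
  field_simp

/-- Ptolemy's inequality in hyperbolic space. -/
theorem ptolemy (a b c d : HypSpace) :
    Real.sinh (dist a c / 2) * Real.sinh (dist b d / 2) ≤
      Real.sinh (dist a b / 2) * Real.sinh (dist c d / 2) +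
        Real.sinh (dist b c / 2) * Real.sinh (dist a d / 2) := by
  have h := EuclideanGeometry.mul_dist_le_mul_dist_add_mul_dist a.toE b.toE c.toE d.toE
  simp only [← sinh_half_mul] at h
  have ha := Real.sqrt_pos.2 a.t_pos
  have hb := Real.sqrt_pos.2 b.t_pos
  have hc := Real.sqrt_pos.2 c.t_pos
  have hd := Real.sqrt_pos.2 d.t_pos
  -- Each of the three products of opposite sides carries the same factor, four times the product of
  -- the four square roots of heights.
  refine le_of_mul_le_mul_right (a := 4 * (√a.t * √b.t * √c.t * √d.t)) ?_ (by positivity)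
  linarith

/-- Ptolemy's inequality with one of the four points in the opposite half space. -/
theorem ptolemy_refl (x y z w : HypSpace) :
    Real.sinh (dist x z / 2) * Real.cosh (dist y w / 2) ≤
      Real.sinh (dist x y / 2) * Real.cosh (dist z w / 2) +
        Real.sinh (dist y z / 2) * Real.cosh (dist x w / 2) := by
  have h := EuclideanGeometry.mul_dist_le_mul_dist_add_mul_dist x.toE y.toE z.toE w.refl
  simp only [← sinh_half_mul, ← cosh_half_mul] at h
  have ha := Real.sqrt_pos.2 x.t_pos
  have hb := Real.sqrt_pos.2 y.t_pos
  have hc := Real.sqrt_pos.2 z.t_pos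
  have hd := Real.sqrt_pos.2 w.t_pos
  refine le_of_mul_le_mul_right (a := 4 * (√x.t * √y.t * √z.t * √w.t)) ?_ (by positivity)
  linarith

theorem sinh_le_exp_half (x : ℝ) : Real.sinh x ≤ Real.exp x / 2 := by
  rw [Real.sinh_eq]; linarith [Real.exp_pos (-x)]

theorem exp_le_four_sinh {x : ℝ} (hx : 1 / 2 ≤ x) : Real.exp x ≤ 4 * Real.sinh x := by
  rw [Real.sinh_eq]
  have h1 : Real.exp (-x) * Real.exp x = 1 := by rw [← Real.exp_add]; simp
  have h2 : 2 ≤ Real.exp x * Real.exp x := by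
    rw [← Real.exp_add]; linarith [Real.add_one_le_exp (x + x)]
  nlinarith [Real.exp_pos x, Real.exp_pos (-x)]

theorem cosh_le_exp {x : ℝ} (hx : 0 ≤ x) : Real.cosh x ≤ Real.exp x := by
  rw [Real.cosh_eq]; linarith [Real.exp_le_exp.2 (show -x ≤ x by linarith)]

theorem exp_le_two_cosh (x : ℝ) : Real.exp x ≤ 2 * Real.cosh x := by
  rw [Real.cosh_eq]; linarith [Real.exp_pos (-x)]

/-- The four point condition: hyperbolic space is Gromov hyperbolic. -/
theorem four_point (a b c d : HypSpace) :
    dist a c + dist b d ≤ max (dist a b + dist c d) (dist a d + dist b c) + 8 := by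
  -- The comparison of `sinh` with `exp` fails near zero, so a short diagonal is treated by the
  -- triangle inequality.
  by_cases h1 : dist a c ≤ 1
  · have : dist a d + dist b c ≤ max (dist a b + dist c d) (dist a d + dist b c) := le_max_right _ _
    linarith [dist_triangle b a d, dist_triangle b c a, dist_comm a c]
  by_cases h2 : dist b d ≤ 1
  · have : dist a d + dist b c ≤ max (dist a b + dist c d) (dist a d + dist b c) := le_max_right _ _
    linarith [dist_triangle a d c, dist_triangle d b c, dist_comm b d]
  push Not at h1 h2
  have h := ptolemy a b c d
  have k1 := exp_le_four_sinh (x := dist a c / 2) (by linarith)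
  have k2 := exp_le_four_sinh (x := dist b d / 2) (by linarith)
  have s (x y : HypSpace) : 0 ≤ Real.sinh (dist x y / 2) := Real.sinh_nonneg_iff.2 (by positivity)
  have l1 : Real.sinh (dist a b / 2) * Real.sinh (dist c d / 2) ≤
      Real.exp (max (dist a b + dist c d) (dist a d + dist b c) / 2) / 4 := by
    calc _ ≤ (Real.exp (dist a b / 2) / 2) * (Real.exp (dist c d / 2) / 2) :=
          mul_le_mul (sinh_le_exp_half _) (sinh_le_exp_half _) (s _ _) (by positivity)
      _ = Real.exp ((dist a b + dist c d) / 2) / 4 := by rw [add_div, Real.exp_add]; ring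
      _ ≤ _ := by gcongr; exact le_max_left _ _
  have l2 : Real.sinh (dist b c / 2) * Real.sinh (dist a d / 2) ≤
      Real.exp (max (dist a b + dist c d) (dist a d + dist b c) / 2) / 4 := by
    calc _ ≤ (Real.exp (dist b c / 2) / 2) * (Real.exp (dist a d / 2) / 2) :=
          mul_le_mul (sinh_le_exp_half _) (sinh_le_exp_half _) (s _ _) (by positivity)
      _ = Real.exp ((dist a d + dist b c) / 2) / 4 := by rw [add_div, Real.exp_add]; ring
      _ ≤ _ := by gcongr; exact le_max_right _ _
  generalize max (dist a b + dist c d) (dist a d + dist b c) = m at *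
  -- The two lower bounds lose a factor `16` and each product on the right gains `1 / 4`; hence `8`,
  -- which is below `exp 4`. Doubling the exponent gives the additive constant `8`.
  have k3 : Real.exp ((dist a c + dist b d) / 2) ≤ 8 * Real.exp (m / 2) := by
    rw [add_div, Real.exp_add]
    nlinarith [mul_le_mul k1 k2 (Real.exp_pos _).le (by nlinarith [s a c])]
  have k4 : (8 : ℝ) ≤ Real.exp 4 := by
    have := Real.add_one_le_exp (2 : ℝ)
    rw [show (4 : ℝ) = 2 + 2 by norm_num, Real.exp_add]; nlinarith
  have k5 : Real.exp ((dist a c + dist b d) / 2) ≤ Real.exp (4 + m / 2) := by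
    rw [Real.exp_add]; nlinarith [Real.exp_pos (m / 2)]
  linarith [Real.exp_le_exp.1 k5]

/-! ### Visual metrics and quasi-geodesics -/

/-- The visual distance of `x` and `y`, seen from `w`. -/
def vis (w x y : HypSpace) : ℝ :=
  Real.sinh (dist x y / 2) / (Real.cosh (dist x w / 2) * Real.cosh (dist y w / 2))

theorem vis_self (w x : HypSpace) : vis w x x = 0 := by simp [vis]

/-- In the unit ball model centred at `w`, `vis w` is the Euclidean distance. The inequality is
`ptolemy_refl` divided by the three hyperbolic cosines of the half distances to `w`. -/
theorem vis_triangle (w x y z : HypSpace) : vis w x z ≤ vis w x y + vis w y z := by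
  have h := ptolemy_refl x y z w
  have hx := Real.cosh_pos (dist x w / 2)
  have hy := Real.cosh_pos (dist y w / 2)
  have hz := Real.cosh_pos (dist z w / 2)
  unfold vis
  rw [div_add_div _ _ (by positivity) (by positivity), div_le_div_iff₀ (by positivity)
    (by positivity)]
  nlinarith [mul_le_mul_of_nonneg_left h
    (show 0 ≤ Real.cosh (dist x w / 2) * Real.cosh (dist z w / 2) * Real.cosh (dist y w / 2) by
      positivity)]

theorem vis_le_sum (w : HypSpace) (x : ℕ → HypSpace) (n : ℕ) :
    vis w (x 0) (x n) ≤ ∑ i ∈ Finset.range n, vis w (x i) (x (i + 1)) := by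
  induction n with
  | zero => simp [vis_self]
  | succ n ih => rw [Finset.sum_range_succ]; linarith [vis_triangle w (x 0) (x n) (x (n + 1))]

theorem sinh_half_le {d : ℝ} (h0 : 0 ≤ d) (h1 : d ≤ 1) : Real.sinh (d / 2) ≤ d := by
  have h2 := abs_le.1 (Real.abs_exp_sub_one_sub_id_le (x := d / 2) (by rw [abs_le]; constructor <;> linarith))
  have h3 := Real.add_one_le_exp (-(d / 2))
  rw [Real.sinh_eq]
  nlinarith [h2.2]

/-- `∑ dᵢ exp(-κ sᵢ)` is bounded, if `sᵢ` are the partial sums of the `dᵢ ≤ 1`. -/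
theorem sum_mul_exp_le {κ : ℝ} (hκ : 0 < κ) (d : ℕ → ℝ) (n : ℕ)
    (h0 : ∀ i < n, 0 ≤ d i) (h1 : ∀ i < n, d i ≤ 1) :
    ∑ i ∈ Finset.range n, d i * Real.exp (-κ * ∑ j ∈ Finset.range i, d j) ≤
      Real.exp κ / κ * (1 - Real.exp (-κ * ∑ j ∈ Finset.range n, d j)) := by
  induction n with
  | zero => simp
  | succ n ih =>
    rw [Finset.sum_range_succ]
    have ih := ih (fun i hi => h0 i (hi.trans n.lt_succ_self)) fun i hi => h1 i (hi.trans n.lt_succ_self)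
    refine (add_le_add_left ih _).trans ?_
    rw [Finset.sum_range_succ _ n, mul_add, Real.exp_add]
    have hE := Real.exp_pos (-κ * ∑ j ∈ Finset.range n, d j)
    generalize Real.exp (-κ * ∑ j ∈ Finset.range n, d j) = E at *
    have hd0 := h0 n n.lt_succ_self
    have hd1 := h1 n n.lt_succ_self
    generalize d n = δ at *
    have e1 : Real.exp (-κ * δ) * Real.exp (κ * δ) = 1 := by rw [← Real.exp_add]; simp
    have e2 := Real.add_one_le_exp (κ * δ)
    have e3 : Real.exp κ * Real.exp (-κ * δ) ≥ 1 := by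
      rw [← Real.exp_add]; exact Real.one_le_exp (by nlinarith)
    have e4 : κ * δ ≤ Real.exp κ * (1 - Real.exp (-κ * δ)) := by
      have : κ * δ * Real.exp (-κ * δ) ≤ 1 - Real.exp (-κ * δ) := by
        nlinarith [Real.exp_pos (-κ * δ)]
      nlinarith [mul_le_mul_of_nonneg_left this (Real.exp_pos κ).le, mul_nonneg hκ.le hd0]
    -- One step of the comparison with the integral of `exp (-κ s)`: the factor `exp κ` pays for
    -- evaluating the integrand at the left end of a step of length at most `1`. Multiplied by `E`,
    -- the right side telescopes.
    have e5 : δ ≤ Real.exp κ / κ * (1 - Real.exp (-κ * δ)) := by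
      rw [div_mul_eq_mul_div, le_div_iff₀ hκ]; linarith
    nlinarith [mul_le_mul_of_nonneg_right e5 hE.le]

set_option maxHeartbeats 1000000 in
/-- A sequence of points which is quasi-geodesic with respect to its first point, and which never
gets closer to `m` than at its first point, moves away from `m` at the fastest rate, up to a
constant. -/
theorem exists_dist_ge_of_quasigeodesic (A B : ℝ) (hA : 0 < A) (hB : 0 ≤ B) :
    ∃ C : ℝ, 0 ≤ C ∧ ∀ (m : HypSpace) (x : ℕ → HypSpace) (N : ℕ),
      (∀ i < N, dist (x i) (x (i + 1)) ≤ 1) →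
      (∀ i ≤ N, ∑ j ∈ Finset.range i, dist (x j) (x (j + 1)) ≤ A * dist (x 0) (x i) + B) →
      (∀ i ≤ N, dist (x 0) m ≤ dist (x i) m) →
      dist (x 0) m + dist (x 0) (x N) ≤ dist (x N) m + C := by
  set C₁ : ℝ := 8 * (4 * A + B) + 2 with hC₁
  have hC₁' : 2 ≤ C₁ := by rw [hC₁]; nlinarith
  set κ : ℝ := 1 / (4 * A) with hκ
  have hκ0 : 0 < κ := by positivity
  set C₂ : ℝ := 4 * C₁ ^ 2 * Real.exp (B / (4 * A)) * (Real.exp κ / κ) with hC₂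
  have hC₂' : 0 < C₂ := by positivity
  refine ⟨2 * Real.log (4 * C₂ + 2), ?_, fun m x N h1 h2 h3 => ?_⟩
  · have := Real.log_nonneg (show 1 ≤ 4 * C₂ + 2 by linarith); linarith
  set R := dist (x 0) m with hR
  have hR0 : 0 ≤ R := dist_nonneg
  have first : ∀ i ≤ N, Real.exp (R / 2) * Real.exp (dist (x 0) (x i) / 4) ≤
      C₁ * Real.exp (dist (x i) m / 2) := by
    intro i hi
    have hD : 0 ≤ dist (x 0) (x i) := dist_nonneg
    have hm := h3 i hi
    have s2 := h2 i hi
    have hsum : vis m (x 0) (x i) ≤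
        (∑ j ∈ Finset.range i, dist (x j) (x (j + 1))) / Real.cosh (R / 2) ^ 2 := by
      refine (vis_le_sum m x i).trans ?_
      rw [Finset.sum_div]
      refine Finset.sum_le_sum fun j hj => ?_
      have hj := (Finset.mem_range.1 hj)
      have c1 : Real.cosh (R / 2) ≤ Real.cosh (dist (x j) m / 2) := by
        rw [Real.cosh_le_cosh, abs_of_nonneg (by positivity), abs_of_nonneg (by positivity)]
        linarith [h3 j (by omega)]
      have c2 : Real.cosh (R / 2) ≤ Real.cosh (dist (x (j + 1)) m / 2) := by
        rw [Real.cosh_le_cosh, abs_of_nonneg (by positivity), abs_of_nonneg (by positivity)]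
        linarith [h3 (j + 1) (by omega)]
      have c0 := Real.cosh_pos (R / 2)
      unfold vis
      rw [pow_two]
      exact div_le_div₀ dist_nonneg (sinh_half_le dist_nonneg (h1 j (by omega))) (by positivity)
        (mul_le_mul c1 c2 c0.le (c0.le.trans c1))
    unfold vis at hsum
    rw [← hR] at hsum
    have hs0 : 0 ≤ ∑ j ∈ Finset.range i, dist (x j) (x (j + 1)) :=
      Finset.sum_nonneg fun _ _ => dist_nonneg
    generalize dist (x 0) (x i) = D at *
    generalize ∑ j ∈ Finset.range i, dist (x j) (x (j + 1)) = S at *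
    have hexp : Real.exp (R / 2) ≤ Real.exp (dist (x i) m / 2) := Real.exp_le_exp.2 (by linarith)
    by_cases hD1 : D ≤ 1
    · have : Real.exp (D / 4) ≤ 2 := by
        have := Real.exp_le_exp.2 (show D / 4 ≤ Real.log 2 by linarith [Real.log_two_gt_d9])
        rwa [Real.exp_log two_pos] at this
      calc _ ≤ Real.exp (dist (x i) m / 2) * 2 := by gcongr
        _ ≤ _ := by nlinarith [Real.exp_pos (dist (x i) m / 2)]
    · push Not at hD1
      have k1 := exp_le_four_sinh (x := D / 2) (by linarith)
      have k2 := exp_le_two_cosh (R / 2)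
      have k3 := cosh_le_exp (x := dist (x i) m / 2) (by positivity)
      have k4 : S ≤ (4 * A + B) * Real.exp (D / 4) := by
        nlinarith [Real.add_one_le_exp (D / 4)]
      have c0 := Real.cosh_pos (R / 2)
      have c1 := Real.cosh_pos (dist (x i) m / 2)
      rw [div_le_div_iff₀ (by positivity) (by positivity)] at hsum
      have k5 : Real.sinh (D / 2) * Real.cosh (R / 2) ≤ S * Real.cosh (dist (x i) m / 2) :=
        le_of_mul_le_mul_right (a := Real.cosh (R / 2)) (by linarith) c0
      have k6 : Real.exp (D / 2) * Real.exp (R / 2) ≤ 8 * (S * Real.cosh (dist (x i) m / 2)) := by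
        nlinarith [mul_le_mul k1 k2 (Real.exp_pos _).le (by linarith [Real.exp_pos (D / 2)])]
      have k7 : S * Real.cosh (dist (x i) m / 2) ≤
          ((4 * A + B) * Real.exp (D / 4)) * Real.exp (dist (x i) m / 2) :=
        mul_le_mul k4 k3 c1.le (by positivity)
      have k8 : Real.exp (D / 2) = Real.exp (D / 4) * Real.exp (D / 4) := by
        rw [← Real.exp_add]; ring_nf
      rw [k8] at k6
      have k9 : Real.exp (R / 2) * Real.exp (D / 4) ≤
          8 * (4 * A + B) * Real.exp (dist (x i) m / 2) :=
        le_of_mul_le_mul_right (a := Real.exp (D / 4)) (by linarith) (Real.exp_pos _)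
      nlinarith [Real.exp_pos (dist (x i) m / 2)]
  -- Second pass: by `first`, the visual size of the steps decays exponentially in the length
  -- travelled, so the total visual length is of order `exp (-R)`.
  have hsum : vis m (x 0) (x N) ≤ C₂ * Real.exp (-R) := by
    refine (vis_le_sum m x N).trans ?_
    have key : ∀ i ∈ Finset.range N, vis m (x i) (x (i + 1)) ≤
        4 * C₁ ^ 2 * Real.exp (B / (4 * A)) * Real.exp (-R) * (dist (x i) (x (i + 1)) *
          Real.exp (-κ * ∑ j ∈ Finset.range i, dist (x j) (x (j + 1)))) := by
      intro i hi
      have hi := Finset.mem_range.1 hi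
      have f1 := first i (by omega)
      have f2 := first (i + 1) (by omega)
      have g2 : Real.exp (R / 2) ≤ C₁ * Real.exp (dist (x (i + 1)) m / 2) := by
        refine le_trans ?_ f2
        have := Real.one_le_exp (show 0 ≤ dist (x 0) (x (i + 1)) / 4 by positivity)
        nlinarith [Real.exp_pos (R / 2)]
      have c1 := exp_le_two_cosh (dist (x i) m / 2)
      have c2 := exp_le_two_cosh (dist (x (i + 1)) m / 2)
      have c1' := Real.cosh_pos (dist (x i) m / 2)
      have c2' := Real.cosh_pos (dist (x (i + 1)) m / 2)
      have s1 := sinh_half_le dist_nonneg (h1 i hi)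
      have s2 := h2 i hi.le
      -- The quasi-geodesic inequality converts decay in the distance into decay in the length; this
      -- dictates `κ = 1 / (4 * A)`.
      have e1 : Real.exp (-(dist (x 0) (x i) / 4)) ≤ Real.exp (B / (4 * A)) *
          Real.exp (-κ * ∑ j ∈ Finset.range i, dist (x j) (x (j + 1))) := by
        rw [← Real.exp_add]
        refine Real.exp_le_exp.2 ?_
        rw [hκ]
        generalize ∑ j ∈ Finset.range i, dist (x j) (x (j + 1)) = S at *
        have : (S - B) / (4 * A) ≤ dist (x 0) (x i) / 4 := by
          rw [div_le_div_iff₀ (by positivity) (by positivity)]; nlinarith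
        calc _ ≤ -((S - B) / (4 * A)) := by linarith
          _ = _ := by ring
      have e2 : Real.exp (-(dist (x 0) (x i) / 4)) * Real.exp (dist (x 0) (x i) / 4) = 1 := by
        rw [← Real.exp_add]; simp
      have e3 : Real.exp (-R) * (Real.exp (R / 2) * Real.exp (R / 2)) = 1 := by
        rw [← Real.exp_add, ← Real.exp_add]; ring_nf; exact Real.exp_zero
      generalize ∑ j ∈ Finset.range i, dist (x j) (x (j + 1)) = S at *
      unfold vis
      rw [div_le_iff₀ (by positivity)]
      refine s1.trans ?_
      have hd : 0 ≤ dist (x i) (x (i + 1)) := dist_nonneg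
      generalize dist (x i) (x (i + 1)) = δ at *
      generalize Real.cosh (dist (x i) m / 2) = a at *
      generalize Real.cosh (dist (x (i + 1)) m / 2) = b at *
      generalize Real.exp (dist (x i) m / 2) = a' at *
      generalize Real.exp (dist (x (i + 1)) m / 2) = b' at *
      have q1 : Real.exp (R / 2) * Real.exp (dist (x 0) (x i) / 4) ≤ C₁ * (2 * a) :=
        f1.trans (by gcongr)
      have q2 : Real.exp (R / 2) ≤ C₁ * (2 * b) := g2.trans (by gcongr)
      have q3 := mul_le_mul q1 q2 (Real.exp_pos _).le (by positivity)
      have q4 : 1 ≤ 4 * C₁ ^ 2 * Real.exp (B / (4 * A)) * Real.exp (-R) * Real.exp (-κ * S) *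
          (a * b) := by
        calc (1 : ℝ) = Real.exp (-(dist (x 0) (x i) / 4)) * Real.exp (-R) *
            (Real.exp (R / 2) * Real.exp (dist (x 0) (x i) / 4) * Real.exp (R / 2)) := by
              linear_combination (-1 : ℝ) * e3 - Real.exp (-R) * Real.exp (R / 2) ^ 2 * e2
          _ ≤ Real.exp (-(dist (x 0) (x i) / 4)) * Real.exp (-R) * (C₁ * (2 * a) * (C₁ * (2 * b))) := by
              gcongr
          _ ≤ (Real.exp (B / (4 * A)) * Real.exp (-κ * S)) * Real.exp (-R) *
              (C₁ * (2 * a) * (C₁ * (2 * b))) := by gcongr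
          _ = _ := by ring
      nlinarith [mul_le_mul_of_nonneg_left q4 hd]
    refine (Finset.sum_le_sum key).trans ?_
    rw [← Finset.mul_sum]
    have := sum_mul_exp_le hκ0 (fun i => dist (x i) (x (i + 1))) N (fun _ _ => dist_nonneg) h1
    have e := Real.exp_pos (-κ * ∑ j ∈ Finset.range N, dist (x j) (x (j + 1)))
    calc _ ≤ 4 * C₁ ^ 2 * Real.exp (B / (4 * A)) * Real.exp (-R) * (Real.exp κ / κ * 1) := by
          gcongr
          refine this.trans ?_
          gcongr
          linarith
      _ = _ := by rw [hC₂]; ring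
  -- Unwinding the bound on `vis` gives the conclusion in exponential form. A short distance from `x
  -- 0` to `x N` needs only the monotonicity assumption.
  have hexp : Real.exp ((R + dist (x 0) (x N)) / 2) ≤
      (4 * C₂ + 2) * Real.exp (dist (x N) m / 2) := by
    have hm := h3 N le_rfl
    have e0 := Real.exp_pos (dist (x N) m / 2)
    by_cases hD1 : dist (x 0) (x N) ≤ 1
    · have : Real.exp (dist (x 0) (x N) / 2) ≤ 2 := by
        have := Real.exp_le_exp.2
          (show dist (x 0) (x N) / 2 ≤ Real.log 2 by linarith [Real.log_two_gt_d9])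
        rwa [Real.exp_log two_pos] at this
      have h' : Real.exp (R / 2) ≤ Real.exp (dist (x N) m / 2) := Real.exp_le_exp.2 (by linarith)
      rw [add_div, Real.exp_add]
      have h5 := mul_le_mul h' this (Real.exp_pos _).le e0.le
      linarith [mul_pos hC₂' e0]
    · push Not at hD1
      unfold vis at hsum
      rw [← hR] at hsum
      have k1 := exp_le_four_sinh (x := dist (x 0) (x N) / 2) (by linarith)
      have k2 := cosh_le_exp (x := R / 2) (by positivity)
      have k3 := cosh_le_exp (x := dist (x N) m / 2) (by positivity)
      have c0 := Real.cosh_pos (R / 2)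
      have c1 := Real.cosh_pos (dist (x N) m / 2)
      rw [div_le_iff₀ (by positivity)] at hsum
      have e3 : Real.exp (-R) * (Real.exp (R / 2) * Real.exp (R / 2)) = 1 := by
        rw [← Real.exp_add, ← Real.exp_add]; ring_nf; exact Real.exp_zero
      have k4 : Real.sinh (dist (x 0) (x N) / 2) ≤
          C₂ * Real.exp (-R) * (Real.exp (R / 2) * Real.exp (dist (x N) m / 2)) :=
        hsum.trans (by gcongr)
      rw [add_div, Real.exp_add]
      have k5 : Real.exp (R / 2) * Real.sinh (dist (x 0) (x N) / 2) ≤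
          C₂ * Real.exp (dist (x N) m / 2) := by
        calc _ ≤ Real.exp (R / 2) * (C₂ * Real.exp (-R) *
              (Real.exp (R / 2) * Real.exp (dist (x N) m / 2))) := by gcongr
          _ = _ := by linear_combination C₂ * Real.exp (dist (x N) m / 2) * e3
      linarith [mul_le_mul_of_nonneg_left k1 (Real.exp_pos (R / 2)).le]
  have hl : 0 < 4 * C₂ + 2 := by linarith
  rw [← Real.exp_log hl, ← Real.exp_add, Real.exp_le_exp] at hexp
  linarith

end HypSpace

end

/-! ### Geodesics and midpoints from hyperboloid coordinates -/

noncomputable section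

namespace HypSpace

theorem cosh_dist (p q : HypSpace) :
    Real.cosh (dist p q) = 1 + dist p.toE q.toE ^ 2 / (2 * (p.t * q.t)) := by
  have hp := p.t_pos
  have hq := q.t_pos
  have h := Real.cosh_two_mul (dist p q / 2)
  rw [mul_div_cancel₀ _ two_ne_zero, Real.cosh_sq', sinh_half, div_pow, mul_pow,
    Real.sq_sqrt (by positivity)] at h
  rw [h]
  field_simp
  ring

/-- The hyperbolic distance in terms of the coordinates `1/t`, `z/t` and `(|z|² + t²)/t` of the
hyperboloid model. -/
theorem cosh_dist_eq (p q : HypSpace) :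
    Real.cosh (dist p q) = (p.t⁻¹ * ((‖q.z‖ ^ 2 + q.t ^ 2) * q.t⁻¹) +
      (‖p.z‖ ^ 2 + p.t ^ 2) * p.t⁻¹ * q.t⁻¹) / 2 - p.t⁻¹ * q.t⁻¹ * (inner ℝ p.z q.z) := by
  have hp := p.t_pos
  have hq := q.t_pos
  rw [cosh_dist, toE_sq, norm_sub_sq_real]
  field_simp
  ring

/-- In the hyperboloid model `cosh` of the distance is, up to sign, the Minkowski product, hence
linear in each point. The equation `h` says that the combination of `p` and `q` lies again on the
hyperboloid. -/
theorem exists_combination (p q : HypSpace) (α β : ℝ) (hα : 0 ≤ α) (hβ : 0 ≤ β)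
    (h : α ^ 2 + β ^ 2 + 2 * α * β * Real.cosh (dist p q) = 1) :
    ∃ r : HypSpace, ∀ y, Real.cosh (dist r y) =
      α * Real.cosh (dist p y) + β * Real.cosh (dist q y) := by
  have hp := p.t_pos
  have hq := q.t_pos
  have hu : 0 < α * p.t⁻¹ + β * q.t⁻¹ := by
    rcases hα.eq_or_lt with rfl | hα
    · rcases hβ.eq_or_lt with rfl | hβ
      · simp at h
      · positivity
    · positivity
  -- The point is read off from the coordinates `1 / t` and `z / t`, which combine linearly.
  refine ⟨⟨(α * p.t⁻¹ + β * q.t⁻¹)⁻¹ • ((α * p.t⁻¹) • p.z + (β * q.t⁻¹) • q.z),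
    (α * p.t⁻¹ + β * q.t⁻¹)⁻¹, inv_pos.2 hu⟩, fun y => ?_⟩
  have hy := y.t_pos
  rw [cosh_dist_eq] at h
  simp only [cosh_dist_eq, norm_smul, inner_smul_left, inner_add_left, mul_pow, inv_inv]
  rw [norm_add_sq_real]
  simp only [norm_smul, inner_smul_left, inner_smul_right, Real.norm_eq_abs, sq_abs, mul_pow,
    RCLike.conj_to_real, abs_inv, abs_of_pos hu]
  generalize inner ℝ p.z y.z = a at *
  generalize inner ℝ q.z y.z = b at *
  generalize inner ℝ p.z q.z = c at *
  generalize ‖p.z‖ ^ 2 = x1 at *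
  generalize ‖q.z‖ ^ 2 = x2 at *
  generalize ‖y.z‖ ^ 2 = x3 at *
  -- The normalization `h` makes the remaining coordinate `(|z|² + t²) / t` combine linearly too.
  have key : (α * p.t⁻¹) ^ 2 * x1 + 2 * (α * p.t⁻¹ * (β * q.t⁻¹ * c)) + (β * q.t⁻¹) ^ 2 * x2 + 1 =
      (α * p.t⁻¹ + β * q.t⁻¹) * (α * ((x1 + p.t ^ 2) * p.t⁻¹) + β * ((x2 + q.t ^ 2) * q.t⁻¹)) := by
    rw [← h]
    field_simp
    ring
  set u := α * p.t⁻¹ + β * q.t⁻¹ with hu'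
  have hi : u⁻¹ * u = 1 := inv_mul_cancel₀ hu.ne'
  set N := (α * p.t⁻¹) ^ 2 * x1 + 2 * (α * p.t⁻¹ * (β * q.t⁻¹ * c)) + (β * q.t⁻¹) ^ 2 * x2 with hN
  have e1 : (u⁻¹ ^ 2 * (((α * p.t⁻¹) ^ 2 * x1) + 2 * (α * p.t⁻¹ * (β * q.t⁻¹ * c)) +
      (β * q.t⁻¹) ^ 2 * x2) + u⁻¹ ^ 2) * u =
      α * ((x1 + p.t ^ 2) * p.t⁻¹) + β * ((x2 + q.t ^ 2) * q.t⁻¹) := by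
    rw [← hN]
    calc _ = u⁻¹ * (N + 1) * (u⁻¹ * u) := by ring
      _ = u⁻¹ * (u * (α * ((x1 + p.t ^ 2) * p.t⁻¹) + β * ((x2 + q.t ^ 2) * q.t⁻¹))) := by
        rw [hi, key, mul_one]
      _ = (u⁻¹ * u) * (α * ((x1 + p.t ^ 2) * p.t⁻¹) + β * ((x2 + q.t ^ 2) * q.t⁻¹)) := by ring
      _ = _ := by rw [hi, one_mul]
  have e2 : u * y.t⁻¹ * (u⁻¹ * (α * p.t⁻¹ * a + β * q.t⁻¹ * b)) =
      y.t⁻¹ * (α * p.t⁻¹ * a + β * q.t⁻¹ * b) := by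
    linear_combination y.t⁻¹ * (α * p.t⁻¹ * a + β * q.t⁻¹ * b) * hi
  simp only [mul_pow] at e1 e2 ⊢
  linear_combination (y.t⁻¹ / 2) * e1 - e2 + (x3 + y.t ^ 2) * y.t⁻¹ / 2 * hu'

theorem dist_eq_of_cosh_eq {p q : HypSpace} {x : ℝ} (hx : 0 ≤ x)
    (h : Real.cosh (dist p q) = Real.cosh x) : dist p q = x := by
  have h1 := Real.cosh_le_cosh.1 h.le
  have h2 := Real.cosh_le_cosh.1 h.ge
  rw [abs_of_nonneg hx, abs_of_nonneg dist_nonneg] at *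
  exact le_antisymm h1 h2

/-- Any two points are joined by a geodesic. -/
theorem exists_geodesic (p q : HypSpace) :
    ∃ γ : Path p q, ∀ s t, dist (γ s) (γ t) = dist p q * |(s : ℝ) - t| := by
  rcases eq_or_ne p q with rfl | hpq
  · exact ⟨Path.refl p, fun s t => by simp⟩
  have hℓ : 0 < dist p q := dist_pos.2 hpq
  have hs := Real.sinh_pos_iff.2 hℓ
  set ℓ := dist p q with hℓ'
  -- The coefficients of spherical interpolation with `sin` replaced by `sinh`.
  have key : ∀ s : I, ∃ r : HypSpace, ∀ y, Real.cosh (dist r y) =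
      Real.sinh (ℓ - ℓ * s) / Real.sinh ℓ * Real.cosh (dist p y) +
        Real.sinh (ℓ * s) / Real.sinh ℓ * Real.cosh (dist q y) := by
    intro s
    refine exists_combination p q _ _ ?_ ?_ ?_
    · exact div_nonneg (Real.sinh_nonneg_iff.2 (by nlinarith [s.2.2])) hs.le
    · exact div_nonneg (Real.sinh_nonneg_iff.2 (by nlinarith [s.2.1])) hs.le
    · rw [← hℓ', Real.sinh_sub]
      have h1 := Real.cosh_sq (ℓ * s)
      have h2 := Real.cosh_sq ℓ
      field_simp
      rw [show Real.sinh ℓ ^ 2 = Real.cosh ℓ ^ 2 - 1 by linarith]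
      linear_combination (Real.cosh ℓ ^ 2 - 1) * h1 - Real.sinh (ℓ * s) ^ 2 * h2 + h2 * Real.cosh (ℓ * s) ^ 2 -
        (2 * Real.cosh (ℓ * s) ^ 2 - Real.sinh (ℓ * s) ^ 2) * h2
  choose r hr using key
  -- Applying the linear formula first to `r s` and then to `r t` expresses this distance through
  -- that of `p` and `q` alone.
  have hr' : ∀ s t : I, dist (r s) (r t) = ℓ * |(s : ℝ) - t| := by
    intro s t
    refine dist_eq_of_cosh_eq (by positivity) ?_
    rw [hr s, dist_comm p, dist_comm q, hr t, hr t, dist_self, dist_self, dist_comm q p, ← hℓ',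
      Real.cosh_zero, ← abs_of_pos hℓ, ← abs_mul, abs_of_pos hℓ, Real.cosh_abs, mul_sub,
      Real.sinh_sub, Real.sinh_sub, Real.cosh_sub]
    have h2 := Real.cosh_sq ℓ
    field_simp
    linear_combination (-(Real.sinh (ℓ * s) * Real.sinh (ℓ * t))) * h2
  refine ⟨⟨⟨r, ?_⟩, ?_, ?_⟩, hr'⟩
  · refine (LipschitzWith.of_dist_le_mul (K := ℓ.toNNReal) fun s t => ?_).continuous
    rw [hr', Real.coe_toNNReal _ hℓ.le]; rfl
  · refine dist_eq_zero.1 (dist_eq_of_cosh_eq le_rfl ?_)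
    change Real.cosh (dist (r 0) p) = _
    rw [hr]
    simp [hs.ne']
  · refine dist_eq_zero.1 (dist_eq_of_cosh_eq le_rfl ?_)
    change Real.cosh (dist (r 1) q) = _
    rw [hr]
    simp [hs.ne']

/-- The distance from the midpoint of a segment. -/
theorem exists_midpoint (p q : HypSpace) : ∃ r : HypSpace, ∀ y, Real.cosh (dist r y) =
    (Real.cosh (dist p y) + Real.cosh (dist q y)) / (2 * Real.cosh (dist p q / 2)) := by
  have hc := Real.cosh_pos (dist p q / 2)
  have h2 := Real.cosh_two_mul (dist p q / 2)
  rw [mul_div_cancel₀ _ two_ne_zero, Real.sinh_sq] at h2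
  obtain ⟨r, hr⟩ := exists_combination p q (1 / (2 * Real.cosh (dist p q / 2)))
    (1 / (2 * Real.cosh (dist p q / 2))) (by positivity) (by positivity) (by
      rw [h2]; field_simp; ring)
  exact ⟨r, fun y => by rw [hr]; field_simp⟩

/-- The hypotheses give `X ≤ τ + S ^ 2 / τ`, so the excess of `X ^ 2` over `τ ^ 2` is bounded
independently of `τ`. -/
theorem sq_le_of_mul_le {X S τ : ℝ} (hτ : 1 ≤ τ) (hX : τ ≤ X) (h : X * τ ≤ S ^ 2 + τ ^ 2) :
    X ^ 2 ≤ τ ^ 2 + 2 * S ^ 2 + S ^ 4 := by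
  have h1 : S ^ 2 / τ * τ = S ^ 2 := by field_simp
  have h2 : S ^ 2 / τ ≤ S ^ 2 := div_le_self (by positivity) hτ
  have h3 : 0 ≤ S ^ 2 / τ := by positivity
  have h4 : X ≤ τ + S ^ 2 / τ := le_of_mul_le_mul_right (a := τ) (by nlinarith) (by linarith)
  calc X ^ 2 ≤ (τ + S ^ 2 / τ) ^ 2 := by gcongr; linarith
    _ = τ ^ 2 + 2 * S ^ 2 + (S ^ 2 / τ) ^ 2 := by linear_combination 2 * h1
    _ ≤ τ ^ 2 + 2 * S ^ 2 + (S ^ 2) ^ 2 := by gcongr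
    _ = _ := by ring

/-- Two long segments with close endpoints have very close midpoints. -/
theorem exists_midpoint_close (ε c : ℝ) (hε : 0 < ε) (hc : 0 ≤ c) :
    ∃ D₀ : ℝ, 0 ≤ D₀ ∧ ∀ D ≥ D₀, ∀ (g : HypSpace ≃ᵢ HypSpace) (p u : HypSpace), dist p u = D →
      dist p (g p) ≤ c → dist u (g u) ≤ c → D ≤ dist u (g p) → D ≤ dist (g u) p →
      ∃ x, dist x (g x) < ε := by
  set S := Real.sinh (c / 2) with hS
  have hS0 : 0 ≤ S := Real.sinh_nonneg_iff.2 (by positivity)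
  set K := 2 * Real.cosh c + 8 * S ^ 2 + 4 * S ^ 4 with hK
  have hK0 : 0 ≤ K := by have := Real.cosh_pos c; positivity
  have hε' : 0 < Real.cosh ε - 1 := sub_pos.2 (Real.one_lt_cosh.2 hε.ne')
  -- Chosen so that `sinh (D / 2)` is at least `1 + K / (cosh ε - 1)`.
  refine ⟨2 + 2 * (K / (Real.cosh ε - 1)), by positivity, ?_⟩
  intro D hD g p u hpu hpp huu hup hgup
  have hq : 0 ≤ K / (Real.cosh ε - 1) := by positivity
  obtain ⟨x, hx⟩ := exists_midpoint p u
  refine ⟨x, ?_⟩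
  have hx' : ∀ y, Real.cosh (dist (g x) y) = (Real.cosh (dist (g p) y) + Real.cosh (dist (g u) y)) /
      (2 * Real.cosh (dist p u / 2)) := by
    intro y
    have e (z : HypSpace) : dist (g z) y = dist z (g.symm y) := by
      rw [← g.isometry.dist_eq z, g.apply_symm_apply]
    rw [e, e, e, hx]
  -- The midpoint formula, used at `x` and at `g x`, gives the sum of the four `cosh` distances
  -- between the end points of the two segments over `4 * cosh (D / 2) ^ 2`.
  have hcosh : Real.cosh (dist x (g x)) = (Real.cosh (dist p (g p)) + Real.cosh (dist (g u) p) +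
      (Real.cosh (dist u (g p)) + Real.cosh (dist u (g u)))) / (4 * Real.cosh (D / 2) ^ 2) := by
    rw [hx, dist_comm p, dist_comm u, hx', hx', hpu, dist_comm p, dist_comm u, dist_comm u]
    field_simp
    ring
  -- Ptolemy bounds the product of the diagonals, while each is at least `D`; so each exceeds the
  -- side by so little that the numerator in `hcosh` is four times `sinh (D / 2) ^ 2` up to a
  -- constant.
  have hP := ptolemy p (g p) (g u) u
  rw [g.isometry.dist_eq, hpu] at hP
  have c2 (z : ℝ) : Real.cosh z = 1 + 2 * Real.sinh (z / 2) ^ 2 := by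
    have := Real.cosh_two_mul (z / 2)
    rw [mul_div_cancel₀ _ two_ne_zero, Real.cosh_sq] at this
    linarith
  have m {y z : ℝ} (h : y ≤ z) : Real.sinh (y / 2) ≤ Real.sinh (z / 2) :=
    Real.sinh_le_sinh.2 (by linarith)
  have hσ : 1 + K / (Real.cosh ε - 1) ≤ Real.sinh (D / 2) :=
    (show 1 + K / (Real.cosh ε - 1) ≤ D / 2 by linarith).trans
      (Real.self_le_sinh_iff.2 (by linarith))
  have hX := m hgup
  have hY := m hup
  rw [dist_comm] at hX hY
  rw [dist_comm (g p) u] at hP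
  rw [dist_comm (g p) u] at hY
  have hU := m huu
  have hV := m hpp
  have hcc : Real.cosh (dist p (g p)) ≤ Real.cosh c := by
    rw [Real.cosh_le_cosh, abs_of_nonneg dist_nonneg, abs_of_nonneg hc]; exact hpp
  have hcd : Real.cosh (dist u (g u)) ≤ Real.cosh c := by
    rw [Real.cosh_le_cosh, abs_of_nonneg dist_nonneg, abs_of_nonneg hc]; exact huu
  rw [dist_comm (g u) u] at hP
  rw [c2 (dist (g u) p), c2 (dist u (g p)), dist_comm (g u) p, Real.cosh_sq] at hcosh
  have hU0 : 0 ≤ Real.sinh (dist u (g u) / 2) := Real.sinh_nonneg_iff.2 (by positivity)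
  have hV0 : 0 ≤ Real.sinh (dist p (g p) / 2) := Real.sinh_nonneg_iff.2 (by positivity)
  rw [← hS] at hU hV
  rw [← abs_of_nonneg (dist_nonneg (x := x) (y := g x)), ← abs_of_pos hε, ← Real.cosh_lt_cosh, hcosh]
  generalize Real.sinh (dist p (g u) / 2) = X at *
  generalize Real.sinh (dist u (g p) / 2) = Y at *
  generalize Real.sinh (D / 2) = τ at *
  have hP' : X * Y ≤ S ^ 2 + τ ^ 2 := by
    nlinarith [mul_le_mul hV hU hU0 hS0]
  have hσ1 : 1 ≤ τ := by linarith
  have hX2 : X ^ 2 ≤ τ ^ 2 + 2 * S ^ 2 + S ^ 4 := sq_le_of_mul_le hσ1 hX (by nlinarith)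
  have hY2 : Y ^ 2 ≤ τ ^ 2 + 2 * S ^ 2 + S ^ 4 := sq_le_of_mul_le hσ1 hY (by nlinarith)
  have hk : K < (Real.cosh ε - 1) * τ ^ 2 := by
    have h1 : K = (Real.cosh ε - 1) * (K / (Real.cosh ε - 1)) := by field_simp
    rw [h1]
    refine mul_lt_mul_of_pos_left ?_ hε'
    nlinarith
  rw [div_lt_iff₀ (by positivity)]
  nlinarith

end HypSpace

end

/-! ### Concatenation of efficient segments -/

noncomputable section

namespace HypSpace

/-- The path `P, Q, P', Q'` consisting of three segments is efficient if it is so at `Q` and at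
`P'`, and if the first and the last segment do not fellow-travel in case the middle one is short. -/
theorem dist_ge_of_locally_efficient {C D : ℝ} {P Q P' Q' u u' : HypSpace}
    (h1 : dist P Q + dist Q P' ≤ dist P P' + C) (h2 : dist Q' P' + dist P' Q ≤ dist Q' Q + C)
    (hu : dist Q u = D) (hu2 : dist u P = dist P Q - D)
    (hu' : dist P' u' = D) (hu2' : dist u' Q' = dist P' Q' - D)
    (hclose : dist Q P' ≤ C + 4 → C + 20 < dist u u') :
    dist P Q + dist Q P' + dist P' Q' ≤ dist P Q' + max (2 * C + 8) (2 * D) := by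
  by_cases hy : dist Q P' ≤ C + 4
  · by_contra! hcon
    have hcon' := (add_le_add_right (le_max_right (2 * C + 8) (2 * D)) (dist P Q')).trans_lt hcon
    have f1 := four_point u P Q' Q
    have f2 := four_point u Q' u' P'
    have t1 := dist_triangle Q P' Q'
    have t2 := dist_triangle u Q P'
    have := hclose hy
    rw [dist_comm u Q] at f1 t2
    rw [dist_comm Q' Q] at f1
    rw [dist_comm Q' P', dist_comm Q' u', dist_comm u' P'] at f2
    rcases max_cases (dist u P + dist Q Q') (dist Q u + dist P Q') with ⟨e, -⟩ | ⟨e, -⟩ <;>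
    rcases max_cases (dist u Q' + dist P' u') (dist u P' + dist u' Q') with ⟨e', -⟩ | ⟨e', -⟩ <;>
    rw [e] at f1 <;> rw [e'] at f2 <;> linarith
  · push Not at hy
    have f := four_point P Q P' Q'
    have := le_max_left (2 * C + 8) (2 * D)
    rw [dist_comm Q' P', dist_comm P' Q, dist_comm Q' Q] at h2
    rcases max_cases (dist P Q + dist P' Q') (dist P Q' + dist Q P') with ⟨e, -⟩ | ⟨e, -⟩ <;>
    rw [e] at f <;> linarith

/-! ### The topology of the half-space model -/

/-- The bound involves the height of `p` only and tends to zero with the distance; this is what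
continuity of the coordinates needs. It comes from `q.t ≤ p.t + |p - q|`, inserted into the distance
formula. -/
theorem toE_dist_le (p q : HypSpace) :
    dist p.toE q.toE ≤ 2 * p.t * Real.sinh (dist p q / 2) * (1 + 2 * Real.sinh (dist p q / 2)) := by
  have hp := p.t_pos
  have hq := q.t_pos
  have h := sinh_half_mul p q
  have h2 := toE_sq p q
  have hs : 0 ≤ Real.sinh (dist p q / 2) := Real.sinh_nonneg_iff.2 (by positivity)
  have e0 : 0 ≤ dist p.toE q.toE := dist_nonneg
  have hsq : (Real.sinh (dist p q / 2) * 2) ^ 2 * (p.t * q.t) = dist p.toE q.toE ^ 2 := by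
    rw [← h, mul_pow, mul_pow, mul_pow, mul_pow, Real.sq_sqrt hp.le, Real.sq_sqrt hq.le]; ring
  generalize Real.sinh (dist p q / 2) = s at *
  generalize dist p.toE q.toE = E at *
  have h3 : q.t ≤ p.t + E := by
    have : (p.t - q.t) ^ 2 ≤ E ^ 2 := by nlinarith [sq_nonneg ‖p.z - q.z‖]
    have := abs_le_of_sq_le_sq' this e0
    linarith [this.1]
  have h4 : E ^ 2 ≤ 4 * s ^ 2 * (p.t * (p.t + E)) := by
    rw [← hsq]
    nlinarith [mul_le_mul_of_nonneg_left h3 (show 0 ≤ 4 * s ^ 2 * p.t by positivity)]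
  by_contra! hcon
  have h5 : 0 < E - 2 * p.t * s * (1 + 2 * s) := by linarith
  nlinarith [mul_pos h5 h5, mul_nonneg hs hp.le, mul_nonneg (mul_nonneg hs hp.le) h5.le,
    mul_nonneg (mul_nonneg hs hs) h5.le, mul_nonneg (mul_nonneg (mul_nonneg hs hp.le) hs) h5.le,
    mul_nonneg (mul_nonneg hs hp.le) (mul_nonneg hs hp.le), pow_nonneg hs 3, pow_nonneg hs 4]

theorem continuous_toE : Continuous toE := by
  rw [continuous_iff_continuousAt]
  intro p
  rw [ContinuousAt, tendsto_iff_dist_tendsto_zero]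
  have hc : Continuous fun q : HypSpace =>
      2 * p.t * Real.sinh (dist p q / 2) * (1 + 2 * Real.sinh (dist p q / 2)) := by
    have := Real.continuous_sinh
    fun_prop
  refine squeeze_zero (fun _ => dist_nonneg) (fun q => ?_) (by simpa using hc.tendsto p)
  rw [dist_comm]
  exact toE_dist_le p q

theorem continuous_z : Continuous HypSpace.z :=
  continuous_fst.comp ((WithLp.prod_continuous_ofLp 2 ℂ ℝ).comp continuous_toE)

theorem continuous_t : Continuous HypSpace.t :=
  continuous_snd.comp ((WithLp.prod_continuous_ofLp 2 ℂ ℝ).comp continuous_toE)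

theorem continuous_mk {T : Type*} [TopologicalSpace T] {f : T → ℂ} {g : T → ℝ} (hf : Continuous f)
    (hg : Continuous g) (h : ∀ x, 0 < g x) : Continuous fun x => (⟨f x, g x, h x⟩ : HypSpace) := by
  rw [continuous_iff_continuousAt]
  intro x
  rw [ContinuousAt, tendsto_iff_dist_tendsto_zero]
  have hE : Continuous fun y => (WithLp.toLp 2 (f y, g y) : WithLp 2 (ℂ × ℝ)) :=
    (WithLp.prod_continuous_toLp 2 ℂ ℝ).comp (hf.prodMk hg)
  have hc : Continuous fun y => 2 * Real.arsinh
      (dist (WithLp.toLp 2 (f y, g y) : WithLp 2 (ℂ × ℝ)) (WithLp.toLp 2 (f x, g x)) /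
        (2 * √(g y * g x))) := by
    have := Real.continuous_arsinh
    refine continuous_const.mul (this.comp ((hE.dist continuous_const).div₀ (by fun_prop) ?_))
    intro y
    have := h x
    have := h y
    positivity
  simpa [dist_def, toE] using hc.tendsto x

/-- The homeomorphism of hyperbolic space with the half space. -/
def homeoHalfSpace : HypSpace ≃ₜ {x : ℂ × ℝ | 0 < x.2} where
  toFun p := ⟨(p.z, p.t), p.t_pos⟩
  invFun x := ⟨x.1.1, x.1.2, x.2⟩
  left_inv _ := rfl
  right_inv _ := rfl
  continuous_toFun := (continuous_z.prodMk continuous_t).subtype_mk _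
  continuous_invFun := continuous_mk (by fun_prop) (by fun_prop) _

/-- Needed because it makes paths with the same end points homotopic, so that the lift of a path can
be replaced by a geodesic within its class. -/
instance : ContractibleSpace HypSpace := by
  have hconv : Convex ℝ {x : ℂ × ℝ | 0 < x.2} :=
    (convex_Ioi (0 : ℝ)).is_linear_preimage (f := fun x : ℂ × ℝ => x.2) ⟨fun _ _ => rfl, fun _ _ => rfl⟩
  have := hconv.contractibleSpace ⟨(0, 1), one_pos (α := ℝ)⟩
  exact homeoHalfSpace.contractibleSpace

end HypSpace

end

noncomputable section

/-! ### Lengths and displacements -/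

/-- Homotopy classes of paths, relative to the endpoints. -/
abbrev PClass {T : Type*} [TopologicalSpace T] (x y : T) := Path.Homotopic.Quotient x y

notation "cl(" γ ")" => Path.Homotopic.Quotient.mk γ

theorem PClass.exists_rep {T : Type*} [TopologicalSpace T] {x y : T} (δ : PClass x y) :
    ∃ γ : Path x y, cl(γ) = δ :=
  Path.Homotopic.Quotient.mk_surjective δ

namespace HypManifold

variable {M : HypManifold}

theorem proj_smul {g : HypSpace ≃ᵢ HypSpace} (hg : g ∈ M.Γ) (p : HypSpace) :
    M.proj (g p) = M.proj p :=
  M.isQuotientCoveringMap.map_smul ⟨g, hg⟩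

theorem exists_of_proj_eq {p q : HypSpace} (h : M.proj p = M.proj q) : ∃ g ∈ M.Γ, g p = q := by
  obtain ⟨⟨g, hg⟩, e⟩ := M.isQuotientCoveringMap.apply_eq_iff_mem_orbit.1 h.symm
  exact ⟨g, hg, e⟩

theorem lift_unique {b b' : C(I, HypSpace)} (h0 : b 0 = b' 0)
    (h : ∀ t, M.proj (b t) = M.proj (b' t)) : b = b' :=
  DFunLike.coe_injective
    (M.isCoveringMap.eq_of_comp_eq b.continuous b'.continuous (funext h) 0 h0)

/-- Two lifts of a path differ by an element of `Γ`. -/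
theorem exists_of_lifts {b b' : C(I, HypSpace)} (h : ∀ t, M.proj (b t) = M.proj (b' t)) :
    ∃ g ∈ M.Γ, ∀ t, g (b t) = b' t := by
  obtain ⟨g, hg, e⟩ := exists_of_proj_eq (h 0)
  refine ⟨g, hg, fun t => ?_⟩
  exact DFunLike.congr_fun (lift_unique (b := (⟨g, g.continuous⟩ : C(HypSpace, HypSpace)).comp b) e
    fun t => (proj_smul hg _).trans (h t)) t

/-- Any two lifts differ by an isometry in `Γ`, so the infimum is over equal numbers. -/
theorem pathLength_eq {c : C(I, M.Carrier)} {b : C(I, HypSpace)} (hb : ∀ t, M.proj (b t) = c t) :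
    M.pathLength c = eVariationOn b Set.univ := by
  refine le_antisymm (iInf₂_le b hb) (le_iInf₂ fun b' hb' => le_of_eq ?_)
  obtain ⟨g, -, e⟩ := exists_of_lifts fun t => (hb t).trans (hb' t).symm
  simp only [eVariationOn, ← e, g.isometry.edist_eq]

end HypManifold

variable {T : Type} [TopologicalSpace T] {M : HypManifold}

/-- The length of a path in `T`, measured with `f : T → M`. -/
def len (f : C(T, M.Carrier)) {x y : T} (γ : Path x y) : ℝ≥0∞ :=
  M.pathLength (f.comp γ.toContinuousMap)

/-- The end point of the lift of a path which starts at a given point. -/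
def dev (f : C(T, M.Carrier)) {x y : T} (δ : PClass x y) (p : M.proj ⁻¹' {f x}) :
    M.proj ⁻¹' {f y} :=
  M.isCoveringMap.monodromy (δ.map f) p

theorem nonempty_fiber (f : C(T, M.Carrier)) (x : T) : Nonempty (M.proj ⁻¹' {f x}) := by
  obtain ⟨p, hp⟩ := M.isQuotientCoveringMap.surjective (f x)
  exact ⟨⟨p, hp⟩⟩

/-- The distance between the end points of the lifts of a path. -/
def disp (f : C(T, M.Carrier)) {x y : T} (δ : PClass x y) : ℝ :=
  dist (nonempty_fiber f x).some.1 (dev f δ (nonempty_fiber f x).some).1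

/-- The infimum of the lengths of the paths in a homotopy class. -/
def classLen (f : C(T, M.Carrier)) {x y : T} (δ : PClass x y) : ℝ≥0∞ :=
  ⨅ (γ : Path x y) (_ : cl(γ) = δ), len f γ

variable (f : C(T, M.Carrier)) {x y z : T}

theorem exists_lift (γ : Path x y) (p : M.proj ⁻¹' {f x}) :
    ∃ b : C(I, HypSpace), b 0 = p.1 ∧ ∀ t, M.proj (b t) = f (γ t) := by
  have h0 : (f.comp γ.toContinuousMap) 0 = M.proj p.1 := by
    rw [show M.proj p.1 = f x from p.2]; simp
  exact ⟨M.isCoveringMap.liftPath (f.comp γ.toContinuousMap) p.1 h0,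
    M.isCoveringMap.liftPath_zero _ _ h0, fun t => congr_fun (M.isCoveringMap.liftPath_lifts _ _ h0) t⟩

variable {f} in
theorem dev_mk_eq {γ : Path x y} {p : M.proj ⁻¹' {f x}} {b : C(I, HypSpace)} (h0 : b 0 = p.1)
    (hb : ∀ t, M.proj (b t) = f (γ t)) : (dev f cl(γ) p).1 = b 1 := by
  have h : (f.comp γ.toContinuousMap) 0 = M.proj p.1 := by
    rw [show M.proj p.1 = f x from p.2]; simp
  have : b = M.isCoveringMap.liftPath (f.comp γ.toContinuousMap) p.1 h :=
    (M.isCoveringMap.eq_liftPath_iff' h).2 ⟨funext hb, h0⟩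
  rw [this]
  rfl

variable {f} in
theorem len_eq {γ : Path x y} {b : C(I, HypSpace)} (hb : ∀ t, M.proj (b t) = f (γ t)) :
    len f γ = eVariationOn b Set.univ := HypManifold.pathLength_eq hb

@[simp] theorem dev_refl (p : M.proj ⁻¹' {f x}) : dev f (.refl x) p = p :=
  congr_fun M.isCoveringMap.monodromy_refl p

theorem map_quotient_trans {S : Type*} [TopologicalSpace S] (f : C(T, S)) (δ : PClass x y)
    (η : PClass y z) : (δ.trans η).map f = (δ.map f).trans (η.map f) := by
  obtain ⟨_, rfl⟩ := δ.exists_rep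
  obtain ⟨_, rfl⟩ := η.exists_rep
  rw [← Path.Homotopic.Quotient.mk_trans, ← Path.Homotopic.Quotient.mk_map, Path.map_trans]
  rfl

theorem map_quotient_symm {S : Type*} [TopologicalSpace S] (f : C(T, S)) (δ : PClass x y) :
    δ.symm.map f = (δ.map f).symm := by
  obtain ⟨_, rfl⟩ := δ.exists_rep
  rw [← Path.Homotopic.Quotient.mk_symm, ← Path.Homotopic.Quotient.mk_map, ← Path.Homotopic.Quotient.mk_map, ← Path.Homotopic.Quotient.mk_symm]
  rfl

theorem dev_trans (δ : PClass x y) (η : PClass y z) (p : M.proj ⁻¹' {f x}) :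
    dev f (δ.trans η) p = dev f η (dev f δ p) := by
  rw [dev, map_quotient_trans]
  exact M.isCoveringMap.monodromy_trans_apply _ _ _

@[simp] theorem dev_symm_dev (δ : PClass x y) (p : M.proj ⁻¹' {f x}) :
    dev f δ.symm (dev f δ p) = p := by
  rw [← dev_trans, Path.Homotopic.Quotient.trans_symm, dev_refl]

/-- Developing is equivariant. -/
theorem dev_smul (δ : PClass x y) {p q : M.proj ⁻¹' {f x}} {g : HypSpace ≃ᵢ HypSpace}
    (hg : g ∈ M.Γ) (h : g p.1 = q.1) : (dev f δ q).1 = g (dev f δ p).1 := by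
  obtain ⟨γ, rfl⟩ := δ.exists_rep
  obtain ⟨b, h0, hb⟩ := exists_lift f γ p
  rw [dev_mk_eq h0 hb, dev_mk_eq (b := (⟨g, g.continuous⟩ : C(HypSpace, HypSpace)).comp b)]
  · rfl
  · rw [← h, ← h0]; rfl
  · intro t; rw [← hb]; exact HypManifold.proj_smul hg _

/-- Developing is equivariant under `Γ`, which acts by isometries. With a free choice of the
starting lift, inequalities between distances of points become inequalities between displacements of
classes. -/
theorem disp_eq (δ : PClass x y) (p : M.proj ⁻¹' {f x}) :
    disp f δ = dist p.1 (dev f δ p).1 := by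
  obtain ⟨g, hg, e⟩ := HypManifold.exists_of_proj_eq
    (p.2.trans (nonempty_fiber f x).some.2.symm : M.proj p.1 = M.proj (nonempty_fiber f x).some.1)
  rw [disp, dev_smul f δ hg e, ← e, g.isometry.dist_eq]

theorem disp_nonneg (δ : PClass x y) : 0 ≤ disp f δ := dist_nonneg

theorem disp_symm (δ : PClass x y) : disp f δ.symm = disp f δ := by
  have p := (nonempty_fiber f x).some
  rw [disp_eq f δ p, disp_eq f δ.symm (dev f δ p), dev_symm_dev, dist_comm]

theorem disp_trans_le (δ : PClass x y) (η : PClass y z) :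
    disp f (δ.trans η) ≤ disp f δ + disp f η := by
  have p := (nonempty_fiber f x).some
  rw [disp_eq f _ p, disp_eq f δ p, disp_eq f η (dev f δ p), dev_trans]
  exact dist_triangle _ _ _

theorem disp_le_len (γ : Path x y) : ENNReal.ofReal (disp f cl(γ)) ≤ len f γ := by
  have p := (nonempty_fiber f x).some
  obtain ⟨b, h0, hb⟩ := exists_lift f γ p
  rw [len_eq hb, disp_eq f _ p, dev_mk_eq h0 hb, ← h0, ← edist_dist]
  exact eVariationOn.edist_le _ trivial trivial

theorem classLen_mk_le (γ : Path x y) : classLen f cl(γ) ≤ len f γ :=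
  iInf₂_le (f := fun (γ' : Path x y) (_ : cl(γ') = cl(γ)) => len f γ') γ rfl

theorem disp_le_classLen (δ : PClass x y) : ENNReal.ofReal (disp f δ) ≤ classLen f δ :=
  le_iInf₂ fun γ h => h ▸ disp_le_len f γ

theorem antitone_unitInterval_symm : Antitone unitInterval.symm :=
  fun _ _ h => unitInterval.symm_le_symm.2 h

theorem len_symm (γ : Path x y) : len f γ.symm = len f γ := by
  have p := (nonempty_fiber f x).some
  obtain ⟨b, h0, hb⟩ := exists_lift f γ p
  rw [len_eq hb, len_eq (b := b.comp ⟨unitInterval.symm, unitInterval.continuous_symm⟩)]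
  · refine le_antisymm (eVariationOn.comp_le_of_antitoneOn _ _ ?_ ?_) ?_
    · exact antitone_unitInterval_symm.antitoneOn _
    · exact fun _ _ => trivial
    · have := eVariationOn.comp_le_of_antitoneOn (t := Set.univ) (s := Set.univ)
        (b.comp ⟨unitInterval.symm, unitInterval.continuous_symm⟩) unitInterval.symm
        (antitone_unitInterval_symm.antitoneOn _) (fun _ _ => trivial)
      refine le_of_eq_of_le ?_ this
      congr 1
      ext t : 1
      simp
  · intro t; rw [ContinuousMap.comp_apply, hb]; rfl

theorem Path.range_convexComb_zero (t : I) : Set.range (Set.Icc.convexComb 0 t) = Set.Iic t := by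
  rw [Path.range_subpathAux, Set.uIcc_of_le (show (0 : I) ≤ t from t.2.1)]; ext; simp

theorem Path.range_convexComb_one (t : I) : Set.range (Set.Icc.convexComb t 1) = Set.Ici t := by
  rw [Path.range_subpathAux, Set.uIcc_of_le (show t ≤ (1 : I) from t.2.2)]; ext; simp [unitInterval.le_one']

theorem Path.monotone_convexComb {s t : I} (h : s ≤ t) : Monotone (Set.Icc.convexComb s t) := by
  intro a b hab
  have h' : (s : ℝ) ≤ t := h
  have hab' : (a : ℝ) ≤ b := hab
  change (1 - a : ℝ) * s + a * t ≤ (1 - b) * s + b * t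
  nlinarith

/-- The part of a path up to time `t`. -/
def Path.initial {T : Type*} [TopologicalSpace T] {x y : T} (γ : Path x y) (t : I) : Path x (γ t) :=
  (γ.subpath 0 t).cast γ.source.symm rfl

/-- The part of a path from time `t` on. -/
def Path.final {T : Type*} [TopologicalSpace T] {x y : T} (γ : Path x y) (t : I) : Path (γ t) y :=
  (γ.subpath t 1).cast rfl γ.target.symm

theorem Path.initial_apply {T : Type*} [TopologicalSpace T] {x y : T} (γ : Path x y) (t s : I) :
    γ.initial t s = γ (Set.Icc.convexComb 0 t s) := rfl

theorem Path.final_apply {T : Type*} [TopologicalSpace T] {x y : T} (γ : Path x y) (t s : I) :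
    γ.final t s = γ (Set.Icc.convexComb t 1 s) := rfl

theorem cl_initial_trans_final {T : Type*} [TopologicalSpace T] {x y : T} (γ : Path x y) (t : I) :
    Path.Homotopic.Quotient.trans cl(γ.initial t) cl(γ.final t) = cl(γ) := by
  rw [← Path.Homotopic.Quotient.mk_trans, Path.Homotopic.Quotient.eq]
  have h : Path.Homotopic _ _ := ⟨Path.Homotopy.subpathTransSubpath γ 0 t 1⟩
  have h' := h.pathCast γ.source.symm γ.target.symm
  rw [Path.subpath_zero_one] at h'
  exact h'

theorem len_initial_add_len_final (γ : Path x y) (t : I) :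
    len f (γ.initial t) + len f (γ.final t) = len f γ := by
  have p := (nonempty_fiber f x).some
  obtain ⟨b, h0, hb⟩ := exists_lift f γ p
  rw [len_eq hb, len_eq (b := b.comp ⟨Set.Icc.convexComb 0 t, by fun_prop⟩) fun _ => hb _,
    len_eq (b := b.comp ⟨Set.Icc.convexComb t 1, by fun_prop⟩) fun _ => hb _]
  have e : eVariationOn b (Set.Iic t ∪ Set.Ici t) = _ :=
    eVariationOn.union b (x := t) ⟨Set.mem_Iic.2 le_rfl, fun _ h => h⟩
      ⟨Set.mem_Ici.2 le_rfl, fun _ h => Set.mem_Ici.1 h⟩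
  rw [Set.Iic_union_Ici] at e
  rw [e, ← Path.range_convexComb_zero, ← Path.range_convexComb_one, ← Set.image_univ,
    ← Set.image_univ,
    ← eVariationOn.comp_eq_of_monotoneOn b _ ((Path.monotone_convexComb t.2.1).monotoneOn _),
    ← eVariationOn.comp_eq_of_monotoneOn b _ ((Path.monotone_convexComb t.2.2).monotoneOn _)]
  rfl

theorem len_congr {x' y' : T} {γ : Path x y} {γ' : Path x' y'} (h : ∀ t, γ t = γ' t) :
    len f γ = len f γ' := by
  unfold len; congr 1; ext t; exact congrArg f (h t)

/-- The middle of the unit interval. -/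
def unitHalf : I := ⟨1 / 2, by norm_num, by norm_num⟩

theorem initial_half_trans {T : Type*} [TopologicalSpace T] {x y z : T} (γ : Path x y)
    (γ' : Path y z) (t : I) : (γ.trans γ').initial unitHalf t = γ t := by
  have : ((Set.Icc.convexComb 0 unitHalf t : I) : ℝ) = t / 2 := by
    change (1 - t : ℝ) * 0 + t * (1 / 2) = t / 2; ring
  rw [Path.initial_apply, Path.trans_apply, dif_pos (by rw [this]; linarith [t.2.2])]
  congr 1; ext; simp only [this]; ring

theorem final_half_trans {T : Type*} [TopologicalSpace T] {x y z : T} (γ : Path x y)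
    (γ' : Path y z) (t : I) : (γ.trans γ').final unitHalf t = γ' t := by
  have : ((Set.Icc.convexComb unitHalf 1 t : I) : ℝ) = (t + 1) / 2 := by
    change (1 - t : ℝ) * (1 / 2) + t * 1 = (t + 1) / 2; ring
  rw [Path.final_apply, Path.trans_apply]
  split_ifs with h
  · have ht : t = 0 := Subtype.ext (le_antisymm (by rw [this] at h; simp; linarith) t.2.1)
    subst ht
    rw [γ'.source]
    convert γ.target
    rw [this]; simp
  · congr 1; ext; simp only [this]; ring

theorem len_trans (γ : Path x y) (γ' : Path y z) :
    len f (γ.trans γ') = len f γ + len f γ' := by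
  rw [← len_initial_add_len_final f _ unitHalf, len_congr f (initial_half_trans γ γ'),
    len_congr f (final_half_trans γ γ')]

theorem classLen_trans_le (δ : PClass x y) (η : PClass y z) :
    classLen f (δ.trans η) ≤ classLen f δ + classLen f η := by
  conv_rhs => unfold classLen
  simp_rw [ENNReal.iInf_add, ENNReal.add_iInf]
  refine le_iInf₂ fun γ hγ => le_iInf₂ fun γ' hγ' => ?_
  rw [← len_trans, ← hγ, ← hγ', ← Path.Homotopic.Quotient.mk_trans]
  exact classLen_mk_le f _

variable {f} in
theorem dev_initial {γ : Path x y} {p : M.proj ⁻¹' {f x}} {b : C(I, HypSpace)} (h0 : b 0 = p.1)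
    (hb : ∀ t, M.proj (b t) = f (γ t)) (t : I) : (dev f cl(γ.initial t) p).1 = b t := by
  rw [dev_mk_eq (b := b.comp ⟨Set.Icc.convexComb 0 t, by fun_prop⟩) ?_ fun _ => hb _]
  · simp
  · simp [h0]

theorem quotient_map_id (δ : PClass x y) : δ.map (.id T) = δ := by
  obtain ⟨γ, rfl⟩ := δ.exists_rep
  rfl

theorem quotient_cast_cast_self {x' y' : T} (δ : PClass x y) (h₁ : x' = x) (h₂ : y' = y)
    (h₃ : x = x') (h₄ : y = y') : (δ.cast h₁ h₂).cast h₃ h₄ = δ := by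
  subst h₁ h₂
  obtain ⟨γ, rfl⟩ := δ.exists_rep
  rfl

theorem eVariationOn_le_of_dist_eq {b : I → HypSpace} {d : ℝ}
    (hb : ∀ s t : I, dist (b s) (b t) = d * |(s : ℝ) - t|) :
    eVariationOn b Set.univ ≤ ENNReal.ofReal d := by
  have hd : 0 ≤ d := by simpa using dist_nonneg.trans_eq (hb 0 1)
  refine iSup_le fun ⟨n, u, hu, _⟩ => ?_
  have e : ∀ i, edist (b (u (i + 1))) (b (u i)) =
      ENNReal.ofReal (d * ((u (i + 1) : ℝ) - u i)) := fun i => by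
    rw [edist_dist, hb, abs_of_nonneg (sub_nonneg.2 (Subtype.coe_le_coe.2 (hu i.le_succ)))]
  simp only [e]
  rw [← ENNReal.ofReal_sum_of_nonneg fun i _ =>
    mul_nonneg hd (sub_nonneg.2 (Subtype.coe_le_coe.2 (hu i.le_succ))), ← Finset.mul_sum,
    Finset.sum_range_sub fun i => (u i : ℝ)]
  refine ENNReal.ofReal_le_ofReal (mul_le_of_le_one_right hd ?_)
  linarith [(u n).2.2, (u 0).2.1]

/-- Every class of paths in `M` contains a geodesic. -/
theorem exists_geodesic_rep {m m' : M.Carrier} (δ : PClass m m') :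
    ∃ γ : Path m m', cl(γ) = δ ∧ len (.id M.Carrier) γ ≤ ENNReal.ofReal (disp (.id _) δ) := by
  have p : M.proj ⁻¹' {m} := (nonempty_fiber (.id M.Carrier) m).some
  obtain ⟨b, hb⟩ := HypSpace.exists_geodesic p.1 (M.isCoveringMap.monodromy δ p).1
  -- Both are classes of paths between the same points of a contractible space.
  have hcl : cl(b) = M.isCoveringMap.liftPathQuotient δ p := Subsingleton.elim _ _
  have hmap := M.isCoveringMap.map_liftPathQuotient δ p
  rw [← hcl] at hmap
  have hp : m = M.proj p.1 := p.2.symm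
  have hq : m' = M.proj (M.isCoveringMap.monodromy δ p).1 :=
    (M.isCoveringMap.monodromy δ p).2.symm
  refine ⟨(b.map M.isCoveringMap.continuous).cast hp hq, ?_, ?_⟩
  · rw [Path.Homotopic.Quotient.mk_cast]
    change (Path.Homotopic.Quotient.map cl(b) ⟨M.proj, M.isCoveringMap.continuous⟩).cast hp hq = δ
    rw [hmap]
    exact quotient_cast_cast_self δ _ _ _ _
  · rw [len_eq (b := b.toContinuousMap) fun _ => rfl, disp_eq _ δ p]
    change _ ≤ ENNReal.ofReal (dist p.1 (M.isCoveringMap.monodromy (δ.map (.id _)) p).1)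
    rw [quotient_map_id]
    exact eVariationOn_le_of_dist_eq hb

/-- A path in the universal cover from `a` to `b` is a representative of the class `a⁻¹ b`. With
this the universal cover disappears from the argument. -/
theorem coverDist_eq {x₀ : T} (a b : UnivCover x₀) :
    coverDist f a b = classLen f (a.2.symm.trans b.2) := by
  unfold coverDist classLen len
  congr! 3 with γ
  constructor
  · intro h
    rw [← h, ← Path.Homotopic.Quotient.trans_assoc, Path.Homotopic.Quotient.symm_trans,
      Path.Homotopic.Quotient.refl_trans]
  · intro h
    rw [h, ← Path.Homotopic.Quotient.trans_assoc, Path.Homotopic.Quotient.trans_symm,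
      Path.Homotopic.Quotient.refl_trans]

end

noncomputable section

theorem quotient_symm_trans {T : Type*} [TopologicalSpace T] {x y z : T} (δ : PClass x y)
    (η : PClass y z) : (δ.trans η).symm = η.symm.trans δ.symm := by
  obtain ⟨γ, rfl⟩ := δ.exists_rep
  obtain ⟨γ', rfl⟩ := η.exists_rep
  rw [← Path.Homotopic.Quotient.mk_trans, ← Path.Homotopic.Quotient.mk_symm, Path.trans_symm]
  rfl

theorem quotient_symm_symm {T : Type*} [TopologicalSpace T] {x y : T} (δ : PClass x y) :
    δ.symm.symm = δ := by
  obtain ⟨γ, rfl⟩ := δ.exists_rep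
  rw [← Path.Homotopic.Quotient.mk_symm, ← Path.Homotopic.Quotient.mk_symm, Path.symm_symm]

/-! ### The realization of a graph -/

namespace FinGraph

variable {X : FinGraph}

/-- The normal form of a point of the realization. -/
def nf (x : X.Space) : X.V ⊕ (X.E × I) := by
  classical
  refine Quot.lift (fun p : X.Pieces => match p with
    | Sum.inl v => Sum.inl v.1
    | Sum.inr ⟨e, t⟩ => if t = 0 then Sum.inl (X.src e) else if t = 1 then Sum.inl (X.tgt e)
        else Sum.inr (e, t)) ?_ x
  rintro _ _ (e | e) <;> simp

@[simp] theorem nf_vertex (v : X.V) : nf (X.vertex v) = Sum.inl v := rfl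

@[simp] theorem edge_zero (e : X.E) : X.edge e 0 = X.vertex (X.src e) := Quot.sound (Glue.src e)

@[simp] theorem edge_one (e : X.E) : X.edge e 1 = X.vertex (X.tgt e) := Quot.sound (Glue.tgt e)

theorem nf_edge (e : X.E) {t : I} (h0 : t ≠ 0) (h1 : t ≠ 1) :
    nf (X.edge e t) = Sum.inr (e, t) := by
  change (if t = 0 then _ else if t = 1 then _ else _) = _
  rw [if_neg h0, if_neg h1]

theorem vertex_injective : Function.Injective X.vertex := fun v w h => by
  simpa using congrArg nf h

theorem edge_eq_vertex {e : X.E} {t : I} {v : X.V} (h : X.edge e t = X.vertex v) :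
    t = 0 ∧ X.src e = v ∨ t = 1 ∧ X.tgt e = v := by
  rcases eq_or_ne t 0 with rfl | h0
  · exact .inl ⟨rfl, vertex_injective (by simpa using h)⟩
  rcases eq_or_ne t 1 with rfl | h1
  · exact .inr ⟨rfl, vertex_injective (by simpa using h)⟩
  · simpa [nf_edge e h0 h1] using congrArg nf h

theorem edge_eq_edge {e e' : X.E} {t t' : I} (h0 : t ≠ 0) (h1 : t ≠ 1)
    (h : X.edge e' t' = X.edge e t) : e' = e ∧ t' = t := by
  have h0' : t' ≠ 0 := by
    rintro rfl
    rw [edge_zero, eq_comm] at h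
    rcases edge_eq_vertex h with h | h
    exacts [h0 h.1, h1 h.1]
  have h1' : t' ≠ 1 := by
    rintro rfl
    rw [edge_one, eq_comm] at h
    rcases edge_eq_vertex h with h | h
    exacts [h0 h.1, h1 h.1]
  simpa [nf_edge e h0 h1, nf_edge e' h0' h1'] using congrArg nf h

theorem space_cases (x : X.Space) :
    (∃ v, X.vertex v = x) ∨ ∃ e t, t ≠ 0 ∧ t ≠ 1 ∧ X.edge e t = x := by
  obtain ⟨⟨v, ⟨⟩⟩ | ⟨e, t⟩, rfl⟩ := Quot.exists_rep x
  · exact .inl ⟨v, rfl⟩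
  · change (∃ v, X.vertex v = X.edge e t) ∨ _
    rcases eq_or_ne t 0 with rfl | h0
    · exact .inl ⟨X.src e, (edge_zero e).symm⟩
    rcases eq_or_ne t 1 with rfl | h1
    · exact .inl ⟨X.tgt e, (edge_one e).symm⟩
    · exact .inr ⟨e, t, h0, h1, rfl⟩

/-- The vertices form a discrete summand, so only the edges impose a condition. -/
theorem isOpen_iff {U : Set X.Space} : IsOpen U ↔ ∀ e, IsOpen (X.edge e ⁻¹' U) := by
  refine ⟨fun h e => h.preimage (X.edge e).continuous, fun h => ?_⟩
  refine isOpen_coinduced.2 (isOpen_sum_iff.2 ⟨?_, ?_⟩)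
  · exact isOpen_sigma_iff.2 fun v => isOpen_discrete _
  · exact isOpen_sigma_iff.2 fun e => h e

theorem continuous_iff {W : Type*} [TopologicalSpace W] {φ : X.Space → W} :
    Continuous φ ↔ ∀ e, Continuous (φ ∘ X.edge e) := by
  simp only [continuous_def, isOpen_iff]
  exact ⟨fun h e U hU => h U hU e, fun h U hU e => h e U hU⟩

/-- An edge, as a path between its end points. -/
def epath (X : FinGraph) (e : X.E) : Path (X.vertex (X.src e)) (X.vertex (X.tgt e)) where
  toContinuousMap := X.edge e
  source' := edge_zero e
  target' := edge_one e

variable {W : Type*} [TopologicalSpace W]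

/-- The map from a graph given by the images of the vertices and the edges. -/
def graphMap (pv : X.V → W) (pe : ∀ e, Path (pv (X.src e)) (pv (X.tgt e))) : C(X.Space, W) where
  toFun := Quot.lift (fun p : X.Pieces => match p with
    | Sum.inl v => pv v.1
    | Sum.inr ⟨e, t⟩ => pe e t) (by rintro _ _ (e | e) <;> simp)
  continuous_toFun := continuous_iff.2 fun e => (pe e).continuous

theorem map_ext {φ ψ : C(X.Space, W)} (hv : ∀ v, φ (X.vertex v) = ψ (X.vertex v))
    (he : ∀ e t, φ (X.edge e t) = ψ (X.edge e t)) : φ = ψ := by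
  ext x
  obtain ⟨⟨v, ⟨⟩⟩ | ⟨e, t⟩, rfl⟩ := Quot.exists_rep x
  exacts [hv v, he e t]

/-- A map of a graph is determined up to homotopy, relative to the vertices, by the classes of the
images of the edges. -/
theorem homotopicRel_of_edges {φ ψ : C(X.Space, W)} (hv : ∀ v, φ (X.vertex v) = ψ (X.vertex v))
    (he : ∀ e, (cl(X.epath e) : PClass _ _).map φ =
      ((cl(X.epath e) : PClass _ _).map ψ).cast (hv _) (hv _)) :
    φ.HomotopicRel ψ (Set.range X.vertex) := by
  have he' : ∀ e, Nonempty (Path.Homotopy ((X.epath e).map φ.continuous)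
      (((X.epath e).map ψ.continuous).cast (hv _) (hv _))) := fun e =>
    Path.Homotopic.Quotient.eq.1 (he e)
  have H := fun e => (he' e).some
  -- The homotopies on the edges are glued as a map into the path space of `W`; uncurrying avoids
  -- the topology of the product of a quotient with `I`.
  let G : C(X.Space, C(I, W)) := graphMap (fun v => .const I (φ (X.vertex v))) fun e =>
    { toContinuousMap := ((H e).toContinuousMap.comp .prodSwap).curry
      source' := by
        ext s
        exact (H e).source s
      target' := by
        ext s
        exact (H e).target s }
  have hG : ∀ x, G x 0 = φ x ∧ G x 1 = ψ x := by
    intro x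
    obtain ⟨⟨v, ⟨⟩⟩ | ⟨e, t⟩, rfl⟩ := Quot.exists_rep x
    · exact ⟨rfl, hv v⟩
    · exact ⟨(H e).apply_zero t, (H e).apply_one t⟩
  exact ⟨{ toContinuousMap := G.uncurry.comp .prodSwap
           map_zero_left := fun x => (hG x).1
           map_one_left := fun x => (hG x).2
           prop' := by rintro t _ ⟨v, rfl⟩; rfl }⟩

end FinGraph

theorem map_eq_of_homotopicRel {S T : Type*} [TopologicalSpace S] [TopologicalSpace T]
    {φ ψ : C(S, T)} {U : Set S} (h : φ.HomotopicRel ψ U) {x y : S} (hx : x ∈ U) (hy : y ∈ U)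
    (δ : PClass x y) : δ.map φ = (δ.map ψ).cast (h.some.eq_fst 1 hx ▸ by simp)
      (h.some.eq_fst 1 hy ▸ by simp) := by
  obtain ⟨γ, rfl⟩ := δ.exists_rep
  obtain ⟨F⟩ := h
  refine Path.Homotopic.Quotient.eq.2 ⟨?_⟩
  exact
  { toContinuousMap := F.toContinuousMap.comp (.prodMap (.id I) γ.toContinuousMap)
    map_zero_left := fun t => F.apply_zero _
    map_one_left := fun t => F.apply_one _
    prop' := by
      rintro t _ (rfl | rfl)
      · simpa using F.eq_fst t hx
      · simpa using F.eq_fst t hy }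

namespace FinGraph
variable {X : FinGraph}

/-! ### Edge paths -/

/-- The classes of the paths which are products of edges in `S` and their inverses. -/
inductive EdgeClass (S : Set X.E) : ∀ {v w : X.V}, PClass (X.vertex v) (X.vertex w) → Prop
  | refl (v : X.V) : EdgeClass S (.refl (X.vertex v))
  | edge {v : X.V} {e : X.E} {δ : PClass (X.vertex v) (X.vertex (X.src e))} :
      EdgeClass S δ → e ∈ S → EdgeClass S (δ.trans cl(X.epath e))
  | symm_edge {v : X.V} {e : X.E} {δ : PClass (X.vertex v) (X.vertex (X.tgt e))} :
      EdgeClass S δ → e ∈ S → EdgeClass S (δ.trans (.symm cl(X.epath e)))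

namespace EdgeClass
variable {S S' : Set X.E} {u v w : X.V}

theorem mono (h : S ⊆ S') {δ : PClass (X.vertex v) (X.vertex w)} (hδ : EdgeClass S δ) :
    EdgeClass S' δ := by
  induction hδ with
  | refl => exact .refl v
  | edge _ he ih => exact .edge ih (h he)
  | symm_edge _ he ih => exact .symm_edge ih (h he)

theorem trans {δ : PClass (X.vertex u) (X.vertex v)} {η : PClass (X.vertex v) (X.vertex w)}
    (hδ : EdgeClass S δ) (hη : EdgeClass S η) : EdgeClass S (δ.trans η) := by
  induction hη with
  | refl => simpa using hδ
  | edge _ he ih => rw [← Path.Homotopic.Quotient.trans_assoc]; exact .edge ih he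
  | symm_edge _ he ih => rw [← Path.Homotopic.Quotient.trans_assoc]; exact .symm_edge ih he

theorem single {e : X.E} (he : e ∈ S) : EdgeClass S (cl(X.epath e) : PClass _ _) := by
  simpa using EdgeClass.edge (.refl (X.src e)) he

theorem single_symm {e : X.E} (he : e ∈ S) :
    EdgeClass S (Path.Homotopic.Quotient.symm cl(X.epath e) : PClass _ _) := by
  simpa using EdgeClass.symm_edge (.refl (X.tgt e)) he

theorem symm {δ : PClass (X.vertex u) (X.vertex v)} (hδ : EdgeClass S δ) :
    EdgeClass S δ.symm := by
  induction hδ with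
  | refl =>
    rw [← Path.Homotopic.Quotient.mk_refl, ← Path.Homotopic.Quotient.mk_symm, Path.refl_symm]
    exact .refl u
  | edge _ he ih =>
    rw [quotient_symm_trans]; exact (single_symm he).trans ih
  | symm_edge _ he ih =>
    rw [quotient_symm_trans, quotient_symm_symm]; exact (single he).trans ih

end EdgeClass
end FinGraph

end

/-! ### Classes of initial pieces of paths -/

noncomputable section

theorem quotient_trans_cast_symm {T : Type*} [TopologicalSpace T] {x y y' z : T} (h : y' = y)
    (κ : PClass x y) (ε : PClass z y) :
    (κ.cast rfl h).trans (ε.cast rfl h).symm = κ.trans ε.symm := by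
  subst h
  simp only [Path.Homotopic.Quotient.cast_rfl_rfl]

theorem cl_initial_zero {T : Type*} [TopologicalSpace T] {x y : T} (γ : Path x y) :
    cl(γ.initial 0) = (Path.Homotopic.Quotient.refl x).cast rfl γ.source := by
  rw [← Path.Homotopic.Quotient.mk_refl, ← Path.Homotopic.Quotient.mk_cast]
  congr 1
  ext t
  change γ (Set.Icc.convexComb 0 0 t) = x
  simp

theorem cl_initial_one {T : Type*} [TopologicalSpace T] {x y : T} (γ : Path x y) :
    cl(γ.initial 1) = (cl(γ) : PClass x y).cast rfl γ.target := by
  rw [← Path.Homotopic.Quotient.mk_cast]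
  congr 1
  ext t
  change γ (Set.Icc.convexComb 0 1 t) = γ t
  simp

theorem cl_initial_trans_subpath {T : Type*} [TopologicalSpace T] {x y : T} (γ : Path x y)
    (s t : I) : (cl(γ.initial s) : PClass _ _).trans cl(γ.subpath s t) = cl(γ.initial t) := by
  rw [← Path.Homotopic.Quotient.mk_trans, Path.Homotopic.Quotient.eq]
  have h : Path.Homotopic _ _ := ⟨Path.Homotopy.subpathTransSubpath γ 0 s t⟩
  exact h.pathCast γ.source.symm rfl

theorem quotient_trans_const {T : Type*} [TopologicalSpace T] {x y z : T} (ε : PClass x y)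
    (π : Path y z) (hπ : ∀ t, π t = y) :
    ε.trans cl(π) = ε.cast rfl ((π.target.symm.trans (hπ 1)) : z = y) := by
  obtain rfl : z = y := π.target.symm.trans (hπ 1)
  obtain rfl : π = .refl z := by ext t; exact hπ t
  simp

theorem quotient_trans_cast {T : Type*} [TopologicalSpace T] {x y z z' : T} (h : z' = z)
    (κ : PClass x y) (ε : PClass y z) :
    κ.trans (ε.cast rfl h) = (κ.trans ε).cast rfl h := by
  subst h
  simp only [Path.Homotopic.Quotient.cast_rfl_rfl]

instance : ContractibleSpace I := (convex_Icc (0 : ℝ) 1).contractibleSpace ⟨0, by simp⟩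

/-- The parameters move in `I`, where paths with the same end points are homotopic; `γ` carries this
homotopy along. -/
theorem cl_initial_trans_of_param {T : Type*} [TopologicalSpace T] {x y : T} (γ : Path x y)
    (b : C(I, I)) (π : Path (γ (b 0)) (γ (b 1))) (hπ : ∀ t, π t = γ (b t)) :
    (cl(γ.initial (b 0)) : PClass _ _).trans cl(π) = cl(γ.initial (b 1)) := by
  let q : Path (0 : I) 1 := ⟨.id I, rfl, rfl⟩
  let c : Path (b 0) (b 1) := ⟨b, rfl, rfl⟩
  have h : Path.Homotopic ((q.initial (b 0)).trans c) (q.initial (b 1)) :=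
    SimplyConnectedSpace.paths_homotopic _ _
  have h' := (h.map ⟨γ, γ.continuous⟩).pathCast γ.source.symm rfl
  rw [← Path.Homotopic.Quotient.mk_trans, Path.Homotopic.Quotient.eq]
  have e : (γ.initial (b 0)).trans π = (((q.initial (b 0)).trans c).map γ.continuous).cast
      γ.source.symm rfl := by
    refine Path.ext (funext fun t => ?_)
    change _ = γ ((q.initial (b 0)).trans c t)
    rw [Path.trans_apply]
    erw [Path.trans_apply]
    split_ifs
    · rfl
    · exact hπ _
  rw [e]
  exact h'

namespace FinGraph

variable {X : FinGraph}

theorem isOpen_openEdge (e : X.E) {U : Set I} (hU : IsOpen U) (h0 : 0 ∉ U) (h1 : 1 ∉ U) :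
    IsOpen (X.edge e '' U) := by
  refine isOpen_iff.2 fun e' => ?_
  by_cases he : e' = e
  · subst he
    convert hU
    ext t
    refine ⟨?_, fun h => ⟨t, h, rfl⟩⟩
    rintro ⟨t', ht', h⟩
    exact (edge_eq_edge (fun h => h0 (h ▸ ht')) (fun h => h1 (h ▸ ht')) h.symm).2 ▸ ht'
  · convert isOpen_empty
    ext t
    refine ⟨?_, fun h => h.elim⟩
    rintro ⟨t', ht', h⟩
    exact he (edge_eq_edge (fun h => h0 (h ▸ ht')) (fun h => h1 (h ▸ ht')) h.symm).1

theorem isOpenEmbedding_openEdge (e : X.E) :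
    Topology.IsOpenEmbedding fun t : Set.Ioo (0 : I) 1 => X.edge e t := by
  refine .of_continuous_injective_isOpenMap (by fun_prop) ?_ ?_
  · intro s t h
    exact Subtype.ext (edge_eq_edge t.2.1.ne' t.2.2.ne h).2
  · intro U hU
    have := isOpen_openEdge e (isOpen_Ioo.isOpenMap_subtype_val U hU)
      (by rintro ⟨t, -, h⟩; exact t.2.1.ne' h) (by rintro ⟨t, -, h⟩; exact t.2.2.ne h)
    rwa [Set.image_image] at this

/-- The open star of a vertex: the points at distance less than `1/3` from it. -/
def star (X : FinGraph) (v : X.V) : Set X.Space :=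
  {X.vertex v} ∪ ⋃ e, X.edge e '' {t | (t : ℝ) < 1 / 3 ∧ X.src e = v ∨ 2 / 3 < (t : ℝ) ∧ X.tgt e = v}

theorem isOpen_star (v : X.V) : IsOpen (X.star v) := by
  refine isOpen_iff.2 fun e => ?_
  have : X.edge e ⁻¹' X.star v =
      {t : I | (t : ℝ) < 1 / 3 ∧ X.src e = v ∨ 2 / 3 < (t : ℝ) ∧ X.tgt e = v} := by
    ext t
    refine ⟨?_, fun h => .inr (Set.mem_iUnion.2 ⟨e, t, h, rfl⟩)⟩
    have hv : ∀ {t : I}, X.edge e t = X.vertex v →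
        (t : ℝ) < 1 / 3 ∧ X.src e = v ∨ 2 / 3 < (t : ℝ) ∧ X.tgt e = v := by
      intro t h
      rcases edge_eq_vertex h with ⟨rfl, h'⟩ | ⟨rfl, h'⟩
      · exact .inl ⟨by norm_num, h'⟩
      · exact .inr ⟨by norm_num, h'⟩
    have hv' : ∀ {t : I} {w}, w = v → X.edge e t = X.vertex w →
        (t : ℝ) < 1 / 3 ∧ X.src e = v ∨ 2 / 3 < (t : ℝ) ∧ X.tgt e = v := by
      rintro t w rfl h
      exact hv h
    rintro (h | h)
    · exact hv h
    · obtain ⟨e', t', ht', h : X.edge e' t' = X.edge e t⟩ := Set.mem_iUnion.1 h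
      rcases eq_or_ne t' 0 with rfl | h0
      · rw [edge_zero] at h
        rcases ht' with ⟨-, h2⟩ | ⟨h', -⟩
        · exact hv' h2 h.symm
        · norm_num at h'
      rcases eq_or_ne t' 1 with rfl | h1
      · rw [edge_one] at h
        rcases ht' with ⟨h', -⟩ | ⟨-, h2⟩
        · norm_num at h'
        · exact hv' h2 h.symm
      obtain ⟨rfl, rfl⟩ := edge_eq_edge h0 h1 h.symm
      exact ht'
  rw [this]
  have o1 : IsOpen {t : I | (t : ℝ) < 1 / 3} := isOpen_lt (by fun_prop) (by fun_prop)
  have o2 : IsOpen {t : I | 2 / 3 < (t : ℝ)} := isOpen_lt (by fun_prop) (by fun_prop)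
  exact (o1.inter isOpen_const).union (o2.inter isOpen_const)

/-! ### Every path between vertices is homotopic to an edge path -/

/-- A class which starts at a vertex is an edge path followed by part of an edge, with edges
in `S`. -/
def Good (S : Set X.E) {v : X.V} {y : X.Space} (ε : PClass (X.vertex v) y) : Prop :=
  (∀ w (h : X.vertex w = y), EdgeClass S (ε.cast rfl h)) ∧
  ∀ e ∈ S, ∀ τ (h : X.epath e τ = y),
    EdgeClass S ((ε.cast rfl h).trans (.symm cl((X.epath e).initial τ)))

variable {S : Set X.E}

theorem good_cast {v : X.V} {y y' : X.Space} (h : y' = y) {ε : PClass (X.vertex v) y} :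
    Good S (ε.cast rfl h) ↔ Good S ε := by
  subst h
  rw [Path.Homotopic.Quotient.cast_rfl_rfl]

theorem good_of_edgeClass {v u : X.V} {κ : PClass (X.vertex v) (X.vertex u)}
    (hκ : EdgeClass S κ) : Good S κ := by
  refine ⟨fun w h => ?_, fun e he τ h => ?_⟩
  · obtain rfl := vertex_injective h
    rwa [Path.Homotopic.Quotient.cast_rfl_rfl]
  · rcases edge_eq_vertex h with ⟨rfl, rfl⟩ | ⟨rfl, rfl⟩
    · rw [cl_initial_zero, quotient_trans_cast_symm]
      exact hκ.trans (EdgeClass.refl _).symm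
    · rw [cl_initial_one, quotient_trans_cast_symm]
      exact hκ.trans (.single_symm he)

theorem good_trans_initial {v : X.V} {e : X.E} (he : e ∈ S) {κ : PClass (X.vertex v) (X.vertex (X.src e))}
    (hκ : EdgeClass S κ) (τ : I) : Good S (κ.trans cl((X.epath e).initial τ)) := by
  rcases eq_or_ne τ 0 with rfl | h0
  · rw [cl_initial_zero, quotient_trans_cast, good_cast]
    exact good_of_edgeClass (hκ.trans (.refl _))
  rcases eq_or_ne τ 1 with rfl | h1
  · rw [cl_initial_one, quotient_trans_cast, good_cast]
    exact good_of_edgeClass (hκ.trans (.single he))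
  refine ⟨fun w h => ?_, fun e' he' τ' h => ?_⟩
  · rcases edge_eq_vertex (e := e) (t := τ) h.symm with h | h
    exacts [(h0 h.1).elim, (h1 h.1).elim]
  · obtain ⟨rfl, rfl⟩ := edge_eq_edge h0 h1 h
    rw [Path.Homotopic.Quotient.cast_rfl_rfl, Path.Homotopic.Quotient.trans_assoc,
      Path.Homotopic.Quotient.trans_symm, Path.Homotopic.Quotient.trans_refl]
    exact hκ

/-- Motion inside one edge only exchanges the partial edge at the end of the class: the piece up to
`b 0` is cancelled and the piece up to `b 1` is appended. -/
theorem good_trans_of_edge {v : X.V} {y y' : X.Space} {ε : PClass (X.vertex v) y} (hε : Good S ε)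
    (π : Path y y') {e : X.E} (he : e ∈ S)
    (b : C(I, I)) (hb : ∀ t, π t = X.epath e (b t)) :
    Good S (ε.trans cl(π)) := by
  obtain rfl : X.epath e (b 0) = y := by rw [← hb, π.source]
  obtain rfl : X.epath e (b 1) = y' := by rw [← hb, π.target]
  have key : (cl(π) : PClass _ _) = Path.Homotopic.Quotient.trans
      (.symm cl((X.epath e).initial (b 0))) cl((X.epath e).initial (b 1)) := by
    rw [← cl_initial_trans_of_param _ b π hb, ← Path.Homotopic.Quotient.trans_assoc,
      Path.Homotopic.Quotient.symm_trans, Path.Homotopic.Quotient.refl_trans]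
  rw [key, ← Path.Homotopic.Quotient.trans_assoc]
  refine good_trans_initial he ?_ _
  have := hε.2 e he (b 0) rfl
  rwa [Path.Homotopic.Quotient.cast_rfl_rfl] at this

/-- The parameter change of the unit interval which collapses the two outer thirds. -/
def pinch : C(I, I) := ⟨fun t => Set.projIcc 0 1 zero_le_one (3 * (t : ℝ) - 1), by fun_prop⟩

theorem pinch_of_lt {t : I} (h : (t : ℝ) < 1 / 3) : pinch t = 0 :=
  Set.projIcc_of_le_left zero_le_one (by linarith)

theorem pinch_of_gt {t : I} (h : 2 / 3 < (t : ℝ)) : pinch t = 1 :=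
  Set.projIcc_of_right_le zero_le_one (by linarith)

/-- The map which collapses the stars of the vertices. -/
def collapse (X : FinGraph) : C(X.Space, X.Space) :=
  graphMap X.vertex fun e => (X.epath e).reparam pinch pinch.continuous
    (pinch_of_lt (by norm_num)) (pinch_of_gt (by norm_num))

theorem collapse_edge (e : X.E) (t : I) : X.collapse (X.edge e t) = X.epath e (pinch t) := rfl

/-- Collapsing reparametrizes every edge. It tames paths near the vertices, where they may switch
between edges infinitely often. -/
theorem collapse_homotopicRel : (ContinuousMap.id X.Space).HomotopicRel X.collapse
    (Set.range X.vertex) := by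
  refine homotopicRel_of_edges (fun v => rfl) fun e => ?_
  exact Path.Homotopic.Quotient.eq.2 ⟨Path.Homotopy.reparam (X.epath e) pinch pinch.continuous
    (pinch_of_lt (by norm_num)) (pinch_of_gt (by norm_num))⟩

theorem collapse_of_mem_star {v : X.V} {x : X.Space} (h : x ∈ X.star v) :
    X.collapse x = X.vertex v := by
  rcases h with rfl | h
  · rfl
  · obtain ⟨e, t, ⟨ht, rfl⟩ | ⟨ht, rfl⟩, rfl⟩ := Set.mem_iUnion.1 h
    · rw [collapse_edge, pinch_of_lt ht, Path.source]
    · rw [collapse_edge, pinch_of_gt ht, Path.target]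

theorem exists_ordConnected_nhd {U : Set I} (hU : IsOpen U) {t : I} (ht : t ∈ U) :
    ∃ J ∈ 𝓝 t, J ⊆ U ∧ J.OrdConnected := by
  obtain ⟨ε, hε, h⟩ := Metric.isOpen_iff.1 hU t ht
  refine ⟨_, Metric.ball_mem_nhds t hε, h, ⟨fun a ha b hb c hc => ?_⟩⟩
  rw [Metric.mem_ball, Subtype.dist_eq, Real.dist_eq, abs_lt] at *
  have h1 : (a : ℝ) ≤ c := hc.1
  have h2 : (c : ℝ) ≤ b := hc.2
  constructor <;> linarith

theorem convexComb_mem {J : Set I} (hJ : J.OrdConnected) {s t : I} (hs : s ∈ J) (ht : t ∈ J)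
    (r : I) : Set.Icc.convexComb s t r ∈ J := by
  refine hJ.uIcc_subset hs ht ?_
  rw [← Path.range_subpathAux]
  exact ⟨r, rfl⟩

/-- Near a time at which `γ` is at a vertex, `c` is constant; near any other time, `γ` stays inside
one open edge and `c` in the corresponding edge. -/
theorem exists_nhd_good {v w : X.V} {γ c : Path (X.vertex v) (X.vertex w)}
    (hγc : ∀ t, c t = X.collapse (γ t))
    (hS : ∀ t e τ, τ ≠ 0 → τ ≠ 1 → γ t = X.edge e τ → e ∈ S) (t₀ : I) :
    ∃ J ∈ 𝓝 t₀, ∀ s ∈ J, ∀ t ∈ J,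
      Good S (v := v) cl(c.initial s) →
      Good S (v := v) cl(c.initial t) := by
  rcases space_cases (γ t₀) with ⟨u, hu⟩ | ⟨e, τ, h0, h1, he⟩
  · obtain ⟨J, hJ, hJU, hJc⟩ := exists_ordConnected_nhd (t := t₀)
      ((isOpen_star u).preimage γ.continuous) (.inl hu.symm)
    have hc : ∀ r ∈ J, c r = X.vertex u := fun r hr =>
      (hγc r).trans (collapse_of_mem_star (hJU hr))
    refine ⟨J, hJ, fun s hs t ht h => ?_⟩
    rw [← cl_initial_trans_subpath _ s t, quotient_trans_const, good_cast]
    · exact h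
    · exact fun r => (hc _ (convexComb_mem hJc hs ht r)).trans (hc _ hs).symm
  · obtain ⟨J, hJ, hJU, hJc⟩ := exists_ordConnected_nhd (t := t₀)
      ((isOpenEmbedding_openEdge e).isOpen_range.preimage γ.continuous)
      ⟨⟨τ, unitInterval.pos_iff_ne_zero.2 h0, unitInterval.lt_one_iff_ne_one.2 h1⟩, he⟩
    refine ⟨J, hJ, fun s hs t ht h => ?_⟩
    choose b hb using fun r : I => hJU (convexComb_mem hJc hs ht r)
    have hbc : Continuous b := by
      rw [(isOpenEmbedding_openEdge e).isInducing.continuous_iff]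
      have : Continuous fun r : I => γ (Set.Icc.convexComb s t r) := by fun_prop
      convert this using 1
      exact funext hb
    rw [← cl_initial_trans_subpath _ s t]
    refine good_trans_of_edge h _ (hS t₀ e τ h0 h1 he.symm) (pinch.comp ⟨fun r => (b r).1, by fun_prop⟩) fun r => ?_
    change c (Set.Icc.convexComb s t r) = _
    rw [hγc, ← hb r]
    rfl

/-- Every path between vertices is homotopic to an edge path, which uses only the edges that the
given path meets. -/
theorem edgeClass_of_mem {v w : X.V} (γ : Path (X.vertex v) (X.vertex w))
    (hS : ∀ t e τ, τ ≠ 0 → τ ≠ 1 → γ t = X.edge e τ → e ∈ S) :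
    EdgeClass S (cl(γ) : PClass (X.vertex v) (X.vertex w)) := by
  have hγ := map_eq_of_homotopicRel X.collapse_homotopicRel ⟨v, rfl⟩ ⟨w, rfl⟩ cl(γ)
  rw [quotient_map_id] at hγ
  rw [hγ]
  let c : Path (X.vertex v) (X.vertex w) := γ.map X.collapse.continuous
  -- Connectedness of the interval takes the place of a subdivision into small pieces.
  have hloc : IsLocallyConstant fun t => Good S (v := v) cl(c.initial t) := by
    rw [IsLocallyConstant.iff_eventually_eq]
    intro t₀
    obtain ⟨J, hJ, h⟩ := exists_nhd_good (γ := γ) (c := c) (fun _ => rfl) hS t₀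
    filter_upwards [hJ] with t ht
    exact propext ⟨h t ht t₀ (mem_of_mem_nhds hJ), h t₀ (mem_of_mem_nhds hJ) t ht⟩
  have h0 : Good S (v := v) cl(c.initial 0) := by
    rw [cl_initial_zero, good_cast]
    exact good_of_edgeClass (.refl v)
  have h1 : Good S (v := v) cl(c.initial 1) := by
    have := hloc.apply_eq_of_preconnectedSpace 0 1
    exact this ▸ h0
  rw [cl_initial_one, good_cast] at h1
  have := h1.1 w rfl
  rw [Path.Homotopic.Quotient.cast_rfl_rfl] at this
  exact this

theorem edgeClass_univ {v w : X.V} (δ : PClass (X.vertex v) (X.vertex w)) :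
    EdgeClass Set.univ δ := by
  obtain ⟨γ, rfl⟩ := δ.exists_rep
  exact edgeClass_of_mem γ fun _ _ _ _ _ _ => trivial

end FinGraph

end

noncomputable section

/-! ### The fundamental group of a graph is free -/

theorem IsCoveringMap.monodromy_eq_of_lift {P S : Type*} [TopologicalSpace P] [TopologicalSpace S]
    {π : P → S} (cov : IsCoveringMap π) {x y : S} {γ : Path x y} {p : π ⁻¹' {x}} {b : C(I, P)}
    (h0 : b 0 = p.1) (hb : ∀ t, π (b t) = γ t) : (cov.monodromy cl(γ) p).1 = b 1 := by
  have h : γ.toContinuousMap 0 = π p.1 := by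
    rw [show π p.1 = x from p.2]; simp
  have : b = cov.liftPath γ.toContinuousMap p.1 h :=
    (cov.eq_liftPath_iff' h).2 ⟨funext hb, h0⟩
  rw [this]
  rfl

namespace FinGraph

variable (X : FinGraph)

/-- The gluing of the covering graph. -/
inductive CovGlue : (Σ _ : FreeGroup X.E, X.Pieces) → (Σ _ : FreeGroup X.E, X.Pieces) → Prop
  | src (g : FreeGroup X.E) (e : X.E) : CovGlue ⟨g, Sum.inr ⟨e, 0⟩⟩ ⟨g, Sum.inl ⟨X.src e, ()⟩⟩
  | tgt (g : FreeGroup X.E) (e : X.E) :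
      CovGlue ⟨g, Sum.inr ⟨e, 1⟩⟩ ⟨g * FreeGroup.of e, Sum.inl ⟨X.tgt e, ()⟩⟩

/-- The covering of the graph with group the free group on the edges, such that each edge acts by
its generator. Its components are trees. -/
def Cov : Type := Quot X.CovGlue

instance : TopologicalSpace X.Cov := inferInstanceAs (TopologicalSpace (Quot X.CovGlue))

variable {X}

/-- A point of the covering. -/
def covMk (g : FreeGroup X.E) (p : X.Pieces) : X.Cov := Quot.mk _ ⟨g, p⟩

theorem continuous_covMk (g : FreeGroup X.E) : Continuous (covMk (X := X) g) :=
  continuous_quot_mk.comp continuous_sigmaMk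

theorem covMk_zero (g : FreeGroup X.E) (e : X.E) :
    covMk g (Sum.inr ⟨e, 0⟩) = covMk g (Sum.inl ⟨X.src e, ()⟩) := Quot.sound (.src g e)

theorem covMk_one (g : FreeGroup X.E) (e : X.E) :
    covMk g (Sum.inr ⟨e, 1⟩) = covMk (g * FreeGroup.of e) (Sum.inl ⟨X.tgt e, ()⟩) :=
  Quot.sound (.tgt g e)

instance : MulAction (FreeGroup X.E) X.Cov where
  smul g := Quot.map (fun p => ⟨g * p.1, p.2⟩) (by
    rintro _ _ (⟨h, e⟩ | ⟨h, e⟩)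
    · exact .src _ _
    · rw [← mul_assoc]; exact .tgt _ _)
  one_smul := by
    rintro ⟨g, p⟩
    exact congrArg (covMk · p) (one_mul g)
  mul_smul := by
    rintro g h ⟨k, p⟩
    exact congrArg (covMk · p) (mul_assoc g h k)

theorem smul_covMk (g h : FreeGroup X.E) (p : X.Pieces) : g • covMk h p = covMk (g * h) p := rfl

/-- The covering map. -/
def covProj : X.Cov → X.Space := Quot.lift (fun p => Quot.mk _ p.2) (by
  rintro _ _ (⟨h, e⟩ | ⟨h, e⟩)
  exacts [Quot.sound (.src e), Quot.sound (.tgt e)])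

theorem cov_cases (a : X.Cov) : (∃ g v, covMk g (Sum.inl ⟨v, ()⟩) = a) ∨
    ∃ g e t, t ≠ 0 ∧ t ≠ 1 ∧ covMk g (Sum.inr ⟨e, t⟩) = a := by
  obtain ⟨⟨g, ⟨v, ⟨⟩⟩ | ⟨e, t⟩⟩, rfl⟩ := Quot.exists_rep a
  · exact .inl ⟨g, v, rfl⟩
  · rcases eq_or_ne t 0 with rfl | h0
    · exact .inl ⟨_, _, (covMk_zero g e).symm⟩
    rcases eq_or_ne t 1 with rfl | h1
    · exact .inl ⟨_, _, (covMk_one g e).symm⟩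
    · exact .inr ⟨g, e, t, h0, h1, rfl⟩

theorem isOpen_cov_iff {U : Set X.Cov} :
    IsOpen U ↔ ∀ g e, IsOpen {t : I | covMk g (Sum.inr ⟨e, t⟩) ∈ U} := by
  refine ⟨fun h g e => h.preimage ((continuous_covMk g).comp
    (continuous_inr.comp continuous_sigmaMk)), fun h => ?_⟩
  refine isOpen_coinduced.2 (isOpen_sigma_iff.2 fun g => isOpen_sum_iff.2 ⟨?_, ?_⟩)
  · exact isOpen_sigma_iff.2 fun v => isOpen_discrete _
  · exact isOpen_sigma_iff.2 fun e => h g e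

/-- The sheet of a point of the covering, where the edges are cut at `c`. -/
def sheet (c : ℝ) (hc0 : 0 ≤ c) (hc1 : c < 1) : X.Cov → FreeGroup X.E := by
  classical
  refine Quot.lift (fun p => match p with
    | ⟨g, Sum.inl _⟩ => g
    | ⟨g, Sum.inr ⟨e, t⟩⟩ => if (t : ℝ) ≤ c then g else g * FreeGroup.of e) ?_
  rintro _ _ (⟨h, e⟩ | ⟨h, e⟩)
  · simp [hc0]
  · simp [hc1]

theorem sheet_edge_le {c : ℝ} (hc0 : 0 ≤ c) (hc1 : c < 1) (g : FreeGroup X.E) (e : X.E) {t : I}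
    (h : (t : ℝ) ≤ c) : sheet c hc0 hc1 (covMk g (Sum.inr ⟨e, t⟩)) = g := if_pos h

theorem sheet_edge_gt {c : ℝ} (hc0 : 0 ≤ c) (hc1 : c < 1) (g : FreeGroup X.E) (e : X.E) {t : I}
    (h : c < (t : ℝ)) : sheet c hc0 hc1 (covMk g (Sum.inr ⟨e, t⟩)) = g * FreeGroup.of e :=
  if_neg h.not_ge

theorem sheet_smul {c : ℝ} (hc0 : 0 ≤ c) (hc1 : c < 1) (k : FreeGroup X.E) (a : X.Cov) :
    sheet c hc0 hc1 (k • a) = k * sheet c hc0 hc1 a := by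
  obtain ⟨⟨g, ⟨v, ⟨⟩⟩ | ⟨e, t⟩⟩, rfl⟩ := Quot.exists_rep a
  · rfl
  · change sheet c hc0 hc1 (covMk _ _) = k * sheet c hc0 hc1 (covMk _ _)
    rcases le_or_gt (t : ℝ) c with h | h
    · rw [sheet_edge_le _ _ _ _ h, sheet_edge_le _ _ _ _ h]
    · rw [sheet_edge_gt _ _ _ _ h, sheet_edge_gt _ _ _ _ h, mul_assoc]

/-- Away from the points with parameter `c`, `sheet` is locally constant. As it is equivariant, a
nontrivial group element moves the points of one sheet off that sheet. -/
theorem cov_disjoint_of_cut {c : ℝ} (hc0 : 0 < c) (hc1 : c < 1) (a : X.Cov)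
    (ha : ∀ e (t : I), covProj a = X.edge e t → (t : ℝ) ≠ c) :
    ∃ U ∈ 𝓝 a, ∀ g : FreeGroup X.E, ((g • ·) '' U ∩ U).Nonempty → g = 1 := by
  refine ⟨{b | sheet c hc0.le hc1 b = sheet c hc0.le hc1 a ∧
    ∀ e (t : I), covProj b = X.edge e t → (t : ℝ) ≠ c}, IsOpen.mem_nhds ?_ ⟨rfl, ha⟩, ?_⟩
  · refine isOpen_cov_iff.2 fun g e => ?_
    have : {t : I | covMk g (Sum.inr ⟨e, t⟩) ∈ {b | sheet c hc0.le hc1 b = sheet c hc0.le hc1 a ∧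
        ∀ e (t : I), covProj b = X.edge e t → (t : ℝ) ≠ c}} =
        {t : I | (t : ℝ) < c ∧ g = sheet c hc0.le hc1 a} ∪
        {t : I | c < (t : ℝ) ∧ g * FreeGroup.of e = sheet c hc0.le hc1 a} := by
      ext t
      constructor
      · rintro ⟨h1, h2⟩
        rcases lt_or_gt_of_ne (h2 e t rfl) with h | h
        · rw [sheet_edge_le _ _ _ _ h.le] at h1
          exact .inl ⟨h, h1⟩
        · rw [sheet_edge_gt _ _ _ _ h] at h1
          exact .inr ⟨h, h1⟩
      · have hne : (t : ℝ) ≠ c → ∀ e' (t' : I), X.edge e t = X.edge e' t' → (t' : ℝ) ≠ c := by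
          rintro ht e' t' h rfl
          exact ht (congrArg Subtype.val (edge_eq_edge (by rintro rfl; simp at hc0)
            (by rintro rfl; simp at hc1) h).2)
        rintro (⟨h1, h2⟩ | ⟨h1, h2⟩)
        · exact ⟨(sheet_edge_le _ _ _ _ h1.le).trans h2, hne h1.ne⟩
        · exact ⟨(sheet_edge_gt _ _ _ _ h1).trans h2, hne h1.ne'⟩
    rw [this]
    have o1 : IsOpen {t : I | (t : ℝ) < c} := isOpen_lt (by fun_prop) (by fun_prop)
    have o2 : IsOpen {t : I | c < (t : ℝ)} := isOpen_lt (by fun_prop) (by fun_prop)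
    exact (o1.inter isOpen_const).union (o2.inter isOpen_const)
  · rintro g ⟨_, ⟨b, hb, rfl⟩, hb'⟩
    have := hb'.1
    dsimp only at this
    rw [sheet_smul, hb.1] at this
    exact mul_eq_right.1 this

theorem isQuotientCoveringMap_covProj :
    IsQuotientCoveringMap (covProj (X := X)) (FreeGroup X.E) where
  toIsQuotientMap := by
    have hc : Continuous (covProj (X := X)) :=
      continuous_quot_lift _ (continuous_quot_mk.comp
        (continuous_sigma fun _ => continuous_id))
    refine Topology.IsQuotientMap.of_comp (f := covMk 1) (continuous_covMk 1) hc ?_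
    exact isQuotientMap_quot_mk
  continuous_const_smul g := by
    refine continuous_def.2 fun U hU => isOpen_cov_iff.2 fun h e => ?_
    exact isOpen_cov_iff.1 hU (g * h) e
  apply_eq_iff_mem_orbit {a b} := by
    constructor
    · intro h
      rcases cov_cases a with ⟨g, v, rfl⟩ | ⟨g, e, t, h0, h1, rfl⟩ <;>
      rcases cov_cases b with ⟨g', v', rfl⟩ | ⟨g', e', t', h0', h1', rfl⟩
      · obtain rfl : v = v' := vertex_injective h
        exact ⟨g * g'⁻¹, by simp [smul_covMk]⟩
      · rcases edge_eq_vertex (e := e') (t := t') (v := v) h.symm with h | h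
        exacts [(h0' h.1).elim, (h1' h.1).elim]
      · rcases edge_eq_vertex (e := e) (t := t) (v := v') h with h | h
        exacts [(h0 h.1).elim, (h1 h.1).elim]
      · obtain ⟨rfl, rfl⟩ := edge_eq_edge (e' := e) (t' := t) h0' h1' h
        exact ⟨g * g'⁻¹, by simp [smul_covMk]⟩
    · rintro ⟨g, rfl⟩
      obtain ⟨⟨h, p⟩, rfl⟩ := Quot.exists_rep b
      rfl
  disjoint a := by
    -- Edges are cut at their midpoints, unless the given point is itself a midpoint; then they are
    -- cut at `1 / 4`.
    by_cases h : ∀ e (t : I), covProj a = X.edge e t → (t : ℝ) ≠ 1 / 2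
    · exact cov_disjoint_of_cut (by norm_num) (by norm_num) a h
    · push Not at h
      obtain ⟨e, t, h, ht⟩ := h
      refine cov_disjoint_of_cut (c := 1 / 4) (by norm_num) (by norm_num) a fun e' t' h' ht' => ?_
      have := (edge_eq_edge (by rintro rfl; norm_num at ht) (by rintro rfl; norm_num at ht)
        (h'.symm.trans h)).2
      rw [this, ht] at ht'
      norm_num at ht'

theorem monodromy_epath (g : FreeGroup X.E) (e : X.E)
    (p : covProj ⁻¹' {X.vertex (X.src e)}) (hp : p.1 = covMk g (Sum.inl ⟨X.src e, ()⟩)) :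
    ((isQuotientCoveringMap_covProj (X := X)).isCoveringMap.monodromy cl(X.epath e) p).1 =
      covMk (g * FreeGroup.of e) (Sum.inl ⟨X.tgt e, ()⟩) := by
  rw [IsCoveringMap.monodromy_eq_of_lift (b := ⟨fun t => covMk g (Sum.inr ⟨e, t⟩),
    (continuous_covMk g).comp (continuous_inr.comp continuous_sigmaMk)⟩)]
  · exact covMk_one g e
  · exact (covMk_zero g e).trans hp.symm
  · exact fun t => rfl

/-- The word in the edges read along `δ` is recorded twice: as the sheet where the lift of `δ` ends,
and as the loop obtained by closing up `δ` with the paths `τ`. So a loop with closed lift has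
trivial word and is trivial. The opposite group makes products follow the order of concatenation. -/
theorem exists_word {v : X.V} (τ : ∀ w, PClass (X.vertex v) (X.vertex w))
    (Φ : FreeGroup X.E →* (FundamentalGroup X.Space (X.vertex v))ᵐᵒᵖ)
    (hΦ : ∀ e, Φ (FreeGroup.of e) = .op (FundamentalGroup.fromPath
      (((τ (X.src e)).trans cl(X.epath e)).trans (τ (X.tgt e)).symm)))
    (p : covProj ⁻¹' {X.vertex v}) (hp : p.1 = covMk 1 (Sum.inl ⟨v, ()⟩))
    {w : X.V} {δ : PClass (X.vertex v) (X.vertex w)} (hδ : EdgeClass Set.univ δ) :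
    ∃ g : FreeGroup X.E,
      ((isQuotientCoveringMap_covProj (X := X)).isCoveringMap.monodromy δ p).1 =
        covMk g (Sum.inl ⟨w, ()⟩) ∧
      Φ g = .op (FundamentalGroup.fromPath (((τ v).trans δ).trans (τ w).symm)) := by
  set cov := (isQuotientCoveringMap_covProj (X := X)).isCoveringMap
  have hmul : ∀ a b : PClass (X.vertex v) (X.vertex v),
      MulOpposite.op (FundamentalGroup.fromPath a) * .op (FundamentalGroup.fromPath b) =
        .op (FundamentalGroup.fromPath (a.trans b)) := fun a b => rfl
  induction hδ with
  | refl =>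
    refine ⟨1, ?_, ?_⟩
    · rw [cov.monodromy_refl]; exact hp
    · rw [map_one, Path.Homotopic.Quotient.trans_refl, Path.Homotopic.Quotient.trans_symm]
      rfl
  | @edge e δ _ _ ih =>
    obtain ⟨g, h1, h2⟩ := ih
    refine ⟨g * FreeGroup.of e, ?_, ?_⟩
    · rw [cov.monodromy_trans_apply]
      exact monodromy_epath g e _ h1
    · rw [map_mul, h2, hΦ, hmul]
      congr 2
      simp only [Path.Homotopic.Quotient.trans_assoc]
      rw [← Path.Homotopic.Quotient.trans_assoc (τ _).symm, Path.Homotopic.Quotient.symm_trans,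
        Path.Homotopic.Quotient.refl_trans]
  | @symm_edge e δ _ _ ih =>
    obtain ⟨g, h1, h2⟩ := ih
    refine ⟨g * (FreeGroup.of e)⁻¹, ?_, ?_⟩
    · have hp' : covProj (covMk (g * (FreeGroup.of e)⁻¹) (Sum.inl ⟨X.src e, ()⟩)) =
        X.vertex (X.src e) := rfl
      have := monodromy_epath (g * (FreeGroup.of e)⁻¹) e ⟨_, hp'⟩ rfl
      rw [inv_mul_cancel_right, ← h1] at this
      rw [cov.monodromy_trans_apply, ← Subtype.ext this, ← cov.monodromy_trans_apply,
        Path.Homotopic.Quotient.trans_symm, cov.monodromy_refl]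
      rfl
    · have : MulOpposite.op (FundamentalGroup.fromPath
          (((τ (X.src e)).trans cl(X.epath e)).trans (τ (X.tgt e)).symm)) *
          .op (FundamentalGroup.fromPath (((τ (X.tgt e)).trans (.symm cl(X.epath e))).trans
            (τ (X.src e)).symm)) = 1 := by
        rw [hmul]
        change MulOpposite.op (FundamentalGroup.fromPath _) =
          .op (FundamentalGroup.fromPath (.refl _))
        congr 2
        simp only [Path.Homotopic.Quotient.trans_assoc]
        rw [← Path.Homotopic.Quotient.trans_assoc (τ (X.tgt e)).symm,
          Path.Homotopic.Quotient.symm_trans, Path.Homotopic.Quotient.refl_trans,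
          ← Path.Homotopic.Quotient.trans_assoc (cl(X.epath e)),
          Path.Homotopic.Quotient.trans_symm, Path.Homotopic.Quotient.refl_trans,
          Path.Homotopic.Quotient.trans_symm]
      rw [map_mul, map_inv, h2, hΦ, inv_eq_of_mul_eq_one_right this, hmul]
      congr 2
      simp only [Path.Homotopic.Quotient.trans_assoc]
      rw [← Path.Homotopic.Quotient.trans_assoc (τ (X.tgt e)).symm,
        Path.Homotopic.Quotient.symm_trans, Path.Homotopic.Quotient.refl_trans]

instance : LocallyPathConnectedSpace I :=
  (isQuotientMap_projIcc (h := zero_le_one' ℝ)).locallyPathConnectedSpace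

theorem pathConnectedSpace_of_connectedSpace [ConnectedSpace X.Space] : PathConnectedSpace X.Space :=
  pathConnectedSpace_iff_connectedSpace.2 inferInstance

/-- Monodromy of the covering maps the fundamental group to the opposite of the free group on the
edges. By `exists_word` it is injective, and subgroups of free groups are free. -/
theorem isFreeGroup_fundamentalGroup [PathConnectedSpace X.Space] (v : X.V) :
    IsFreeGroup (FundamentalGroup X.Space (X.vertex v)) := by
  let τ : ∀ w, PClass (X.vertex v) (X.vertex w) := fun w =>
    cl((PathConnectedSpace.joined (X.vertex v) (X.vertex w)).somePath)
  let Φ : FreeGroup X.E →* (FundamentalGroup X.Space (X.vertex v))ᵐᵒᵖ :=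
    FreeGroup.lift fun e => .op (FundamentalGroup.fromPath
      (((τ (X.src e)).trans cl(X.epath e)).trans (τ (X.tgt e)).symm))
  let p : covProj ⁻¹' {X.vertex v} := ⟨covMk 1 (Sum.inl ⟨v, ()⟩), rfl⟩
  have hq := isQuotientCoveringMap_covProj (X := X)
  have hinj : Function.Injective (hq.fundamentalGroupToMulOpposite p) := by
    rw [injective_iff_map_eq_one]
    intro δ hδ
    rw [hq.fundamentalGroupToMulOpposite_eq_one_iff] at hδ
    obtain ⟨g, h1, h2⟩ := exists_word τ Φ (fun e => FreeGroup.lift_apply_of) p rfl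
      (edgeClass_univ (FundamentalGroup.toPath δ))
    have h3 : covMk 1 (Sum.inl ⟨v, ()⟩) = covMk g (Sum.inl ⟨v, ()⟩) := by
      rw [← h1]; exact congrArg Subtype.val hδ.symm
    -- Any cut recovers the group element from a vertex of the covering; `0` is a convenient one.
    have h4 : (1 : FreeGroup X.E) = g := congrArg (sheet 0 le_rfl one_pos) h3
    rw [← h4, map_one] at h2
    have h5 : Path.Homotopic.Quotient.refl _ = ((τ v).trans (FundamentalGroup.toPath δ)).trans
      (τ v).symm := MulOpposite.op_injective h2
    have h6 := congrArg (fun a => ((τ v).symm.trans a).trans (τ v)) h5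
    simp only [Path.Homotopic.Quotient.trans_assoc, Path.Homotopic.Quotient.symm_trans,
      Path.Homotopic.Quotient.trans_refl] at h6
    rw [← Path.Homotopic.Quotient.trans_assoc, Path.Homotopic.Quotient.symm_trans,
      Path.Homotopic.Quotient.refl_trans] at h6
    exact h6.symm
  have : IsFreeGroup (FreeGroup X.E)ᵐᵒᵖ := IsFreeGroup.ofMulEquiv (MulEquiv.inv' _)
  exact IsFreeGroup.ofMulEquiv (MonoidHom.ofInjective hinj).symm

end FinGraph

end

noncomputable section

/-! ### Equivalence of carrier graphs -/

section PClass
variable {S T : Type} [TopologicalSpace S] [TopologicalSpace T] {x y z : T}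

theorem quotient_symm_trans_cancel (δ : PClass x y) (η : PClass y z) :
    δ.symm.trans (δ.trans η) = η := by
  rw [← Path.Homotopic.Quotient.trans_assoc, Path.Homotopic.Quotient.symm_trans,
    Path.Homotopic.Quotient.refl_trans]

theorem quotient_trans_symm_cancel (δ : PClass y x) (η : PClass y z) :
    δ.trans (δ.symm.trans η) = η := by
  rw [← Path.Homotopic.Quotient.trans_assoc, Path.Homotopic.Quotient.trans_symm,
    Path.Homotopic.Quotient.refl_trans]

theorem quotient_refl_symm : (Path.Homotopic.Quotient.refl x).symm = .refl x := by
  rw [← Path.Homotopic.Quotient.mk_refl, ← Path.Homotopic.Quotient.mk_symm, Path.refl_symm]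

theorem map_quotient_refl (φ : C(T, S)) : (Path.Homotopic.Quotient.refl x).map φ = .refl (φ x) := by
  rfl

theorem map_trans_evalAt {φ ψ : C(T, S)} (F : φ.Homotopy ψ) (δ : PClass x y) :
    (δ.map φ).trans cl(F.evalAt y) = Path.Homotopic.Quotient.trans cl(F.evalAt x) (δ.map ψ) := by
  obtain ⟨γ, rfl⟩ := δ.exists_rep
  exact Path.Homotopic.Quotient.eq.2 (Path.Homotopic.map_trans_evalAt F γ)

theorem quotient_map_map {R : Type} [TopologicalSpace R] (φ : C(T, S)) (ψ : C(S, R))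
    (δ : PClass x y) : (δ.map φ).map ψ = δ.map (ψ.comp φ) := by
  obtain ⟨γ, rfl⟩ := δ.exists_rep
  rfl

theorem quotient_cast_trans_cast {x' y' z' : T} (hx : x' = x) (hy : y' = y) (hz : z' = z)
    (δ : PClass x y) (η : PClass y z) :
    (δ.cast hx hy).trans (η.cast hy hz) = (δ.trans η).cast hx hz := by
  subst hx hy hz
  simp only [Path.Homotopic.Quotient.cast_rfl_rfl]

theorem quotient_cast_symm {x' y' : T} (hx : x' = x) (hy : y' = y) (δ : PClass x y) :
    (δ.cast hx hy).symm = δ.symm.cast hy hx := by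
  subst hx hy
  simp only [Path.Homotopic.Quotient.cast_rfl_rfl]

theorem quotient_cast_self {hx : x = x} {hy : y = y} (δ : PClass x y) : δ.cast hx hy = δ :=
  Path.Homotopic.Quotient.cast_rfl_rfl δ

theorem quotient_refl_cast {x' : T} (hx : x' = x) :
    (Path.Homotopic.Quotient.refl x).cast hx hx = .refl x' := by
  subst hx
  simp only [Path.Homotopic.Quotient.cast_rfl_rfl]

theorem map_conj_eq {a b c d : T} {k : C(T, S)} {α : PClass a b} {m : PClass a d}
    {β : PClass c d} {A : PClass (k a) (k b)} {B : PClass (k c) (k d)} {E : PClass (k b) (k c)}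
    (hα : α.map k = A) (hβ : β.map k = B) (hm : m.map k = (A.trans E).trans B) :
    ((α.symm.trans m).trans β.symm).map k = E := by
  rw [map_quotient_trans, map_quotient_trans, map_quotient_symm, map_quotient_symm, hα, hβ, hm]
  simp only [Path.Homotopic.Quotient.trans_assoc, Path.Homotopic.Quotient.trans_symm,
    Path.Homotopic.Quotient.trans_refl, quotient_symm_trans_cancel]

theorem map_conj_eq' {a b c d : T} {k : C(T, S)} {α : PClass a b} {m : PClass b c}
    {β : PClass c d} {A : PClass (k a) (k b)} {B : PClass (k c) (k d)} {E : PClass (k a) (k d)}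
    (hα : α.map k = A) (hβ : β.map k = B) (hm : m.map k = (A.symm.trans E).trans B.symm) :
    ((α.trans m).trans β).map k = E := by
  rw [map_quotient_trans, map_quotient_trans, hα, hβ, hm]
  simp only [Path.Homotopic.Quotient.trans_assoc, Path.Homotopic.Quotient.symm_trans,
    Path.Homotopic.Quotient.trans_refl, quotient_trans_symm_cancel]

end PClass

section Carrier

variable {M : HypManifold} {X X' X'' : FinGraph} {f : C(X.Space, M.Carrier)}
  {f' : C(X'.Space, M.Carrier)} {f'' : C(X''.Space, M.Carrier)}

theorem IsCarrierGraph.pathConnectedSpace (hf : IsCarrierGraph f) : PathConnectedSpace X.Space :=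
  have := hf.1
  FinGraph.pathConnectedSpace_of_connectedSpace

/-- A loop at `f' x` is conjugated to a loop at `f x₁` along the tracks of the two homotopies,
lifted there to `X`, and carried over by `h`. Competitors in a minimality argument therefore need
only be equivalent. -/
theorem IsCarrierGraph.of_carrierEquiv (hf : IsCarrierGraph f) (h : CarrierEquiv f f') :
    IsCarrierGraph f' := by
  obtain ⟨h, ⟨F⟩⟩ := h
  have := hf.pathConnectedSpace
  let K := h.right_inv.some
  have hconn : PathConnectedSpace X'.Space :=
    { nonempty := hf.1.toNonempty.map h
      joined := fun x y => by
        have e : ∀ x, Joined x (h.toFun (h.invFun x)) := fun x => ⟨(K.evalAt x).symm⟩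
        refine (e x).trans (Joined.trans ?_ (e y).symm)
        exact ⟨(PathConnectedSpace.somePath (h.invFun x) (h.invFun y)).map h.toFun.continuous⟩ }
  refine ⟨inferInstance, fun x m => ?_⟩
  let x₁ := h.invFun x
  let κ : PClass (h.toFun x₁) x := cl(K.evalAt x)
  let η : PClass (f x₁) (f' (h.toFun x₁)) := cl(F.evalAt x₁)
  let m' : PClass (f' x) (f' x) := m
  obtain ⟨δ, hδ⟩ := hf.2 x₁ (FundamentalGroup.fromPath
    ((((η.trans (κ.map f')).trans m').trans (κ.map f').symm).trans η.symm))
  let δ' : PClass x₁ x₁ := δ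
  have hδ' : δ'.map f = (((η.trans (κ.map f')).trans m').trans (κ.map f').symm).trans η.symm := hδ
  refine ⟨FundamentalGroup.fromPath ((κ.symm.trans (δ'.map h.toFun)).trans κ), ?_⟩
  change ((κ.symm.trans (δ'.map h.toFun)).trans κ).map f' = m'
  have hnat := map_trans_evalAt F δ'
  rw [hδ', ← quotient_map_map] at hnat
  have h1 : (δ'.map h.toFun).map f' = ((κ.map f').trans m').trans (κ.map f').symm := by
    have := congrArg (fun a => η.symm.trans a) hnat
    simp only [Path.Homotopic.Quotient.trans_assoc, Path.Homotopic.Quotient.symm_trans,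
      Path.Homotopic.Quotient.trans_refl, η, quotient_symm_trans_cancel] at this
    rw [← this]
    simp only [Path.Homotopic.Quotient.trans_assoc]
  rw [map_quotient_trans, map_quotient_trans, h1, map_quotient_symm]
  simp only [Path.Homotopic.Quotient.trans_assoc, Path.Homotopic.Quotient.symm_trans,
    Path.Homotopic.Quotient.trans_refl, quotient_symm_trans_cancel]

theorem CarrierEquiv.trans (h : CarrierEquiv f f') (h' : CarrierEquiv f' f'') :
    CarrierEquiv f f'' := by
  obtain ⟨h, hF⟩ := h
  obtain ⟨h', hF'⟩ := h'
  exact ⟨h.trans h', hF.trans (hF'.comp (.refl _))⟩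

/-- Minimality, for an equivalence given by maps in both directions. -/
theorem IsMinimalLength.graphLength_le (hf : IsMinimalLength f) (h : CarrierEquiv f f') :
    graphLength f ≤ graphLength f' :=
  hf.2 X' f' (hf.1.of_carrierEquiv h) h

theorem IsMinimalLength.of_carrierEquiv (hf : IsMinimalLength f) (h : CarrierEquiv f f')
    (hlen : graphLength f' ≤ graphLength f) : IsMinimalLength f' :=
  ⟨hf.1.of_carrierEquiv h, fun X'' f'' hf'' h' => hlen.trans (hf.2 X'' f'' hf'' (h.trans h'))⟩

theorem carrierEquiv_of_maps (h : C(X.Space, X'.Space)) (k : C(X'.Space, X.Space))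
    (hkh : (k.comp h).Homotopic (.id _)) (hhk : (h.comp k).Homotopic (.id _))
    (hF : f.Homotopic (f'.comp h)) : CarrierEquiv f f' :=
  ⟨⟨h, k, hkh, hhk⟩, hF⟩

theorem homotopic_of_edges {W : Type*} [TopologicalSpace W] {φ ψ : C(X.Space, W)}
    (hv : ∀ v, φ (X.vertex v) = ψ (X.vertex v))
    (he : ∀ e, (cl(X.epath e) : PClass _ _).map φ =
      ((cl(X.epath e) : PClass _ _).map ψ).cast (hv _) (hv _)) : φ.Homotopic ψ :=
  (FinGraph.homotopicRel_of_edges hv he).homotopic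

/-- The length of an edge as a real number. -/
def edgeLen (f : C(X.Space, M.Carrier)) (e : X.E) : ℝ := (edgeLength f e).toReal

theorem edgeLength_eq_len (e : X.E) : edgeLength f e = len f (X.epath e) := rfl

theorem disp_map {T S : Type} [TopologicalSpace T] [TopologicalSpace S] (φ : C(T, S))
    (f : C(S, M.Carrier)) {x y : T} (δ : PClass x y) :
    disp f (δ.map φ) = disp (f.comp φ) δ := by
  obtain ⟨p⟩ := nonempty_fiber f (φ x)
  let p' : M.proj ⁻¹' {(f.comp φ) x} := p
  rw [disp_eq f _ p, disp_eq _ δ p']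
  unfold dev
  rw [quotient_map_map]

/-- Replacing every edge by a geodesic in its class gives an equivalent carrier graph of finite
length. -/
theorem IsMinimalLength.graphLength_ne_top (hf : IsMinimalLength f) : graphLength f ≠ ⊤ := by
  choose γ hγ hlen using fun e => exists_geodesic_rep ((cl(X.epath e) : PClass _ _).map f)
  let g : C(X.Space, M.Carrier) := FinGraph.graphMap (fun v => f (X.vertex v)) γ
  have h : CarrierEquiv f g := by
    refine ⟨.refl _, ?_⟩
    refine homotopic_of_edges (fun v => rfl) fun e => ?_
    exact (hγ e).symm.trans (quotient_cast_self _).symm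
  refine ne_top_of_le_ne_top ?_ (hf.graphLength_le h)
  refine (ENNReal.sum_lt_top.2 fun e _ => ?_).ne
  exact (hlen e).trans_lt ENNReal.ofReal_lt_top

theorem IsMinimalLength.edgeLength_ne_top (hf : IsMinimalLength f) (e : X.E) :
    edgeLength f e ≠ ⊤ :=
  (ENNReal.sum_ne_top.1 hf.graphLength_ne_top) e (Finset.mem_univ e)

theorem IsMinimalLength.ofReal_edgeLen (hf : IsMinimalLength f) (e : X.E) :
    ENNReal.ofReal (edgeLen f e) = edgeLength f e :=
  ENNReal.ofReal_toReal (hf.edgeLength_ne_top e)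

theorem edgeLen_nonneg (e : X.E) : 0 ≤ edgeLen f e := ENNReal.toReal_nonneg

/-! ### Sliding the ends of an edge -/

namespace FinGraph

/-- Transport of edge paths from one graph to another. -/
theorem EdgeClass.transport {S : Set X.E} {S' : Set X'.E} (ν : X.V → X'.V)
    (ε : ∀ e ∈ S, PClass (X'.vertex (ν (X.src e))) (X'.vertex (ν (X.tgt e))))
    (hε : ∀ e he, EdgeClass S' (ε e he)) {v w : X.V} {δ : PClass (X.vertex v) (X.vertex w)}
    (hδ : EdgeClass S δ) :
    ∃ δ' : PClass (X'.vertex (ν v)) (X'.vertex (ν w)), EdgeClass S' δ' ∧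
      ∀ {W : Type} [TopologicalSpace W] (φ : C(X.Space, W)) (φ' : C(X'.Space, W))
        (hv : ∀ v, φ (X.vertex v) = φ' (X'.vertex (ν v))),
        (∀ e he, (cl(X.epath e) : PClass _ _).map φ = ((ε e he).map φ').cast (hv _) (hv _)) →
        δ.map φ = (δ'.map φ').cast (hv _) (hv _) := by
  induction hδ with
  | refl =>
    refine ⟨.refl _, .refl _, fun φ φ' hv he => ?_⟩
    rw [map_quotient_refl, map_quotient_refl, quotient_refl_cast]
  | @edge e δ _ heS ih =>
    obtain ⟨δ', h1, h2⟩ := ih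
    refine ⟨δ'.trans (ε e heS), h1.trans (hε e heS), fun φ φ' hv he => ?_⟩
    rw [map_quotient_trans, map_quotient_trans, h2 φ φ' hv he, he e heS, quotient_cast_trans_cast]
  | @symm_edge e δ _ heS ih =>
    obtain ⟨δ', h1, h2⟩ := ih
    refine ⟨δ'.trans (ε e heS).symm, h1.trans (hε e heS).symm, fun φ φ' hv he => ?_⟩
    rw [map_quotient_trans, map_quotient_trans, h2 φ φ' hv he, map_quotient_symm,
      map_quotient_symm, he e heS, quotient_cast_symm, quotient_cast_trans_cast]

/-- The graph obtained by sliding the ends of the edge `e₀` to the vertices `v` and `w`. -/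
def slide (X : FinGraph) (e₀ : X.E) (v w : X.V) : FinGraph where
  V := X.V
  E := Option {e : X.E // e ≠ e₀}
  fintypeE := by classical infer_instance
  src o := o.elim v fun e => X.src e
  tgt o := o.elim w fun e => X.tgt e

theorem sum_option_ne {e₀ : X.E} [Fintype {e : X.E // e ≠ e₀}] (a : X.E → ℝ≥0∞) :
    ∑ e, a e = a e₀ + ∑ e : {e : X.E // e ≠ e₀}, a e := by
  classical
  rw [← Finset.add_sum_erase _ _ (Finset.mem_univ e₀)]
  congr 1
  rw [Finset.sum_subtype]
  simp


open Classical in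
/-- The class in the new graph which corresponds to an edge of the old one. -/
def slideClass {e₀ : X.E} {v w : X.V}
    (α : PClass ((X.slide e₀ v w).vertex v) ((X.slide e₀ v w).vertex (X.src e₀)))
    (β : PClass ((X.slide e₀ v w).vertex (X.tgt e₀)) ((X.slide e₀ v w).vertex w)) (e : X.E) :
    PClass ((X.slide e₀ v w).vertex (X.src e)) ((X.slide e₀ v w).vertex (X.tgt e)) :=
  if h : e = e₀ then by
    subst h
    exact (α.symm.trans cl((X.slide e v w).epath none)).trans β.symm
  else cl((X.slide e₀ v w).epath (some ⟨e, h⟩))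

theorem slideClass_self {e₀ : X.E} {v w : X.V}
    (α : PClass ((X.slide e₀ v w).vertex v) ((X.slide e₀ v w).vertex (X.src e₀)))
    (β : PClass ((X.slide e₀ v w).vertex (X.tgt e₀)) ((X.slide e₀ v w).vertex w)) :
    slideClass α β e₀ = (α.symm.trans cl((X.slide e₀ v w).epath none)).trans β.symm :=
  dif_pos rfl

theorem slideClass_of_ne {e₀ : X.E} {v w : X.V}
    (α : PClass ((X.slide e₀ v w).vertex v) ((X.slide e₀ v w).vertex (X.src e₀)))
    (β : PClass ((X.slide e₀ v w).vertex (X.tgt e₀)) ((X.slide e₀ v w).vertex w)) {e : X.E}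
    (h : e ≠ e₀) : slideClass α β e = cl((X.slide e₀ v w).epath (some ⟨e, h⟩)) :=
  dif_neg h

end FinGraph

open FinGraph in
/-- In a carrier graph of minimal length, an edge cannot be shortened by sliding its end points
along the other edges. -/
theorem IsMinimalLength.edgeLen_le_disp_slide (hf : IsMinimalLength f) {e₀ : X.E} {v w : X.V}
    {α : PClass (X.vertex v) (X.vertex (X.src e₀))} (hα : EdgeClass {e | e ≠ e₀} α)
    {β : PClass (X.vertex (X.tgt e₀)) (X.vertex w)} (hβ : EdgeClass {e | e ≠ e₀} β) :
    edgeLen f e₀ ≤ disp f ((α.trans cl(X.epath e₀)).trans β) := by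
  let Z := X.slide e₀ v w
  let ε : ∀ e ∈ {e | e ≠ e₀}, PClass (Z.vertex (X.src e)) (Z.vertex (X.tgt e)) :=
    fun e he => cl(Z.epath (some ⟨e, he⟩))
  obtain ⟨α', -, hα'⟩ := hα.transport (X := X) (X' := Z) (S' := Set.univ) (fun v => v) ε fun e he => .single trivial
  obtain ⟨β', -, hβ'⟩ := hβ.transport (X := X) (X' := Z) (S' := Set.univ) (fun v => v) ε fun e he => .single trivial
  choose hp hhp using fun e => (slideClass α' β' e).exists_rep
  -- The new edge stands for `α e₀ β`, and conversely `e₀` is sent to the new edge preceded by `α⁻¹`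
  -- and followed by `β⁻¹`. The maps `h` and `k` fix the vertices and the other edges, so they carry
  -- `α`, `β` and their copies to each other.
  let h : C(X.Space, Z.Space) := graphMap Z.vertex hp
  have hh : ∀ e, (cl(X.epath e) : PClass _ _).map h = slideClass α' β' e := hhp
  obtain ⟨kp, hkp⟩ := ((α.trans cl(X.epath e₀)).trans β).exists_rep
  let k : C(Z.Space, X.Space) := graphMap X.vertex fun o => match o with
    | none => kp
    | some e => X.epath e.1
  have hk0 : (cl(Z.epath none) : PClass _ _).map k = (α.trans cl(X.epath e₀)).trans β := hkp
  have hk1 : ∀ e, (cl(Z.epath (some e)) : PClass _ _).map k = cl(X.epath e.1) := fun e => rfl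
  obtain ⟨γ, hγ, hlen⟩ := exists_geodesic_rep (((α.trans cl(X.epath e₀)).trans β).map f)
  let g : C(Z.Space, M.Carrier) := graphMap (fun v => f (X.vertex v)) fun o => match o with
    | none => γ
    | some e => (X.epath e.1).map f.continuous
  have hg0 : (cl(Z.epath none) : PClass _ _).map g = ((α.trans cl(X.epath e₀)).trans β).map f := hγ
  have hg1 : ∀ e, (cl(Z.epath (some e)) : PClass _ _).map g =
    (cl(X.epath e.1) : PClass _ _).map f := fun e => rfl
  have hαk : α'.map k = α := ((hα' (.id _) k (fun _ => rfl) fun e he =>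
    (quotient_map_id _).trans (quotient_cast_self _).symm).trans
    (quotient_cast_self _)).symm.trans (quotient_map_id α)
  have hαh : α.map h = α' := ((hα' h (.id _) (fun _ => rfl) fun e he =>
    ((hh e).trans ((slideClass_of_ne _ _ he).trans (quotient_map_id _).symm)).trans
    (quotient_cast_self _).symm).trans (quotient_cast_self _)).trans (quotient_map_id α')
  have hαg : α'.map g = α.map f := ((hα' f g (fun _ => rfl) fun e he =>
    (quotient_cast_self (cl(X.epath e).map f)).symm).trans (quotient_cast_self _)).symm
  have hβk : β'.map k = β := ((hβ' (.id _) k (fun _ => rfl) fun e he =>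
    (quotient_map_id _).trans (quotient_cast_self _).symm).trans
    (quotient_cast_self _)).symm.trans (quotient_map_id β)
  have hβh : β.map h = β' := ((hβ' h (.id _) (fun _ => rfl) fun e he =>
    ((hh e).trans ((slideClass_of_ne _ _ he).trans (quotient_map_id _).symm)).trans
    (quotient_cast_self _).symm).trans (quotient_cast_self _)).trans (quotient_map_id β')
  have hβg : β'.map g = β.map f := ((hβ' f g (fun _ => rfl) fun e he =>
    (quotient_cast_self (cl(X.epath e).map f)).symm).trans (quotient_cast_self _)).symm
  have hequiv : CarrierEquiv f g := by
    refine carrierEquiv_of_maps h k ?_ ?_ ?_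
    · refine homotopic_of_edges (fun v => rfl) fun e => ?_
      refine Eq.trans ?_ ((quotient_map_id _).symm.trans (quotient_cast_self _).symm)
      refine (quotient_map_map h k _).symm.trans ((congrArg (·.map k) (hh e)).trans ?_)
      rcases eq_or_ne e e₀ with rfl | he
      · exact (congrArg (·.map k) (slideClass_self α' β')).trans (map_conj_eq hαk hβk hk0)
      · exact (congrArg (·.map k) (slideClass_of_ne α' β' he)).trans (hk1 ⟨e, he⟩)
    · refine homotopic_of_edges (fun v => rfl) fun o => ?_
      refine Eq.trans ?_ ((quotient_map_id _).symm.trans (quotient_cast_self _).symm)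
      refine (quotient_map_map k h _).symm.trans ?_
      rcases o with _ | e
      · exact (congrArg (·.map h) hk0).trans
          (map_conj_eq' hαh hβh ((hh e₀).trans (slideClass_self α' β')))
      · exact (hh e.1).trans (slideClass_of_ne α' β' e.2)
    · refine homotopic_of_edges (fun v => rfl) fun e => ?_
      refine Eq.trans ?_ (quotient_cast_self _).symm
      refine Eq.trans ?_ ((quotient_map_map h g _).symm.trans (congrArg (·.map g) (hh e))).symm
      rcases eq_or_ne e e₀ with rfl | he
      · refine ((congrArg (·.map g) (slideClass_self α' β')).trans
          (map_conj_eq hαg hβg (hg0.trans ?_))).symm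
        rw [map_quotient_trans, map_quotient_trans]
        rfl
      · exact ((congrArg (·.map g) (slideClass_of_ne α' β' he)).trans (hg1 ⟨e, he⟩)).symm
  have hle := hf.graphLength_le hequiv
  classical
  have e1 : graphLength f = edgeLength f e₀ + ∑ e : {e : X.E // e ≠ e₀}, edgeLength f e :=
    sum_option_ne _
  have e2 : graphLength g = edgeLength g none + ∑ e : {e : X.E // e ≠ e₀}, edgeLength f e := by
    unfold graphLength
    refine Eq.trans ?_ (Fintype.sum_option (α := {e : X.E // e ≠ e₀}) (edgeLength g))
    congr! with _ _ o o' ho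
    exact congrArg _ (eq_of_heq ho)
  -- The other edges have the same images under `f` and `g`; their total length is finite and
  -- cancels.
  have hfin : ∑ e : {e : X.E // e ≠ e₀}, edgeLength f e ≠ ⊤ :=
    ne_top_of_le_ne_top hf.graphLength_ne_top (e1 ▸ le_add_self)
  rw [e1, e2] at hle
  have h3 := (ENNReal.add_le_add_iff_right hfin).1 hle
  have h4 := h3.trans hlen
  rw [← hf.ofReal_edgeLen, ENNReal.ofReal_le_ofReal_iff (disp_nonneg _ _), disp_map] at h4
  exact h4

end Carrier

end

noncomputable section

/-! ### Subdivision of an edge -/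

section Carrier

variable {M : HypManifold} {X : FinGraph} {f : C(X.Space, M.Carrier)}

section PClass

variable {S T : Type} [TopologicalSpace S] [TopologicalSpace T] {a b c d : T} (k : C(T, S))
  (α : PClass a b) (β : PClass b c) (γ : PClass c d)

theorem map_trans_trans :
    ((α.trans β).trans γ).map k = ((α.map k).trans (β.map k)).trans (γ.map k) := by
  rw [map_quotient_trans, map_quotient_trans]

theorem map_trans_trans_trans_refl : (((α.trans β).trans γ).trans (.refl d)).map k =
    ((α.map k).trans (β.map k)).trans (γ.map k) := by
  rw [Path.Homotopic.Quotient.trans_refl, map_trans_trans]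

theorem map_refl_trans_trans_trans :
    (((Path.Homotopic.Quotient.refl a).trans α).trans (β.trans γ)).map k =
      ((α.map k).trans (β.map k)).trans (γ.map k) := by
  rw [Path.Homotopic.Quotient.refl_trans, ← Path.Homotopic.Quotient.trans_assoc, map_trans_trans]

end PClass

theorem disp_cast {T : Type} [TopologicalSpace T] {f : C(T, M.Carrier)} {x y x' y' : T}
    (hx : x' = x) (hy : y' = y) (δ : PClass x y) : disp f (δ.cast hx hy) = disp f δ := by
  subst hx hy
  rw [quotient_cast_self]

theorem disp_congr {T T' : Type} [TopologicalSpace T] [TopologicalSpace T'] {f : C(T, M.Carrier)}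
    {f' : C(T', M.Carrier)} {x y : T} {x' y' : T'} {δ : PClass x y} {δ' : PClass x' y'}
    (hx : f x = f' x') (hy : f y = f' y') (h : δ.map f = (δ'.map f').cast hx hy) :
    disp f δ = disp f' δ' := by
  have h1 := disp_map f (.id _) δ
  have h2 := disp_map f' (.id _) δ'
  change _ = disp f δ at h1
  change _ = disp f' δ' at h2
  rw [← h1, ← h2, h, disp_cast]

namespace FinGraph

/-- The graph obtained by subdividing the edge `e₀`. -/
def subdivide (X : FinGraph) (e₀ : X.E) : FinGraph where
  V := Option X.V
  E := Option (Option {e : X.E // e ≠ e₀})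
  fintypeE := by classical infer_instance
  src o := o.elim (some (X.src e₀)) fun o' => o'.elim none fun e => some (X.src e)
  tgt o := o.elim none fun o' => o'.elim (some (X.tgt e₀)) fun e => some (X.tgt e)

variable (e₀ : X.E)

/-- The first half of the subdivided edge. -/
def firstHalf : Path ((X.subdivide e₀).vertex (some (X.src e₀))) ((X.subdivide e₀).vertex none) :=
  (X.subdivide e₀).epath none

/-- The second half of the subdivided edge. -/
def secondHalf : Path ((X.subdivide e₀).vertex none) ((X.subdivide e₀).vertex (some (X.tgt e₀))) :=
  (X.subdivide e₀).epath (some none)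

theorem edgeClass_firstHalf {S : Set (X.subdivide e₀).E} (h : none ∈ S) :
    EdgeClass S (v := some (X.src e₀)) (w := none) cl(firstHalf e₀) := EdgeClass.single h

theorem edgeClass_secondHalf {S : Set (X.subdivide e₀).E} (h : some none ∈ S) :
    EdgeClass S (v := none) (w := some (X.tgt e₀)) cl(secondHalf e₀) := EdgeClass.single h

/-- An edge which is not subdivided. -/
def otherEdge (e : {e : X.E // e ≠ e₀}) : Path ((X.subdivide e₀).vertex (some (X.src e)))
    ((X.subdivide e₀).vertex (some (X.tgt e))) :=
  (X.subdivide e₀).epath (some (some e))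

open Classical in
/-- The path in the subdivided graph which corresponds to an edge. -/
def subdividePath (e : X.E) : Path ((X.subdivide e₀).vertex (some (X.src e)))
    ((X.subdivide e₀).vertex (some (X.tgt e))) :=
  if h : e = e₀ then by
    subst h
    exact (firstHalf e).trans (secondHalf e)
  else otherEdge e₀ ⟨e, h⟩

theorem subdividePath_self : subdividePath e₀ e₀ = (firstHalf e₀).trans (secondHalf e₀) :=
  dif_pos rfl

theorem subdividePath_of_ne {e : X.E} (h : e ≠ e₀) :
    subdividePath e₀ e = otherEdge e₀ ⟨e, h⟩ := dif_neg h

/-- The map on a subdivided graph, with prescribed point of subdivision. -/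
def subdivideMap {W : Type} [TopologicalSpace W] (φ : C(X.Space, W)) (t : I) :
    C((X.subdivide e₀).Space, W) :=
  graphMap (fun o => o.elim (φ (X.epath e₀ t)) fun v => φ (X.vertex v)) fun o => match o with
    | none => ((X.epath e₀).initial t).map φ.continuous
    | some none => ((X.epath e₀).final t).map φ.continuous
    | some (some e) => (X.epath e.1).map φ.continuous

variable {W : Type} [TopologicalSpace W] (φ : C(X.Space, W)) (t : I)

theorem subdividePath_map (e : X.E) : (cl(subdividePath e₀ e) : PClass _ _).map
    (subdivideMap e₀ φ t) = (cl(X.epath e) : PClass _ _).map φ := by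
  rcases eq_or_ne e e₀ with rfl | he
  · rw [subdividePath_self, Path.Homotopic.Quotient.mk_trans, map_quotient_trans]
    refine Eq.trans ?_ (congrArg (·.map φ) (cl_initial_trans_final (X.epath e) t))
    exact (map_quotient_trans φ cl((X.epath e).initial t) cl((X.epath e).final t)).symm
  · rw [subdividePath_of_ne _ he]
    rfl

end FinGraph

open FinGraph

theorem graphLength_subdivideMap (e₀ : X.E) (t : I) :
    graphLength (subdivideMap e₀ f t) = graphLength f := by
  classical
  have e1 : graphLength f = edgeLength f e₀ + ∑ e : {e : X.E // e ≠ e₀}, edgeLength f e :=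
    sum_option_ne _
  have e2 : graphLength (subdivideMap e₀ f t) = len f ((X.epath e₀).initial t) +
      (len f ((X.epath e₀).final t) + ∑ e : {e : X.E // e ≠ e₀}, edgeLength f e) := by
    unfold graphLength
    refine Eq.trans ?_ ((Fintype.sum_option (α := Option {e : X.E // e ≠ e₀})
      (edgeLength (subdivideMap e₀ f t))).trans
        (congrArg _ (Fintype.sum_option (α := {e : X.E // e ≠ e₀})
          fun o => edgeLength (subdivideMap e₀ f t) (some o))))
    congr! with _ _ o o' ho
    exact congrArg _ (eq_of_heq ho)
  rw [e1, e2, ← add_assoc, len_initial_add_len_final]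
  rfl

theorem carrierEquiv_subdivideMap (e₀ : X.E) (t : I) :
    CarrierEquiv f (subdivideMap e₀ f t) := by
  let h : C(X.Space, (X.subdivide e₀).Space) :=
    graphMap (fun v => (X.subdivide e₀).vertex (some v)) (subdividePath e₀)
  -- Subdividing the domain at the midpoint, whatever `t` is, makes `h ∘ k` the identity on the
  -- nose. The parameter `t` enters only through the map to `M`, and the class of the image of `e₀`
  -- does not depend on it.
  let k : C((X.subdivide e₀).Space, X.Space) := subdivideMap e₀ (.id _) unitHalf
  have hh : ∀ e, (cl(X.epath e) : PClass _ _).map h = cl(subdividePath e₀ e) := fun e => rfl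
  have hmid : ∀ s, h (X.epath e₀ s) = (firstHalf e₀).trans (secondHalf e₀) s := fun s =>
    congrArg (· s) (subdividePath_self e₀)
  have hk : ∀ o, h (k ((X.subdivide e₀).vertex o)) = (X.subdivide e₀).vertex o := by
    rintro (_ | v)
    · refine (hmid unitHalf).trans ?_
      have := initial_half_trans (firstHalf e₀) (secondHalf e₀) 1
      rw [Path.target, Path.target] at this
      exact this
    · rfl
  refine carrierEquiv_of_maps h k ?_ ?_ ?_
  · refine homotopic_of_edges (fun v => rfl) fun e => ?_
    refine Eq.trans ?_ (quotient_cast_self _).symm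
    refine (quotient_map_map h k _).symm.trans ((congrArg (·.map k) (hh e)).trans ?_)
    exact subdividePath_map e₀ (.id _) unitHalf e
  · have : h.comp k = .id _ := by
      refine map_ext hk fun o s => ?_
      change h (k ((X.subdivide e₀).epath o s)) = (X.subdivide e₀).epath o s
      rcases o with _ | _ | e
      · exact (hmid _).trans (initial_half_trans (firstHalf e₀) (secondHalf e₀) s)
      · exact (hmid _).trans (final_half_trans (firstHalf e₀) (secondHalf e₀) s)
      · exact congrArg (· s) (subdividePath_of_ne e₀ e.2)
    rw [this]
  · refine homotopic_of_edges (fun v => rfl) fun e => ?_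
    refine Eq.trans ?_ (quotient_cast_self _).symm
    refine Eq.trans ?_ ((quotient_map_map h _ _).symm.trans
      (congrArg (·.map (subdivideMap e₀ f t)) (hh e))).symm
    exact (subdividePath_map e₀ f t e).symm

theorem IsMinimalLength.subdivideMap (hf : IsMinimalLength f) (e₀ : X.E) (t : I) :
    IsMinimalLength (subdivideMap e₀ f t) :=
  hf.of_carrierEquiv (carrierEquiv_subdivideMap e₀ t) (graphLength_subdivideMap e₀ t).le

/-- Edge paths in a graph as edge paths in a subdivision. -/
theorem FinGraph.EdgeClass.subdivide {S : Set X.E} (e₀ : X.E) {v w : X.V}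
    {κ : PClass (X.vertex v) (X.vertex w)} (hκ : EdgeClass S κ) {S' : Set (X.subdivide e₀).E}
    (h0 : e₀ ∈ S → none ∈ S' ∧ some none ∈ S')
    (h1 : ∀ e (he : e ≠ e₀), e ∈ S → some (some ⟨e, he⟩) ∈ S') :
    ∃ κ' : PClass ((X.subdivide e₀).vertex (some v)) ((X.subdivide e₀).vertex (some w)),
      EdgeClass S' κ' ∧ ∀ {W : Type} [TopologicalSpace W] (φ : C(X.Space, W)) (t : I),
        κ'.map (FinGraph.subdivideMap e₀ φ t) = κ.map φ := by
  obtain ⟨κ', h, h'⟩ := hκ.transport (X := X) (X' := X.subdivide e₀) (S' := S') some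
    (fun e _ => cl(subdividePath e₀ e)) fun e he => by
      rcases eq_or_ne e e₀ with rfl | hne
      · rw [subdividePath_self, Path.Homotopic.Quotient.mk_trans]
        exact (EdgeClass.single (h0 he).1).trans (.single (h0 he).2)
      · rw [subdividePath_of_ne _ hne]
        exact .single (h1 e hne he)
  refine ⟨κ', h, fun φ t => ?_⟩
  exact ((h' φ (FinGraph.subdivideMap e₀ φ t) (fun _ => rfl) fun e he =>
    (subdividePath_map e₀ φ t e).symm.trans (quotient_cast_self _).symm).trans
      (quotient_cast_self _)).symm

/-- An edge cannot be shortened by sliding its initial point to a point of another edge. -/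
theorem IsMinimalLength.edgeLen_le_disp_src (hf : IsMinimalLength f) {e e' : X.E} (hne : e ≠ e')
    (t : I) {κ : PClass (X.vertex (X.src e')) (X.vertex (X.src e))}
    (hκ : EdgeClass {a | a ≠ e} κ) :
    edgeLen f e ≤ disp f ((Path.Homotopic.Quotient.trans
      (.symm cl((X.epath e').initial t)) κ).trans cl(X.epath e)) := by
  obtain ⟨κ', hκ', hmap⟩ := hκ.subdivide e' (S' := {a | a ≠ some (some ⟨e, hne⟩)})
    (fun _ => ⟨nofun, nofun⟩) fun a ha ha' h => ha' (congrArg Subtype.val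
      (Option.some_injective _ (Option.some_injective _ h)))
  refine ((hf.subdivideMap e' t).edgeLen_le_disp_slide (e₀ := some (some ⟨e, hne⟩))
    (v := none) (w := some (X.tgt e)) (α := Path.Homotopic.Quotient.trans
      (.symm cl(firstHalf e')) κ') ((edgeClass_firstHalf e' (S := {a | a ≠ some (some ⟨e, hne⟩)}) nofun).symm.trans hκ')
    (β := .refl _) (.refl _)).trans_eq ?_
  refine disp_congr rfl rfl (Eq.trans ?_ (quotient_cast_self _).symm)
  refine (map_trans_trans_trans_refl _ _ _ _).trans (Eq.trans ?_ (map_trans_trans f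
    (.symm cl((X.epath e').initial t)) κ cl(X.epath e)).symm)
  refine congrArg₂ _ (congrArg₂ _ ?_ (hmap f t)) rfl
  exact (map_quotient_symm _ _).trans (map_quotient_symm f cl((X.epath e').initial t)).symm

/-- An edge cannot be shortened by sliding its terminal point to a point of another edge. -/
theorem IsMinimalLength.edgeLen_le_disp_tgt (hf : IsMinimalLength f) {e e' : X.E} (hne : e ≠ e')
    (t : I) {κ : PClass (X.vertex (X.tgt e)) (X.vertex (X.src e'))}
    (hκ : EdgeClass {a | a ≠ e} κ) :
    edgeLen f e ≤ disp f ((Path.Homotopic.Quotient.trans cl(X.epath e) κ).trans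
      cl((X.epath e').initial t)) := by
  obtain ⟨κ', hκ', hmap⟩ := hκ.subdivide e' (S' := {a | a ≠ some (some ⟨e, hne⟩)})
    (fun _ => ⟨nofun, nofun⟩) fun a ha ha' h => ha' (congrArg Subtype.val
      (Option.some_injective _ (Option.some_injective _ h)))
  refine ((hf.subdivideMap e' t).edgeLen_le_disp_slide (e₀ := some (some ⟨e, hne⟩))
    (v := some (X.src e)) (w := none) (β := Path.Homotopic.Quotient.trans κ'
      cl(firstHalf e')) (.refl _) (hκ'.trans (edgeClass_firstHalf e' nofun))
    (α := .refl _)).trans_eq ?_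
  refine disp_congr rfl rfl (Eq.trans ?_ (quotient_cast_self _).symm)
  refine (map_refl_trans_trans_trans _ _ _ _).trans (Eq.trans ?_ (map_trans_trans f
    cl(X.epath e) κ cl((X.epath e').initial t)).symm)
  exact congrArg₂ _ (congrArg₂ _ rfl (hmap f t)) rfl

/-- An initial segment of an edge cannot be shortened by sliding its initial point along the
remaining part of the edge. -/
theorem IsMinimalLength.len_initial_le_disp (hf : IsMinimalLength f) (e : X.E) (t : I)
    {κ : PClass (X.vertex (X.tgt e)) (X.vertex (X.src e))} (hκ : EdgeClass {a | a ≠ e} κ) :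
    (len f ((X.epath e).initial t)).toReal ≤ disp f ((Path.Homotopic.Quotient.trans
      cl((X.epath e).final t) κ).trans cl((X.epath e).initial t)) := by
  -- After subdividing `e`, its second half is a separate edge, along which the first half may
  -- slide.
  obtain ⟨κ', hκ', hmap⟩ := hκ.subdivide e (S' := {a | a ≠ none})
    (fun h => (h rfl).elim) fun a ha ha' => nofun
  refine ((hf.subdivideMap e t).edgeLen_le_disp_slide (e₀ := none)
    (v := none) (w := none) (α := Path.Homotopic.Quotient.trans
      cl(secondHalf e) κ') ((edgeClass_secondHalf e (S := {a | a ≠ none}) nofun).trans hκ')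
    (β := .refl _) (.refl _)).trans_eq ?_
  refine disp_congr rfl rfl (Eq.trans ?_ (quotient_cast_self _).symm)
  refine (map_trans_trans_trans_refl _ _ _ _).trans (Eq.trans ?_ (map_trans_trans f
    cl((X.epath e).final t) κ cl((X.epath e).initial t)).symm)
  exact congrArg₂ _ (congrArg₂ _ rfl (hmap f t)) rfl

end Carrier

end

noncomputable section

/-! ### Long edges of a carrier graph of minimal length -/

theorem symm_initial_symm {T : Type*} [TopologicalSpace T] {x y : T} (γ : Path x y) (t : I) :
    (γ.symm.initial t).symm = γ.final (unitInterval.symm t) := by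
  refine Path.ext (funext fun s => ?_)
  change γ (unitInterval.symm (Set.Icc.convexComb 0 t (unitInterval.symm s))) =
    γ (Set.Icc.convexComb (unitInterval.symm t) 1 s)
  congr 1
  ext
  change 1 - ((1 - (1 - s : ℝ)) * 0 + (1 - s) * t) = (1 - s) * (1 - t) + s * 1
  ring

theorem quotient_mk_trans_symm_mk {T : Type*} [TopologicalSpace T] {x y z : T} {α : Path x y}
    {α' : Path z y} {α'' : Path y z} (h : α'.symm = α'') :
    (cl(α) : PClass _ _).trans (.symm cl(α')) = Path.Homotopic.Quotient.trans cl(α) cl(α'') := by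
  rw [← Path.Homotopic.Quotient.mk_symm, h]

theorem cl_initial_trans_symm_initial_symm {T : Type*} [TopologicalSpace T] {x y : T}
    (γ : Path x y) (t : I) :
    (cl(γ.initial (unitInterval.symm t)) : PClass _ _).trans (.symm cl(γ.symm.initial t)) =
      cl(γ) :=
  (quotient_mk_trans_symm_mk (α := γ.initial (unitInterval.symm t)) (α' := γ.symm.initial t)
    (symm_initial_symm γ t)).trans (cl_initial_trans_final γ _)

section Groupoid

variable {T : Type} [TopologicalSpace T] {x y z w : T}

theorem quotient_symm_trans_trans_cancel (ι : PClass x y) (η : PClass y z) (ε : PClass z w) :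
    (ι.symm.trans (ι.trans η)).trans ε = η.trans ε := by
  rw [quotient_symm_trans_cancel]

end Groupoid

section Carrier

variable {M : HypManifold} {X : FinGraph} {f : C(X.Space, M.Carrier)}

namespace FinGraph

/-- The initial vertex of an oriented edge. -/
def osrc (X : FinGraph) : X.E × Bool → X.V
  | (e, true) => X.src e
  | (e, false) => X.tgt e

/-- The terminal vertex of an oriented edge. -/
def otgt (X : FinGraph) : X.E × Bool → X.V
  | (e, true) => X.tgt e
  | (e, false) => X.src e

/-- An oriented edge as a path. -/
def opath (X : FinGraph) : ∀ o : X.E × Bool, Path (X.vertex (X.osrc o)) (X.vertex (X.otgt o))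
  | (e, true) => X.epath e
  | (e, false) => (X.epath e).symm

/-- The class of a path from an arbitrary point to a vertex is represented by part of an edge,
followed by an edge path, with edges in `S`. -/
def Avoids (S : Set X.E) {x : X.Space} {v : X.V} (η : PClass x (X.vertex v)) : Prop :=
  (∃ w, ∃ h : X.vertex w = x, EdgeClass S (η.cast h rfl)) ∨
    ∃ e ∈ S, ∃ t, ∃ h : X.epath e t = x,
      EdgeClass S ((cl((X.epath e).initial t) : PClass _ _).trans (η.cast h rfl))

theorem avoids_of_oriented {S : Set X.E} {o : X.E × Bool} (ho : o.1 ∈ S) (t : I) {v : X.V}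
    {κ : PClass (X.vertex (X.osrc o)) (X.vertex v)} (hκ : EdgeClass S κ) :
    Avoids S (Path.Homotopic.Quotient.trans (.symm cl((X.opath o).initial t)) κ) := by
  obtain ⟨e, _ | _⟩ := o
  · refine .inr ⟨e, ho, unitInterval.symm t, rfl, ?_⟩
    refine Eq.subst (motive := EdgeClass S) ?_ ((EdgeClass.single ho).trans hκ)
    refine Eq.trans ?_ (congrArg (Path.Homotopic.Quotient.trans
      cl((X.epath e).initial (unitInterval.symm t))) (quotient_cast_self
        (Path.Homotopic.Quotient.trans (.symm cl((X.epath e).symm.initial t)) κ))).symm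
    refine Eq.trans ?_ (Path.Homotopic.Quotient.trans_assoc _ _ _)
    exact congrArg (·.trans κ) (cl_initial_trans_symm_initial_symm (X.epath e) t).symm
  · refine .inr ⟨e, ho, t, rfl, ?_⟩
    refine Eq.subst (motive := EdgeClass S) ?_ hκ
    refine Eq.trans ?_ (congrArg (Path.Homotopic.Quotient.trans
      cl((X.epath e).initial t)) (quotient_cast_self
        (Path.Homotopic.Quotient.trans (.symm cl((X.epath e).initial t)) κ))).symm
    exact (quotient_trans_symm_cancel cl((X.epath e).initial t) κ).symm

end FinGraph

open FinGraph

section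

variable {T : Type} [TopologicalSpace T] {f : C(T, M.Carrier)} {x y z w : T}

theorem disp_refl_trans_trans_symm (ε : PClass x y) (η : PClass z y) :
    disp f (((Path.Homotopic.Quotient.refl x).trans ε).trans η.symm) =
      disp f (η.trans ε.symm) := by
  rw [Path.Homotopic.Quotient.refl_trans, ← disp_symm, quotient_symm_trans, quotient_symm_symm]

theorem disp_trans_symm_trans (ε : PClass x y) (ι : PClass w z) (η : PClass z y) :
    disp f ((ε.trans (ι.trans η).symm).trans ι) = disp f (η.trans ε.symm) := by
  rw [← disp_symm]
  simp only [quotient_symm_trans, quotient_symm_symm,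
    ← Path.Homotopic.Quotient.trans_assoc]
  rw [Path.Homotopic.Quotient.symm_trans, Path.Homotopic.Quotient.refl_trans]

theorem disp_symm_trans_symm (ε : PClass x y) (η : PClass y z) :
    disp f (η.symm.trans ε.symm) = disp f (ε.trans η) := by
  rw [← disp_symm, quotient_symm_trans, quotient_symm_symm, quotient_symm_symm]

theorem disp_symm_trans (ε : PClass y x) (η : PClass y z) :
    disp f (η.symm.trans ε) = disp f (ε.symm.trans η) := by
  rw [← disp_symm, quotient_symm_trans, quotient_symm_symm]

end

/-- An oriented edge cannot be shortened by sliding its initial point. -/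
theorem IsMinimalLength.edgeLen_le_disp (hf : IsMinimalLength f) (o : X.E × Bool) {x : X.Space}
    {η : PClass x (X.vertex (X.osrc o))} (hη : Avoids {a | a ≠ o.1} η) :
    edgeLen f o.1 ≤ disp f (η.trans cl(X.opath o)) := by
  obtain ⟨e, _ | _⟩ := o <;> obtain ⟨w, rfl, h⟩ | ⟨e', he', t, rfl, h⟩ := hη
  · rw [quotient_cast_self] at h
    refine (hf.edgeLen_le_disp_slide (.refl _) h.symm).trans_eq ?_
    exact disp_refl_trans_trans_symm cl(X.epath e) η
  · have h' := Eq.subst (motive := EdgeClass _)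
      (congrArg (Path.Homotopic.Quotient.trans _) (quotient_cast_self η)) h
    refine (hf.edgeLen_le_disp_tgt (Ne.symm he') t h'.symm).trans_eq ?_
    exact disp_trans_symm_trans cl(X.epath e) _ η
  · rw [quotient_cast_self] at h
    have := hf.edgeLen_le_disp_slide h (.refl _)
    rwa [Path.Homotopic.Quotient.trans_refl] at this
  · have h' := Eq.subst (motive := EdgeClass _)
      (congrArg (Path.Homotopic.Quotient.trans _) (quotient_cast_self η)) h
    refine (hf.edgeLen_le_disp_src (Ne.symm he') t h').trans_eq ?_
    exact congrArg (disp f) (quotient_symm_trans_trans_cancel _ η cl(X.epath e))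

/-- The oriented edge version of `edgeLen_le_disp` for terminal points. -/
theorem IsMinimalLength.edgeLen_le_disp_trans (hf : IsMinimalLength f) (o : X.E × Bool)
    {x : X.Space} {η : PClass (X.vertex (X.otgt o)) x} (hη : Avoids {a | a ≠ o.1} η.symm) :
    edgeLen f o.1 ≤ disp f (Path.Homotopic.Quotient.trans cl(X.opath o) η) := by
  obtain ⟨e, _ | _⟩ := o
  · exact (hf.edgeLen_le_disp (e, true) hη).trans_eq (disp_symm_trans cl(X.epath e) η)
  · exact (hf.edgeLen_le_disp (e, false) hη).trans_eq (disp_symm_trans_symm cl(X.epath e) η)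

theorem len_opath (o : X.E × Bool) : len f (X.opath o) = edgeLength f o.1 := by
  obtain ⟨e, _ | _⟩ := o
  · exact len_symm f (X.epath e)
  · rfl

/-- The trivial slide shows that an edge of a minimal graph is no longer than its displacement, so
its lift is a geodesic. -/
theorem IsMinimalLength.disp_opath (hf : IsMinimalLength f) (o : X.E × Bool) :
    disp f (cl(X.opath o) : PClass _ _) = edgeLen f o.1 := by
  refine le_antisymm ?_ ?_
  · have := disp_le_len f (X.opath o)
    rwa [len_opath, ← hf.ofReal_edgeLen, ENNReal.ofReal_le_ofReal_iff (edgeLen_nonneg _)] at this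
  · have := hf.edgeLen_le_disp o (η := .refl _) (.inl ⟨_, rfl, by
      rw [quotient_cast_self]; exact .refl _⟩)
    rwa [Path.Homotopic.Quotient.refl_trans] at this

section Geodesic

variable {T : Type} [TopologicalSpace T] {f : C(T, M.Carrier)} {x y : T}

/-- Displacements are at most lengths; lengths add exactly and displacements subadditively, so
equality for the whole forces equality for both pieces. -/
theorem len_split {γ : Path x y} (h : len f γ = ENNReal.ofReal (disp f cl(γ))) (t : I) :
    disp f cl(γ.initial t) + disp f cl(γ.final t) = disp f cl(γ) ∧
    len f (γ.initial t) = ENNReal.ofReal (disp f cl(γ.initial t)) ∧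
    len f (γ.final t) = ENNReal.ofReal (disp f cl(γ.final t)) := by
  have h1 := disp_le_len f (γ.initial t)
  have h2 := disp_le_len f (γ.final t)
  have h3 := disp_trans_le f cl(γ.initial t) cl(γ.final t)
  rw [cl_initial_trans_final] at h3
  have h4 := len_initial_add_len_final f γ t
  rw [h] at h4
  have n1 : len f (γ.initial t) ≠ ⊤ := ne_top_of_le_ne_top (by rw [h4]; exact ENNReal.ofReal_ne_top)
    le_self_add
  have n2 : len f (γ.final t) ≠ ⊤ := ne_top_of_le_ne_top (by rw [h4]; exact ENNReal.ofReal_ne_top)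
    le_add_self
  have e1 := ENNReal.ofReal_toReal n1
  have e2 := ENNReal.ofReal_toReal n2
  have d1 := disp_nonneg f cl(γ.initial t)
  have d2 := disp_nonneg f cl(γ.final t)
  rw [← e1] at h1
  rw [← e2] at h2
  rw [← e1, ← e2, ← ENNReal.ofReal_add ENNReal.toReal_nonneg ENNReal.toReal_nonneg,
    ENNReal.ofReal_eq_ofReal_iff (add_nonneg ENNReal.toReal_nonneg ENNReal.toReal_nonneg)
      (disp_nonneg f _)] at h4
  rw [ENNReal.ofReal_le_ofReal_iff ENNReal.toReal_nonneg] at h1 h2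
  refine ⟨by linarith, ?_, ?_⟩
  · rw [← e1]; congr 1; linarith
  · rw [← e2]; congr 1; linarith

/-- A shortest path has points at every distance from its initial point. -/
theorem exists_split {γ : Path x y} (h : len f γ = ENNReal.ofReal (disp f cl(γ))) {D : ℝ}
    (h0 : 0 ≤ D) (hD : D ≤ disp f cl(γ)) :
    ∃ t, disp f cl(γ.initial t) = D ∧ disp f cl(γ.final t) = disp f cl(γ) - D := by
  obtain ⟨p⟩ := nonempty_fiber f x
  obtain ⟨b, hb0, hb⟩ := exists_lift f γ p
  have key : ∀ t, disp f cl(γ.initial t) = dist p.1 (b t) := fun t => by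
    rw [disp_eq f _ p, dev_initial hb0 hb]
  have hc : Continuous fun t : I => dist p.1 (b t) := by fun_prop
  have h1 : dist p.1 (b 1) = disp f cl(γ) := by rw [disp_eq f _ p, dev_mk_eq hb0 hb]
  obtain ⟨t, ht⟩ := mem_range_of_exists_le_of_exists_ge hc (c := D) ⟨0, by simpa [hb0] using h0⟩
    ⟨1, by rw [h1]; exact hD⟩
  refine ⟨t, (key t).trans ht, ?_⟩
  rw [← (len_split h t).1, key t]
  linarith [ht]

end Geodesic

end Carrier

end

noncomputable section

/-! ### Edges at a quasi-convex subgraph -/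

section Efficient

variable {M : HypManifold} {S T : Type} [TopologicalSpace S] [TopologicalSpace T]
  {f : C(T, M.Carrier)}

/-- A representative within `1` of the infimum works: otherwise one of its initial pieces could be
replaced by a path shorter by more than `1`. -/
theorem exists_rep_initial_le {a b : S} {h : C(S, M.Carrier)} (β : PClass a b)
    (hβ : classLen h β ≠ ⊤) :
    ∃ γ : Path a b, cl(γ) = β ∧ ∀ t, len h (γ.initial t) ≤ classLen h cl(γ.initial t) + 1 := by
  obtain ⟨γ, hγ, hlen⟩ : ∃ γ : Path a b, cl(γ) = β ∧ len h γ < classLen h β + 1 := by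
    have := ENNReal.lt_add_right hβ one_ne_zero
    conv_lhs at this => unfold classLen
    simpa only [iInf_lt_iff, exists_prop] using this
  refine ⟨γ, hγ, fun t => ?_⟩
  have h1 := len_initial_add_len_final h γ t
  have h2 := classLen_trans_le h cl(γ.initial t) cl(γ.final t)
  rw [cl_initial_trans_final, hγ] at h2
  have hfin : len h (γ.final t) ≠ ⊤ := by
    refine ne_top_of_le_ne_top (ENNReal.add_ne_top.2 ⟨hβ, ENNReal.one_ne_top⟩) ?_
    exact (le_add_self.trans h1.le).trans hlen.le
  refine (ENNReal.add_le_add_iff_right hfin).1 ?_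
  calc _ = len h γ := h1
    _ ≤ classLen h β + 1 := hlen.le
    _ ≤ classLen h cl(γ.initial t) + len h (γ.final t) + 1 := by
      gcongr
      exact h2.trans (by gcongr; exact classLen_mk_le h _)
    _ = _ := by ring

theorem len_initial_eq_eVariationOn {h : C(S, M.Carrier)} {a b : S} {γ : Path a b}
    {c : C(I, HypSpace)} (hc : ∀ t, M.proj (c t) = h (γ t)) (t : I) :
    len h (γ.initial t) = eVariationOn c (Set.Iic t) := by
  rw [len_eq (b := c.comp ⟨Set.Icc.convexComb 0 t, by fun_prop⟩) fun _ => hc _,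
    ← Path.range_convexComb_zero t, ← Set.image_univ,
    ← eVariationOn.comp_eq_of_monotoneOn c _ ((Path.monotone_convexComb t.2.1).monotoneOn _)]
  rfl

theorem exists_fine_subdivision (c : C(I, HypSpace)) :
    ∃ (N : ℕ) (u : ℕ → I), Monotone u ∧ u 0 = 0 ∧ u N = 1 ∧
      ∀ i, dist (c (u i)) (c (u (i + 1))) ≤ 1 := by
  obtain ⟨δ, hδ, h⟩ := Metric.uniformContinuous_iff.1
    (CompactSpace.uniformContinuous_of_continuous c.continuous) 1 one_pos
  obtain ⟨N, hN⟩ := exists_nat_one_div_lt hδ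
  have hN0 : (0 : ℝ) < N + 1 := by positivity
  refine ⟨N + 1, fun i => Set.projIcc 0 1 zero_le_one (i / (N + 1)), fun i j hij => ?_, ?_, ?_,
    fun i => (h ?_).le⟩
  · exact Set.monotone_projIcc _ (by gcongr)
  · simp
  · push_cast; rw [div_self hN0.ne']; simp
  · refine lt_of_le_of_lt ?_ hN
    have := (LipschitzWith.projIcc (zero_le_one (α := ℝ))).dist_le_mul
      ((i : ℝ) / (N + 1)) ((i + 1 : ℕ) / (N + 1))
    refine this.trans_eq ?_
    rw [Real.dist_eq]; push_cast
    rw [← sub_div, abs_div, abs_of_pos hN0]; simp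

/-- If all points of a quasi-convex piece are at least as far from the initial point of `o` as
its terminal point, then `o` is approximately efficient with respect to the piece. -/
theorem exists_efficient_const (A : ℝ) (hA : 0 < A) :
    ∃ C : ℝ, 0 ≤ C ∧ ∀ (M : HypManifold) (S T : Type) [TopologicalSpace S] [TopologicalSpace T]
      (f : C(T, M.Carrier)) (ι : C(S, T)) (a b : S) (β : PClass a b),
      (∀ (z : S) (η : PClass a z),
        classLen (f.comp ι) η ≤ ENNReal.ofReal (A * disp (f.comp ι) η + A ^ 2)) →
      ∀ (x : T) (o : PClass x (ι a)),
      (∀ (z : S) (η : PClass a z), disp f o ≤ disp f (o.trans (η.map ι))) →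
      disp f o + disp f (β.map ι) ≤ disp f (o.trans (β.map ι)) + C := by
  -- The summand `1` is the excess length of the chosen representative of `β`.
  obtain ⟨C, hC, H⟩ := HypSpace.exists_dist_ge_of_quasigeodesic A (A ^ 2 + 1) hA (by positivity)
  refine ⟨C, hC, fun M S T _ _ f ι a b β hq x o ho => ?_⟩
  obtain ⟨γ, hγ, hlen⟩ := exists_rep_initial_le β (ne_top_of_le_ne_top ENNReal.ofReal_ne_top (hq b β))
  obtain ⟨p⟩ := nonempty_fiber f x
  let q : M.proj ⁻¹' {(f.comp ι) a} := dev f o p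
  obtain ⟨c, hc0, hc⟩ := exists_lift (f.comp ι) γ q
  obtain ⟨N, u, hu, hu0, huN, hc1⟩ := exists_fine_subdivision c
  have hdisp : ∀ t, disp (f.comp ι) cl(γ.initial t) = dist (c 0) (c t) := fun t => by
    rw [disp_eq _ _ q, dev_initial hc0 hc, hc0]
  have hq0 : disp f o = dist (c 0) p.1 := by rw [disp_eq f o p, dist_comm, hc0]
  have hdev : ∀ t, disp f (o.trans ((cl(γ.initial t) : PClass a (γ t)).map ι)) = dist (c t) p.1 := fun t => by
    rw [disp_eq f _ p, dev_trans, dist_comm]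
    congr 1
    exact dev_initial hc0 hc t
  have hlast : disp f (o.trans (β.map ι)) = dist (c 1) p.1 := by
    rw [disp_eq f _ p, dev_trans, dist_comm]
    subst hγ
    congr 1
    exact dev_mk_eq (f := f.comp ι) hc0 hc
  have hβ : disp f (β.map ι) = dist (c 0) (c 1) := by
    subst hγ
    rw [disp_map, disp_eq _ _ q, dev_mk_eq hc0 hc, hc0]
  -- The centre `m` is the lift of the far end of `o`, and the points run along the lift of `β`,
  -- starting where `o` ends.
  have := H p.1 (fun i => c (u i)) N (fun i _ => hc1 i) (fun i hi => ?_) (fun i hi => ?_)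
  · simp only [hu0, huN] at this
    rw [hq0, hβ, hlast]; exact this
  · rw [hu0, ← hdisp]
    have h1 : ENNReal.ofReal (∑ j ∈ Finset.range i, dist (c (u j)) (c (u (j + 1)))) ≤
        len (f.comp ι) (γ.initial (u i)) := by
      rw [ENNReal.ofReal_sum_of_nonneg fun _ _ => dist_nonneg, len_initial_eq_eVariationOn hc]
      simp_rw [← edist_dist]
      simp_rw [edist_comm (c (u _)) (c (u (_ + 1)))]
      exact eVariationOn.sum_le_of_monotoneOn_Iic (hu.monotoneOn _) fun j hj => hu hj
    have h2 := (h1.trans (hlen _)).trans (add_le_add_left (hq _ _) 1)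
    have h0 := disp_nonneg (f.comp ι) cl(γ.initial (u i))
    rw [← ENNReal.ofReal_one, ← ENNReal.ofReal_add (by positivity) zero_le_one,
      ENNReal.ofReal_le_ofReal_iff (by positivity)] at h2
    linarith
  · have := ho _ cl(γ.initial (u i))
    rw [hq0, hdev] at this
    simpa [hu0] using this

/-- Two edges which are approximately efficient with respect to the piece between them, and diverge
from each other if the piece is short, form an approximately efficient path. -/
theorem disp_add_disp_add_disp_le {C D : ℝ} {x u y y' u' x' : T} {a₁ : PClass x u}
    {d₁ : PClass u y} {β : PClass y y'} {d₂ : PClass y' u'} {a₂ : PClass u' x'}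
    (h1 : disp f (a₁.trans d₁) + disp f β ≤ disp f ((a₁.trans d₁).trans β) + C)
    (h2 : disp f (d₂.trans a₂) + disp f β ≤ disp f (β.trans (d₂.trans a₂)) + C)
    (hd₁ : disp f d₁ = D) (ha₁ : disp f a₁ = disp f (a₁.trans d₁) - D)
    (hd₂ : disp f d₂ = D) (ha₂ : disp f a₂ = disp f (d₂.trans a₂) - D)
    (hclose : disp f β ≤ C + 4 → C + 20 < disp f ((d₁.trans β).trans d₂)) :
    disp f (a₁.trans d₁) + disp f β + disp f (d₂.trans a₂) ≤
      disp f (((a₁.trans d₁).trans β).trans (d₂.trans a₂)) + max (2 * C + 8) (2 * D) := by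
  obtain ⟨p⟩ := nonempty_fiber f x
  have e1 := disp_eq f (a₁.trans d₁) p
  have e2 := disp_eq f β (dev f (a₁.trans d₁) p)
  have e3 := disp_eq f (d₂.trans a₂) (dev f ((a₁.trans d₁).trans β) p)
  have e4 := disp_eq f (((a₁.trans d₁).trans β).trans (d₂.trans a₂)) p
  have e5 := disp_eq f ((a₁.trans d₁).trans β) p
  have e6 := disp_eq f (β.trans (d₂.trans a₂)) (dev f (a₁.trans d₁) p)
  have e7 := disp_eq f d₁ (dev f a₁ p)
  have e8 := disp_eq f a₁ p
  have e9 := disp_eq f d₂ (dev f ((a₁.trans d₁).trans β) p)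
  have e10 := disp_eq f a₂ (dev f (((a₁.trans d₁).trans β).trans d₂) p)
  have e11 := disp_eq f ((d₁.trans β).trans d₂) (dev f a₁ p)
  simp only [dev_trans] at e1 e2 e3 e4 e5 e6 e7 e8 e9 e10 e11
  rw [e1, e2, e3, e4]
  rw [e1, e2, e5] at h1
  rw [e3, e2, e6] at h2
  rw [e7] at hd₁
  rw [e8, e1] at ha₁
  rw [e9] at hd₂
  rw [e10, e3] at ha₂
  rw [e2, e11] at hclose
  refine HypSpace.dist_ge_of_locally_efficient h1 ?_ ?_ ?_ hd₂ ha₂ hclose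
  · rw [dist_comm, dist_comm _ (dev f d₁ (dev f a₁ p)).1, dist_comm _ (dev f d₁ (dev f a₁ p)).1]
    exact h2
  · rw [dist_comm]; exact hd₁
  · rw [dist_comm]; exact ha₁

end Efficient

end

noncomputable section

/-! ### Pairs of edges at a quasi-convex subgraph -/

namespace FinGraph

variable {X : FinGraph}

/-- The inclusion of a subgraph. -/
def Sub.incl (Y : X.Sub) : C(Y.carrier, X.Space) := ⟨Subtype.val, continuous_subtype_val⟩

theorem Sub.mem_edges {Y : X.Sub} {e : X.E} {t : I} (h0 : t ≠ 0) (h1 : t ≠ 1)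
    (h : X.edge e t ∈ Y.carrier) : e ∈ Y.edges := by
  rcases h with ⟨v, -, hv⟩ | h
  · rcases edge_eq_vertex hv.symm with ⟨h, -⟩ | ⟨h, -⟩
    exacts [(h0 h).elim, (h1 h).elim]
  · obtain ⟨e', he', t', ht'⟩ := Set.mem_iUnion₂.1 h
    exact (edge_eq_edge h0 h1 ht').1 ▸ he'

theorem Sub.edgeClass_of_mem {Y : X.Sub} {v w : X.V} (γ : Path (X.vertex v) (X.vertex w))
    (h : ∀ t, γ t ∈ Y.carrier) : EdgeClass Y.edges (cl(γ) : PClass _ _) :=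
  FinGraph.edgeClass_of_mem γ fun t _ _ h0 h1 e => Sub.mem_edges h0 h1 (e ▸ h t)

theorem Sub.edges_subset_ne {Y : X.Sub} {e : X.E} (he : e ∉ Y.edges) :
    Y.edges ⊆ {a | a ≠ e} := fun a ha (h : a = e) => he (h ▸ ha)

theorem Sub.edgeClass_map {Y : X.Sub} {v w : X.V} {hv : X.vertex v ∈ Y.carrier}
    {hw : X.vertex w ∈ Y.carrier} (η : PClass (⟨_, hv⟩ : Y.carrier) ⟨_, hw⟩) :
    EdgeClass Y.edges (v := v) (w := w) (η.map Y.incl) := by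
  obtain ⟨γ, rfl⟩ := η.exists_rep
  exact Sub.edgeClass_of_mem (γ.map Y.incl.continuous) fun t => (γ t).2

theorem Avoids.mono {S S' : Set X.E} (h : S ⊆ S') {x : X.Space} {v : X.V}
    {η : PClass x (X.vertex v)} (hη : Avoids S η) : Avoids S' η := by
  obtain ⟨w, e, hη⟩ | ⟨e, he, t, e', hη⟩ := hη
  exacts [.inl ⟨w, e, hη.mono h⟩, .inr ⟨e, h he, t, e', hη.mono h⟩]

theorem Sub.avoids_map {Y : X.Sub} {v : X.V} {hv : X.vertex v ∈ Y.carrier} {z : Y.carrier}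
    (η : PClass z (⟨_, hv⟩ : Y.carrier)) : Avoids Y.edges (v := v) (η.map Y.incl) := by
  obtain ⟨γ, rfl⟩ := η.exists_rep
  obtain ⟨z, ⟨w, hw, rfl⟩ | hz⟩ := z
  · refine .inl ⟨w, rfl, ?_⟩
    exact Sub.edgeClass_of_mem ((γ.map Y.incl.continuous).cast rfl rfl) fun t => (γ t).2
  · obtain ⟨e, he, t, rfl⟩ := Set.mem_iUnion₂.1 hz
    refine .inr ⟨e, he, t, rfl, ?_⟩
    have hm : ∀ s, X.edge e s ∈ Y.carrier := fun s =>
      .inr (Set.mem_iUnion₂.2 ⟨e, he, s, rfl⟩)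
    let γ' : Path (X.epath e t) (X.vertex v) := γ.map Y.incl.continuous
    have := Sub.edgeClass_of_mem (Y := Y) (((X.epath e).initial t).trans γ') fun s => by
      rw [Path.trans_apply]
      split_ifs
      exacts [hm _, (γ _).2]
    exact this

theorem edgeClass_opath (o : X.E × Bool) {S : Set X.E} (ho : o.1 ∈ S) :
    EdgeClass S (cl(X.opath o) : PClass _ _) := by
  obtain ⟨e, _ | _⟩ := o
  exacts [.single_symm ho, .single ho]

theorem avoids_of_final {S : Set X.E} {o : X.E × Bool} (ho : o.1 ∈ S) (t : I) {v : X.V}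
    {κ : PClass (X.vertex (X.otgt o)) (X.vertex v)} (hκ : EdgeClass S κ) :
    Avoids S (Path.Homotopic.Quotient.trans cl((X.opath o).final t) κ) := by
  refine Eq.subst (motive := Avoids S) ?_
    (avoids_of_oriented ho t ((edgeClass_opath o ho).trans hκ))
  rw [← cl_initial_trans_final (X.opath o) t, Path.Homotopic.Quotient.trans_assoc,
    quotient_symm_trans_cancel]

end FinGraph

open FinGraph

variable {M : HypManifold} {X : FinGraph} {f : C(X.Space, M.Carrier)}

theorem IsMinimalLength.len_opath (hf : IsMinimalLength f) (o : X.E × Bool) :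
    len f (X.opath o) = ENNReal.ofReal (disp f cl(X.opath o)) := by
  rw [_root_.len_opath, hf.disp_opath, hf.ofReal_edgeLen]

section

variable {C D : ℝ}

/-- Let `d₁` and `d₂` be the parts of length `D` next to the block. If the block is short and their
far ends were within `C + 20 < D`, sliding the start of `o₂` back to the far end of `d₁` would
replace `d₂` by something shorter. -/
theorem IsMinimalLength.disp_ge_of_ne (hf : IsMinimalLength f) (hC : C + 20 < D)
    {o₁ o₂ : X.E × Bool} (hne : o₁.1 ≠ o₂.1)
    {β : PClass (X.vertex (X.otgt o₁)) (X.vertex (X.osrc o₂))} (hβ : EdgeClass {a | a ≠ o₂.1} β)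
    (hD0 : 0 ≤ D) (hD₁ : D ≤ edgeLen f o₁.1) (hD₂ : D ≤ edgeLen f o₂.1)
    (h1 : edgeLen f o₁.1 + disp f β ≤ disp f (Path.Homotopic.Quotient.trans cl(X.opath o₁) β) + C)
    (h2 : edgeLen f o₂.1 + disp f β ≤ disp f (β.trans cl(X.opath o₂)) + C) :
    edgeLen f o₁.1 + disp f β + edgeLen f o₂.1 ≤
      disp f ((Path.Homotopic.Quotient.trans cl(X.opath o₁) β).trans cl(X.opath o₂)) +
        max (2 * C + 8) (2 * D) := by
  rw [← hf.disp_opath o₁] at hD₁ h1 ⊢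
  rw [← hf.disp_opath o₂] at hD₂ h2 ⊢
  obtain ⟨t₁, e₁, e₁'⟩ := exists_split (hf.len_opath o₁)
    (D := disp f cl(X.opath o₁) - D) (by linarith) (by linarith)
  obtain ⟨t₂, e₂, e₂'⟩ := exists_split (hf.len_opath o₂) hD0 hD₂
  have c₁ := cl_initial_trans_final (X.opath o₁) t₁
  have c₂ := cl_initial_trans_final (X.opath o₂) t₂
  have hlen := hf.edgeLen_le_disp o₂ (avoids_of_final (S := {a | a ≠ o₂.1}) hne t₁ hβ)
  rw [← hf.disp_opath o₂] at hlen
  rw [← c₂, ← Path.Homotopic.Quotient.trans_assoc, c₂] at hlen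
  have htri := disp_trans_le f
    ((Path.Homotopic.Quotient.trans cl((X.opath o₁).final t₁) β).trans cl((X.opath o₂).initial t₂))
    cl((X.opath o₂).final t₂)
  have key := disp_add_disp_add_disp_le (C := C) (D := D) (f := f)
    (a₁ := cl((X.opath o₁).initial t₁)) (d₁ := cl((X.opath o₁).final t₁)) (β := β)
    (d₂ := cl((X.opath o₂).initial t₂)) (a₂ := cl((X.opath o₂).final t₂))
  rw [c₁, c₂] at key
  exact key h1 h2 (by linarith) (by linarith) e₂ e₂' fun _ => by linarith

/-- An edge cannot slide along itself, so it is cut at distance `D` from its end, and the initial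
piece slides along the final one. The length `2 * D` leaves room for a first and a last segment of
length `D`. -/
theorem IsMinimalLength.disp_ge_of_eq (hf : IsMinimalLength f) (hC : C + 20 < D) {e : X.E}
    {β : PClass (X.vertex (X.tgt e)) (X.vertex (X.src e))} (hβ : EdgeClass {a | a ≠ e} β)
    (hD0 : 0 ≤ D) (hD : 2 * D ≤ edgeLen f e)
    (h1 : edgeLen f e + disp f β ≤ disp f (Path.Homotopic.Quotient.trans cl(X.epath e) β) + C)
    (h2 : edgeLen f e + disp f β ≤ disp f (β.trans cl(X.epath e)) + C) :
    edgeLen f e + disp f β + edgeLen f e ≤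
      disp f ((Path.Homotopic.Quotient.trans cl(X.epath e) β).trans cl(X.epath e)) +
        max (2 * C + 8) (2 * D) := by
  have hdisp : disp f cl(X.epath e) = edgeLen f e := hf.disp_opath (e, true)
  have hgeo : len f (X.epath e) = ENNReal.ofReal (disp f cl(X.epath e)) := hf.len_opath (e, true)
  rw [← hdisp] at hD h1 h2 ⊢
  obtain ⟨t, e₁, e₁'⟩ := exists_split hgeo
    (D := disp f cl(X.epath e) - D) (by linarith) (by linarith)
  have hgeo' := (len_split hgeo t).2.1
  obtain ⟨s, e₂, e₂'⟩ := exists_split hgeo' hD0 (by linarith)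
  have c₁ := cl_initial_trans_final (X.epath e) t
  have c₂ := cl_initial_trans_final ((X.epath e).initial t) s
  have hlen := hf.len_initial_le_disp e t hβ
  rw [hgeo', ENNReal.toReal_ofReal (disp_nonneg f _)] at hlen
  set d₁ : PClass (X.epath e t) _ := cl((X.epath e).final t)
  set ι : PClass _ (X.epath e t) := cl((X.epath e).initial t)
  set d₂ : PClass _ ((X.epath e).initial t s) := cl(((X.epath e).initial t).initial s)
  set m : PClass ((X.epath e).initial t s) _ := cl(((X.epath e).initial t).final s)
  rw [← c₂, ← Path.Homotopic.Quotient.trans_assoc, c₂] at hlen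
  have htri := disp_trans_le f ((d₁.trans β).trans d₂) m
  have c₃ : d₂.trans (m.trans d₁) = cl(X.epath e) := by
    rw [← Path.Homotopic.Quotient.trans_assoc, c₂, c₁]
  have t₁ := disp_trans_le f m d₁
  have t₂ := disp_trans_le f d₂ (m.trans d₁)
  rw [c₃] at t₂
  have key := disp_add_disp_add_disp_le (C := C) (D := D) (f := f)
    (a₁ := ι) (d₁ := d₁) (β := β) (d₂ := d₂) (a₂ := m.trans d₁)
  rw [c₁, c₃] at key
  exact key h1 h2 (by linarith) (by linarith) e₂ (by linarith) fun _ => by linarith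

theorem IsMinimalLength.disp_ge_of_eq_symm (hf : IsMinimalLength f) (hC : C + 20 < D) {e : X.E}
    {β : PClass (X.vertex (X.src e)) (X.vertex (X.tgt e))} (hβ : EdgeClass {a | a ≠ e} β)
    (hD0 : 0 ≤ D) (hD : 2 * D ≤ edgeLen f e)
    (h1 : edgeLen f e + disp f β ≤
      disp f (Path.Homotopic.Quotient.trans (.symm cl(X.epath e)) β) + C)
    (h2 : edgeLen f e + disp f β ≤ disp f (β.trans (.symm cl(X.epath e))) + C) :
    edgeLen f e + disp f β + edgeLen f e ≤ disp f ((Path.Homotopic.Quotient.trans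
      (.symm cl(X.epath e)) β).trans (.symm cl(X.epath e))) + max (2 * C + 8) (2 * D) := by
  rw [← disp_symm f β, ← disp_symm f (Path.Homotopic.Quotient.trans _ _)] at h1 h2 ⊢
  simp only [quotient_symm_trans, quotient_symm_symm] at h1 h2 ⊢
  rw [← Path.Homotopic.Quotient.trans_assoc]
  exact hf.disp_ge_of_eq hC hβ.symm hD0 hD h2 h1

/-- If the two strands of the edge stay close, the isometry `g` of the loop `β` moves the start `p`
and the point `u` at depth `D` at most `C + 20`. Sliding the edge around `β` and `β⁻¹` shows that
`u` is at least `D` from `g p`, and `g u` from `p`. So `hmid` yields a point which `g` moves less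
than `htrans` permits. -/
theorem IsMinimalLength.disp_ge_of_symm (hf : IsMinimalLength f) {o : X.E × Bool}
    {β : PClass (X.vertex (X.osrc o)) (X.vertex (X.osrc o))} (hβ : EdgeClass {a | a ≠ o.1} β)
    (hD0 : 0 ≤ D) (hD : D ≤ edgeLen f o.1) {ε : ℝ}
    (hmid : ∀ (g : HypSpace ≃ᵢ HypSpace) (p u : HypSpace), dist p u = D →
      dist p (g p) ≤ C + 20 → dist u (g u) ≤ C + 20 → D ≤ dist u (g p) → D ≤ dist (g u) p →
      ∃ x, dist x (g x) < ε)
    (htrans : ∀ p : M.proj ⁻¹' {f (X.vertex (X.osrc o))}, ∀ g ∈ M.Γ, (dev f β p).1 = g p.1 →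
      ∀ x, ε ≤ dist x (g x))
    {α : PClass (X.vertex (X.otgt o)) (X.vertex (X.osrc o))} (hα : α = .symm cl(X.opath o))
    (h1 : edgeLen f o.1 + disp f β ≤ disp f (α.trans β) + C)
    (h2 : edgeLen f o.1 + disp f β ≤ disp f (β.trans cl(X.opath o)) + C) :
    edgeLen f o.1 + disp f β + edgeLen f o.1 ≤ disp f ((α.trans β).trans cl(X.opath o)) +
      max (2 * C + 8) (2 * D) := by
  subst hα
  rw [← hf.disp_opath o] at hD h1 h2 ⊢
  obtain ⟨t, e₂, e₂'⟩ := exists_split (hf.len_opath o) hD0 hD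
  have c := cl_initial_trans_final (X.opath o) t
  set d : PClass _ (X.opath o t) := cl((X.opath o).initial t)
  set a : PClass (X.opath o t) _ := cl((X.opath o).final t)
  have c' : a.symm.trans d.symm = Path.Homotopic.Quotient.symm cl(X.opath o) := by
    rw [← quotient_symm_trans, c]
  have key := disp_add_disp_add_disp_le (C := C) (D := D) (f := f)
    (a₁ := a.symm) (d₁ := d.symm) (β := β) (d₂ := d) (a₂ := a)
  rw [c, c'] at key
  simp only [disp_symm] at key
  refine key h1 h2 e₂ e₂' e₂ e₂' fun hβC => ?_
  by_contra! hcon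
  obtain ⟨p⟩ := nonempty_fiber f (X.vertex (X.osrc o))
  obtain ⟨g, hg, hgp⟩ := HypManifold.exists_of_proj_eq
    (p.2.trans (dev f β p).2.symm : M.proj p.1 = M.proj (dev f β p).1)
  have hgu := dev_smul f d hg hgp
  have hmin : ∀ {η : PClass (X.vertex (X.osrc o)) (X.vertex (X.osrc o))},
      EdgeClass {a | a ≠ o.1} η → D ≤ disp f (η.trans d) := fun {η} hη => by
    have h := hf.edgeLen_le_disp o (η := η) (.inl ⟨_, rfl, by rwa [quotient_cast_self]⟩)
    rw [← hf.disp_opath o, ← c, ← Path.Homotopic.Quotient.trans_assoc, c] at h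
    have := disp_trans_le f (η.trans d) a
    linarith
  have hm1 := hmin hβ
  have hm2 := hmin hβ.symm
  rw [disp_eq f _ p, dev_trans, hgu] at hm1
  rw [disp_eq f _ (dev f β p), dev_trans, dev_symm_dev, ← hgp] at hm2
  rw [disp_eq f _ p, ← hgp] at hβC
  rw [disp_eq f d p] at e₂
  rw [disp_eq f _ (dev f d p), dev_trans, dev_trans, dev_symm_dev, hgu] at hcon
  obtain ⟨x, hx⟩ := hmid g p.1 (dev f d p).1 e₂ (by linarith) hcon
    (by rw [dist_comm]; exact hm2) (by rw [dist_comm]; exact hm1)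
  exact (htrans p g hg hgp.symm x).not_gt hx

end

end

/-! ### Tame subgraphs and pairs of outer edges -/

noncomputable section

open FinGraph

variable {M : HypManifold} {X : FinGraph}

theorem quotient_symm_refl_trans {T : Type*} [TopologicalSpace T] {x y : T} (ε : PClass x y) :
    (ε.symm.trans (.refl x)).trans ε = .refl y := by simp

theorem quotient_refl_trans_symm {T : Type*} [TopologicalSpace T] {x y : T} (ε : PClass x y) :
    (ε.trans (.refl y)).trans ε.symm = .refl x := by simp

/-- The geometric part of quasi-convexity: classes of paths are not much longer than the distance
between the end points of their lifts, and translation lengths are bounded below. -/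
structure IsTame (f : C(X.Space, M.Carrier)) (Y : X.Sub) (A : ℝ) : Prop where
  classLen_le : ∀ {a z : Y.carrier} (η : PClass a z),
    classLen (f.comp Y.incl) η ≤ ENNReal.ofReal (A * disp (f.comp Y.incl) η + A ^ 2)
  translation : ∀ {a : Y.carrier} (η : PClass a a), η ≠ .refl a →
    ∀ p : M.proj ⁻¹' {f a}, ∀ g ∈ M.Γ, (dev f (η.map Y.incl) p).1 = g p.1 →
      ∀ x, 1 / A ≤ dist x (g x)

/-- Long edges are approximately efficient at a quasi-convex subgraph which does not contain them,
and so are pairs of such edges, unless they cancel. -/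
theorem exists_edge_pair_const (A : ℝ) (hA : 0 < A) : ∃ C C' L₀ : ℝ, 0 ≤ C ∧ 0 ≤ C' ∧
    ∀ (M : HypManifold) (X : FinGraph) (f : C(X.Space, M.Carrier)), IsMinimalLength f →
      ∀ Y : X.Sub, IsTame f Y A →
      (∀ (o : X.E × Bool) (hv : X.vertex (X.osrc o) ∈ Y.carrier) (b : Y.carrier)
        (β : PClass b ⟨_, hv⟩), o.1 ∉ Y.edges →
        edgeLen f o.1 + disp f (β.map Y.incl) ≤
          disp f ((β.map Y.incl).trans cl(X.opath o)) + C) ∧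
      (∀ (o : X.E × Bool) (hv : X.vertex (X.otgt o) ∈ Y.carrier) (b : Y.carrier)
        (β : PClass ⟨_, hv⟩ b), o.1 ∉ Y.edges →
        edgeLen f o.1 + disp f (β.map Y.incl) ≤
          disp f (Path.Homotopic.Quotient.trans cl(X.opath o) (β.map Y.incl)) + C) ∧
      ∀ (o₁ o₂ : X.E × Bool) (hv : X.vertex (X.otgt o₁) ∈ Y.carrier)
        (hw : X.vertex (X.osrc o₂) ∈ Y.carrier)
        (β : PClass (⟨_, hv⟩ : Y.carrier) ⟨_, hw⟩), o₁.1 ∉ Y.edges → o₂.1 ∉ Y.edges →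
        L₀ ≤ edgeLen f o₁.1 → L₀ ≤ edgeLen f o₂.1 →
        (⟨X.otgt o₂, (Path.Homotopic.Quotient.trans cl(X.opath o₁) (β.map Y.incl)).trans
          cl(X.opath o₂)⟩ : Σ w, PClass (X.vertex (X.osrc o₁)) (X.vertex w)) ≠
            ⟨X.osrc o₁, .refl _⟩ →
        edgeLen f o₁.1 + disp f (β.map Y.incl) + edgeLen f o₂.1 ≤
          disp f ((Path.Homotopic.Quotient.trans cl(X.opath o₁) (β.map Y.incl)).trans
            cl(X.opath o₂)) + C' := by
  obtain ⟨C, hC, H⟩ := exists_efficient_const A hA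
  obtain ⟨D₀, hD₀, hmid⟩ := HypSpace.exists_midpoint_close (1 / A) (C + 20) (by positivity)
    (by positivity)
  -- Deep enough for the midpoint estimate, and larger than the fellow-travelling bound `C + 20`.
  set D := max D₀ (C + 21)
  have hCD : C + 20 < D := (by linarith : C + 20 < C + 21).trans_le (le_max_right _ _)
  have hD0 : 0 ≤ D := hD₀.trans (le_max_left _ _)
  replace hmid := hmid D (le_max_left _ _)
  refine ⟨C, max (2 * C + 8) (2 * D), 2 * D, hC, le_max_of_le_right (by positivity),
    fun M X f hf Y hY => ?_⟩
  have dep : ∀ (o : X.E × Bool) (hv : X.vertex (X.osrc o) ∈ Y.carrier) (b : Y.carrier)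
      (β : PClass b ⟨_, hv⟩), o.1 ∉ Y.edges →
      edgeLen f o.1 + disp f (β.map Y.incl) ≤
        disp f ((β.map Y.incl).trans cl(X.opath o)) + C := fun o hv b β ho => by
    rw [← hf.disp_opath]
    -- The constant concerns an edge arriving at the block, so the whole configuration is reversed.
    -- Its hypothesis is that sliding along `Y` does not shorten the edge.
    have := H M _ _ f Y.incl _ _ β.symm (fun z η => hY.classLen_le η) _
      (Path.Homotopic.Quotient.symm cl(X.opath o)) fun z η => ?_
    · rw [map_quotient_symm] at this
      rwa [disp_symm, disp_symm, disp_symm_trans_symm] at this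
    · rw [disp_symm]
      refine Eq.trans_le (hf.disp_opath o) ?_
      refine (hf.edgeLen_le_disp o (η := η.symm.map Y.incl) ?_).trans_eq ?_
      · exact (Sub.avoids_map η.symm).mono (Sub.edges_subset_ne ho)
      · rw [map_quotient_symm]
        exact disp_symm_trans _ _
  have arr : ∀ (o : X.E × Bool) (hv : X.vertex (X.otgt o) ∈ Y.carrier) (b : Y.carrier)
      (β : PClass ⟨_, hv⟩ b), o.1 ∉ Y.edges →
      edgeLen f o.1 + disp f (β.map Y.incl) ≤
        disp f (Path.Homotopic.Quotient.trans cl(X.opath o) (β.map Y.incl)) + C :=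
      fun o hv b β ho => by
    rw [← hf.disp_opath]
    refine H M _ _ f Y.incl _ _ β (fun z η => hY.classLen_le η) _ cl(X.opath o) fun z η => ?_
    refine Eq.trans_le (hf.disp_opath o) (hf.edgeLen_le_disp_trans o (η := η.map Y.incl) ?_)
    exact Eq.subst (motive := Avoids _) (map_quotient_symm Y.incl η)
      ((Sub.avoids_map η.symm).mono (Sub.edges_subset_ne ho))
  refine ⟨dep, arr, fun o₁ o₂ hv hw β ho₁ ho₂ hL₁ hL₂ hne => ?_⟩
  have h1 := arr o₁ hv _ β ho₁
  have h2 := dep o₂ hw _ β ho₂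
  have hβ : EdgeClass {a | a ≠ o₂.1} (v := X.otgt o₁) (w := X.osrc o₂) (β.map Y.incl) :=
    (Sub.edgeClass_map β).mono (Sub.edges_subset_ne ho₂)
  by_cases he : o₁.1 = o₂.1
  swap
  · exact hf.disp_ge_of_ne hCD he hβ hD0 (by linarith) (by linarith) h1 h2
  obtain ⟨e, b₁⟩ := o₁
  obtain ⟨e', b₂⟩ := o₂
  obtain rfl : e = e' := he
  have htrans : ∀ v (hv hw : X.vertex v ∈ Y.carrier) (β : PClass (⟨_, hv⟩ : Y.carrier) ⟨_, hw⟩),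
      β ≠ .refl _ → ∀ p : M.proj ⁻¹' {f (X.vertex v)}, ∀ g ∈ M.Γ,
      (dev f (β.map Y.incl) p).1 = g p.1 → ∀ x, 1 / A ≤ dist x (g x) := fun v hv hw β hne =>
    hY.translation β hne
  -- Equal orientations follow the same edge twice; opposite ones backtrack around the loop `β`,
  -- which is nontrivial because otherwise the two edges cancel.
  obtain _ | _ := b₁ <;> obtain _ | _ := b₂
  · exact hf.disp_ge_of_eq_symm hCD (e := e) hβ hD0 hL₁ h1 h2
  · refine hf.disp_ge_of_symm (o := (e, true)) hβ hD0 (by linarith) hmid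
      (htrans _ _ _ β fun h => hne ?_) rfl h1 h2
    subst h
    exact congrArg (Sigma.mk _) (quotient_symm_refl_trans cl(X.epath e))
  · refine hf.disp_ge_of_symm (o := (e, false)) hβ hD0 (by linarith) hmid
      (htrans _ _ _ β fun h => hne ?_) (quotient_symm_symm cl(X.epath e)).symm h1 h2
    subst h
    exact congrArg (Sigma.mk _) (quotient_refl_trans_symm cl(X.epath e))
  · exact hf.disp_ge_of_eq hCD hβ hD0 hL₁ h1 h2

end

noncomputable section

/-! ### Words of blocks and outer edges -/

namespace FinGraph

variable {X : FinGraph} {ι : Type*} (Y : ι → X.Sub)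

/-- The class of a path in one of the subgraphs. -/
def IsBlock {v w : X.V} (β : PClass (X.vertex v) (X.vertex w)) : Prop :=
  ∃ i, ∃ (hv : X.vertex v ∈ (Y i).carrier) (hw : X.vertex w ∈ (Y i).carrier),
    ∃ β' : PClass (⟨_, hv⟩ : (Y i).carrier) ⟨_, hw⟩, β'.map (Y i).incl = β

/-- The class is the product of `n` edges in none of the subgraphs, separated by classes of paths in
the subgraphs. -/
def HasWord : ℕ → ∀ {v w : X.V}, PClass (X.vertex v) (X.vertex w) → Prop
  | 0, _, _, δ => IsBlock Y δ
  | n + 1, v, w, δ => ∃ (o : X.E × Bool) (δ' : PClass (X.vertex v) (X.vertex (X.osrc o)))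
      (β : PClass (X.vertex (X.otgt o)) (X.vertex w)), (∀ i, o.1 ∉ (Y i).edges) ∧ HasWord n δ' ∧
        IsBlock Y β ∧ δ = (δ'.trans cl(X.opath o)).trans β

variable {Y}

theorem IsBlock.refl (hcov : ∀ v, ∃ i, X.vertex v ∈ (Y i).carrier) (v : X.V) :
    IsBlock Y (.refl (X.vertex v)) := by
  obtain ⟨i, hi⟩ := hcov v
  exact ⟨i, hi, hi, .refl _, rfl⟩

theorem IsBlock.trans (hdisj : ∀ i j, i ≠ j → Disjoint (Y i).carrier (Y j).carrier)
    {u v w : X.V} {β : PClass (X.vertex u) (X.vertex v)} {γ : PClass (X.vertex v) (X.vertex w)}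
    (hβ : IsBlock Y β) (hγ : IsBlock Y γ) : IsBlock Y (β.trans γ) := by
  obtain ⟨i, hu, hv, β, rfl⟩ := hβ
  obtain ⟨j, hv', hw, γ, rfl⟩ := hγ
  obtain rfl : i = j := by
    by_contra hij
    exact Set.disjoint_left.1 (hdisj i j hij) hv hv'
  exact ⟨i, hu, hw, β.trans γ, map_quotient_trans _ _ _⟩

theorem IsBlock.symm {u v : X.V} {β : PClass (X.vertex u) (X.vertex v)} (hβ : IsBlock Y β) :
    IsBlock Y β.symm := by
  obtain ⟨i, hu, hv, β, rfl⟩ := hβ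
  exact ⟨i, hv, hu, β.symm, map_quotient_symm _ _⟩

theorem isBlock_epath {i : ι} {e : X.E} (he : e ∈ (Y i).edges) :
    IsBlock Y (cl(X.epath e) : PClass _ _) := by
  have hm : ∀ s, X.edge e s ∈ (Y i).carrier := fun s => .inr (Set.mem_iUnion₂.2 ⟨e, he, s, rfl⟩)
  refine ⟨i, .inl ⟨_, (Y i).src_mem e he, rfl⟩, .inl ⟨_, (Y i).tgt_mem e he, rfl⟩,
    cl(⟨⟨fun s => ⟨X.edge e s, hm s⟩, by fun_prop⟩, ?_, ?_⟩), rfl⟩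
  · exact Subtype.ext (edge_zero e)
  · exact Subtype.ext (edge_one e)

theorem HasWord.trans_block (hdisj : ∀ i j, i ≠ j → Disjoint (Y i).carrier (Y j).carrier)
    {n : ℕ} {u v w : X.V} {δ : PClass (X.vertex u) (X.vertex v)}
    {β : PClass (X.vertex v) (X.vertex w)} (hδ : HasWord Y n δ) (hβ : IsBlock Y β) :
    HasWord Y n (δ.trans β) := by
  cases n with
  | zero => exact IsBlock.trans hdisj hδ hβ
  | succ n =>
    obtain ⟨o, δ', β', ho, hδ', hβ', rfl⟩ := hδ
    exact ⟨o, δ', β'.trans β, ho, hδ', hβ'.trans hdisj hβ, Path.Homotopic.Quotient.trans_assoc _ _ _⟩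

theorem HasWord.trans_edge (hcov : ∀ v, ∃ i, X.vertex v ∈ (Y i).carrier) {n : ℕ} {v : X.V}
    {o : X.E × Bool} {δ : PClass (X.vertex v) (X.vertex (X.osrc o))} (hδ : HasWord Y n δ)
    (ho : ∀ i, o.1 ∉ (Y i).edges) :
    HasWord Y (n + 1) (δ.trans cl(X.opath o)) :=
  ⟨o, δ, .refl _, ho, hδ, .refl hcov _, (Path.Homotopic.Quotient.trans_refl _).symm⟩

theorem exists_hasWord (hcov : ∀ v, ∃ i, X.vertex v ∈ (Y i).carrier)
    (hdisj : ∀ i j, i ≠ j → Disjoint (Y i).carrier (Y j).carrier) {v w : X.V}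
    (δ : PClass (X.vertex v) (X.vertex w)) : ∃ n, HasWord Y n δ := by
  induction edgeClass_univ δ with
  | refl => exact ⟨0, .refl hcov _⟩
  | @edge e δ _ _ ih =>
    obtain ⟨n, hn⟩ := ih
    by_cases he : ∃ i, e ∈ (Y i).edges
    · exact ⟨n, hn.trans_block hdisj (isBlock_epath he.choose_spec)⟩
    · exact ⟨n + 1, hn.trans_edge (o := (e, true)) hcov (not_exists.1 he)⟩
  | @symm_edge e δ _ _ ih =>
    obtain ⟨n, hn⟩ := ih
    by_cases he : ∃ i, e ∈ (Y i).edges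
    · exact ⟨n, hn.trans_block hdisj (isBlock_epath he.choose_spec).symm⟩
    · exact ⟨n + 1, hn.trans_edge (o := (e, false)) hcov (not_exists.1 he)⟩

end FinGraph

open FinGraph

theorem classLen_map_le {M : HypManifold} {S T : Type} [TopologicalSpace S] [TopologicalSpace T]
    (f : C(T, M.Carrier)) (φ : C(S, T)) {x y : S} (δ : PClass x y) :
    classLen f (δ.map φ) ≤ classLen (f.comp φ) δ := by
  refine le_iInf₂ fun γ hγ => ?_
  subst hγ
  exact classLen_mk_le f (γ.map φ.continuous)

theorem disp_four_point {M : HypManifold} {T : Type} [TopologicalSpace T] (f : C(T, M.Carrier))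
    {x y z w : T} (α : PClass x y) (β : PClass y z) (γ : PClass z w) :
    disp f (α.trans β) + disp f (β.trans γ) ≤
      max (disp f α + disp f γ) (disp f ((α.trans β).trans γ) + disp f β) + 8 := by
  obtain ⟨p⟩ := nonempty_fiber f x
  rw [disp_eq f _ p, disp_eq f _ (dev f α p), disp_eq f α p, disp_eq f γ (dev f (α.trans β) p),
    disp_eq f _ p, disp_eq f β (dev f α p)]
  simp only [dev_trans]
  exact HypSpace.four_point _ _ _ _

/-- If the outer edges are long, then classes of paths are not much longer than the distance between
the end points of their lifts, and `f` is injective on fundamental groups. -/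
theorem exists_long_edges_const (A : ℝ) (hA : 0 < A) : ∃ L K B : ℝ, 0 < K ∧ 0 ≤ B ∧
    ∀ (M : HypManifold) (X : FinGraph) (f : C(X.Space, M.Carrier)), IsMinimalLength f →
      ∀ (ι : Type) (Y : ι → X.Sub), (∀ v, ∃ i, X.vertex v ∈ (Y i).carrier) →
      (∀ i j, i ≠ j → Disjoint (Y i).carrier (Y j).carrier) → (∀ i, IsTame f (Y i) A) →
      (∀ e, (∀ i, e ∉ (Y i).edges) → L ≤ edgeLen f e) →
      (∀ v w (δ : PClass (X.vertex v) (X.vertex w)),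
        classLen f δ ≤ ENNReal.ofReal (K * disp f δ + B)) ∧
      ∀ v (δ : PClass (X.vertex v) (X.vertex v)), disp f δ = 0 → δ = .refl _ := by
  obtain ⟨C, C', L₀, hC, hC', H⟩ := exists_edge_pair_const A hA
  -- The loss per junction: one edge at a block, one pair of edges, and one use of the four point
  -- condition.
  obtain ⟨c, hc⟩ : ∃ c, c = C + C' + 8 := ⟨_, rfl⟩
  -- One edge of this length pays for the additive constants `A ^ 2` and `(2 + A) * c` of a block
  -- and a junction; it also exceeds `2 * c` and the threshold `L₀`.
  obtain ⟨L, hL⟩ : ∃ L, L = A ^ 2 + (2 + A) * c + |L₀| + 1 := ⟨_, rfl⟩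
  have hAc : 0 ≤ A * c := by subst hc; positivity
  have hA2 := sq_nonneg A
  have hL₀ := le_abs_self L₀
  have hL₀' := abs_nonneg L₀
  refine ⟨L, 2 + A, (2 + A) * c + A ^ 2, by positivity, by subst hc; positivity,
    fun M X f hf ι Y hcov hdisj hT hlong => ?_⟩
  have hblock : ∀ {v w} {β : PClass (X.vertex v) (X.vertex w)}, IsBlock Y β →
      classLen f β ≤ ENNReal.ofReal (A * disp f β + A ^ 2) := by
    rintro v w β ⟨i, hv, hw, β, rfl⟩
    exact (classLen_map_le f _ β).trans
      ((hT i).classLen_le β |>.trans_eq (by rw [← disp_map]; rfl))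
  have hinj : ∀ {v} {β : PClass (X.vertex v) (X.vertex v)}, IsBlock Y β → disp f β = 0 →
      β = .refl _ := by
    rintro v β ⟨i, hv, hw, β, rfl⟩ h0
    by_contra hne
    obtain ⟨p⟩ := nonempty_fiber f (X.vertex v)
    have h1 := (hT i).translation β (fun h => hne (h ▸ rfl)) p 1 (one_mem _)
      (dist_eq_zero.1 ((disp_eq f (β.map (Y i).incl) p).symm.trans h0)).symm p.1
    have h2 : dist p.1 p.1 = 0 := dist_self _
    have h3 : 0 < 1 / A := by positivity
    exact (h1.trans_eq h2).not_gt h3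
  have hdep : ∀ (o : X.E × Bool) {v} {β : PClass (X.vertex v) (X.vertex (X.osrc o))},
      IsBlock Y β → (∀ i, o.1 ∉ (Y i).edges) →
      edgeLen f o.1 + disp f β ≤ disp f (β.trans cl(X.opath o)) + C := by
    rintro o v β ⟨i, hv, hw, β, rfl⟩ ho
    exact (H M X f hf (Y i) (hT i)).1 o hw _ β (ho i)
  have harr : ∀ (o : X.E × Bool) {v} {β : PClass (X.vertex (X.otgt o)) (X.vertex v)},
      IsBlock Y β → (∀ i, o.1 ∉ (Y i).edges) →
      edgeLen f o.1 + disp f β ≤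
        disp f (Path.Homotopic.Quotient.trans cl(X.opath o) β) + C := by
    rintro o v β ⟨i, hv, hw, β, rfl⟩ ho
    exact (H M X f hf (Y i) (hT i)).2.1 o hv _ β (ho i)
  have hpair : ∀ (o₁ o₂ : X.E × Bool) {β : PClass (X.vertex (X.otgt o₁)) (X.vertex (X.osrc o₂))},
      IsBlock Y β → (∀ i, o₁.1 ∉ (Y i).edges) → (∀ i, o₂.1 ∉ (Y i).edges) →
      (⟨X.otgt o₂, (Path.Homotopic.Quotient.trans cl(X.opath o₁) β).trans cl(X.opath o₂)⟩ :
        Σ w, PClass (X.vertex (X.osrc o₁)) (X.vertex w)) ≠ ⟨X.osrc o₁, .refl _⟩ →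
      edgeLen f o₁.1 + disp f β + edgeLen f o₂.1 ≤ disp f ((Path.Homotopic.Quotient.trans
        cl(X.opath o₁) β).trans cl(X.opath o₂)) + C' := by
    rintro o₁ o₂ β ⟨i, hv, hw, β, rfl⟩ ho₁ ho₂ hne
    have hl₁ := hlong _ ho₁
    have hl₂ := hlong _ ho₂
    have hc0 : 0 ≤ c := by linarith
    exact (H M X f hf (Y i) (hT i)).2.2 o₁ o₂ hv hw β (ho₁ i) (ho₂ i) (by linarith)
      (by linarith) hne
  have hedge : ∀ o : X.E × Bool, classLen f (cl(X.opath o) : PClass _ _) ≤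
      ENNReal.ofReal (edgeLen f o.1) := fun o => by
    rw [hf.ofReal_edgeLen, ← _root_.len_opath]
    exact classLen_mk_le f _
  -- Induction along a shortest word, cut off right after an outer edge. The length bound has no
  -- additive constant there, so nothing accumulates; the last clause keeps the displacement
  -- positive.
  have main : ∀ n {v : X.V} (o : X.E × Bool) (δ : PClass (X.vertex v) (X.vertex (X.osrc o))),
      HasWord Y n δ → (∀ i, o.1 ∉ (Y i).edges) →
      (∀ m ≤ n, ¬ HasWord Y m (δ.trans cl(X.opath o))) →
      disp f δ + edgeLen f o.1 ≤ disp f (δ.trans cl(X.opath o)) + c ∧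
      classLen f (δ.trans cl(X.opath o)) ≤
        ENNReal.ofReal ((2 + A) * disp f (δ.trans cl(X.opath o))) ∧
      L ≤ disp f (δ.trans cl(X.opath o)) + c := by
    intro n
    induction n with
    | zero =>
      rintro v o δ hδ ho hmin
      have hδ : IsBlock Y δ := hδ
      have h1 := hdep o hδ ho
      have hl := hlong _ ho
      have hd := disp_nonneg f δ
      refine ⟨by linarith, ?_, by linarith⟩
      refine (classLen_trans_le f _ _).trans ((add_le_add (hblock hδ) (hedge o)).trans ?_)
      rw [← ENNReal.ofReal_add (by positivity) (edgeLen_nonneg _)]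
      refine ENNReal.ofReal_le_ofReal ?_
      have h2 := mul_le_mul_of_nonneg_left h1 (by positivity : 0 ≤ 2 + A)
      have h3 := mul_nonneg hA.le (edgeLen_nonneg (f := f) o.1)
      have h4 : (2 + A) * C ≤ (2 + A) * c :=
        mul_le_mul_of_nonneg_left (by linarith) (by positivity)
      linarith
    | succ n ih =>
      rintro v o δ ⟨o₁, δ₁, β, ho₁, hδ₁, hβ, rfl⟩ ho hmin
      obtain ⟨j1, k1, l1⟩ := ih o₁ δ₁ hδ₁ ho₁ fun m hm h =>
        hmin (m + 1) (by omega) ((h.trans_block hdisj hβ).trans_edge hcov ho)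
      -- If the two edges and the block between them cancelled, the class would have a word with two
      -- outer edges fewer.
      have kc := hpair o₁ o hβ ho₁ ho fun h => by
        have key : HasWord Y n (δ₁.trans ((Path.Homotopic.Quotient.trans cl(X.opath o₁) β).trans
            cl(X.opath o))) :=
          Eq.subst (motive := fun s : Σ w, PClass (X.vertex (X.osrc o₁)) (X.vertex w) =>
            HasWord Y n (δ₁.trans s.2)) h.symm (by simpa using hδ₁)
        refine hmin n (by omega) ?_
        simpa only [Path.Homotopic.Quotient.trans_assoc] using key
      have hl := hlong _ ho
      have hl₁ := hlong _ ho₁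
      have hd := disp_nonneg f β
      have hd₁ := disp_nonneg f δ₁
      have t1 := disp_trans_le f (δ₁.trans cl(X.opath o₁)) β
      have t2 := disp_trans_le f β cl(X.opath o)
      have fp := disp_four_point f δ₁ cl(X.opath o₁) (β.trans cl(X.opath o))
      rw [hf.disp_opath] at fp t2
      simp only [← Path.Homotopic.Quotient.trans_assoc] at fp kc
      -- One alternative of the four point condition would bound `2 * edgeLen f o₁.1` by `c + C' +
      -- 8`, which is less than `2 * L`; the other gives the claim.
      have e : disp f (δ₁.trans cl(X.opath o₁)) + disp f β + edgeLen f o.1 ≤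
          disp f (((δ₁.trans cl(X.opath o₁)).trans β).trans cl(X.opath o)) + c := by
        rcases le_max_iff.1 (sub_le_iff_le_add.2 fp) with fp | fp <;> linarith
      refine ⟨by linarith, ?_, by linarith⟩
      refine (classLen_trans_le f _ _).trans ((add_le_add ((classLen_trans_le f _ _).trans
        (add_le_add k1 (hblock hβ))) (hedge o)).trans ?_)
      have hd₂ := disp_nonneg f (δ₁.trans cl(X.opath o₁))
      rw [← ENNReal.ofReal_add (by positivity) (by positivity),
        ← ENNReal.ofReal_add (by positivity) (edgeLen_nonneg _)]
      refine ENNReal.ofReal_le_ofReal ?_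
      have h2 := mul_le_mul_of_nonneg_left e (by positivity : 0 ≤ 2 + A)
      have h3 := mul_nonneg hA.le (edgeLen_nonneg (f := f) o.1)
      linarith
  -- A class is a block, or a shortest word for it ends in an outer edge followed by one last block,
  -- where the additive constant reappears.
  have final : ∀ {v w} (δ : PClass (X.vertex v) (X.vertex w)), IsBlock Y δ ∨
      0 < disp f δ ∧ classLen f δ ≤ ENNReal.ofReal ((2 + A) * disp f δ + ((2 + A) * c + A ^ 2)) := by
    intro v w δ
    classical
    have hex := exists_hasWord hcov hdisj δ
    obtain ⟨n, hn, hmin⟩ : ∃ n, HasWord Y n δ ∧ ∀ m < n, ¬ HasWord Y m δ :=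
      ⟨Nat.find hex, Nat.find_spec hex, fun m hm => Nat.find_min hex hm⟩
    cases n with
    | zero => exact .inl hn
    | succ n =>
      obtain ⟨o, δ, β, ho, hδ, hβ, rfl⟩ := hn
      obtain ⟨j, k, l⟩ := main n o δ hδ ho fun m hm h =>
        hmin m (by omega) (h.trans_block hdisj hβ)
      have h2 := harr o hβ ho
      have hl := hlong _ ho
      have fp := disp_four_point f δ cl(X.opath o) β
      rw [hf.disp_opath] at fp
      have hd := disp_nonneg f β
      have hd₁ := disp_nonneg f δ
      have e : disp f (δ.trans cl(X.opath o)) + disp f β ≤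
          disp f ((δ.trans cl(X.opath o)).trans β) + c := by
        rcases le_max_iff.1 (sub_le_iff_le_add.2 fp) with fp | fp <;> linarith
      refine .inr ⟨by linarith, (classLen_trans_le f _ _).trans
        ((add_le_add k (hblock hβ)).trans ?_)⟩
      have hd₂ := disp_nonneg f (δ.trans cl(X.opath o))
      rw [← ENNReal.ofReal_add (by positivity) (by positivity)]
      refine ENNReal.ofReal_le_ofReal ?_
      have h2 := mul_le_mul_of_nonneg_left e (by positivity : 0 ≤ 2 + A)
      linarith
  refine ⟨fun v w δ => ?_, fun v δ h0 => ?_⟩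
  · obtain h | ⟨-, h⟩ := final δ
    · refine (hblock h).trans (ENNReal.ofReal_le_ofReal ?_)
      have := disp_nonneg f δ
      linarith
    · exact h
  · obtain h | ⟨h, -⟩ := final δ
    · exact hinj h h0
    · exact (h.ne' h0).elim

end

noncomputable section

open FinGraph

variable {M : HypManifold} {X : FinGraph} {f : C(X.Space, M.Carrier)}

/-! ### Quasi-convex subgraphs and single vertices -/

/-- The lower quasi-isometry inequality between the trivial class and `η`, multiplied by `A`. -/
theorem IsQuasiConvexMap.classLen_le {T : Type} [TopologicalSpace T] {f : C(T, M.Carrier)} {A : ℝ}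
    (hA : 0 < A) (h : IsQuasiConvexMap f A) {a z : T} (η : PClass a z) :
    classLen f η ≤ ENNReal.ofReal (A * disp f η + A ^ 2) := by
  obtain ⟨p⟩ := nonempty_fiber f a
  have h0 : coverDist f (⟨a, .refl a⟩ : UnivCover a) (⟨z, η⟩ : UnivCover a) = classLen f η :=
    (coverDist_eq f _ _).trans (congrArg (classLen f) (by
      rw [quotient_refl_symm, Path.Homotopic.Quotient.refl_trans] :
        (Path.Homotopic.Quotient.refl a).symm.trans η = η))
  have h1 : univLift f p (⟨a, .refl a⟩ : UnivCover a) = p.1 := congrArg Subtype.val (dev_refl f p)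
  have key := (congrArg (ENNReal.ofReal (1 / A) * ·) h0).symm.trans_le
    ((h.qi a p (⟨a, .refl a⟩ : UnivCover a) (⟨z, η⟩ : UnivCover a)).1.trans_eq
      (congrArg (edist · (dev f η p).1 + ENNReal.ofReal A) h1))
  beta_reduce at key
  rw [edist_dist, ← disp_eq f η p, ← ENNReal.ofReal_add (disp_nonneg f η) hA.le] at key
  have := mul_le_mul_right key (ENNReal.ofReal A)
  rw [← mul_assoc, ← ENNReal.ofReal_mul hA.le, ← ENNReal.ofReal_mul hA.le,
    mul_one_div_cancel hA.ne', ENNReal.ofReal_one, one_mul] at this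
  exact this.trans_eq (by ring_nf)

theorem translationLength_le (g : HypSpace ≃ᵢ HypSpace) (x : HypSpace) :
    translationLength g ≤ dist x (g x) :=
  ciInf_le ⟨0, by rintro _ ⟨p, rfl⟩; exact dist_nonneg⟩ x

/-- An isometry in `Γ` that agrees with `η` at one lift intertwines everywhere, since developing is
equivariant; so the condition on translation lengths applies to it. -/
theorem IsQuasiConvexSub.isTame {Y : X.Sub} {A : ℝ} (hA : 0 < A) (h : IsQuasiConvexSub f Y A) :
    IsTame f Y A where
  classLen_le := IsQuasiConvexMap.classLen_le hA h.2
  translation {a} η hη p g hg e x := by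
    refine (h.2.translation a p (FundamentalGroup.fromPath η) hη g hg fun b => ?_).trans
      (translationLength_le g x)
    let p' : M.proj ⁻¹' {(f.restrict Y.carrier) a} := p
    have e' : g p'.1 = (dev (f.restrict Y.carrier) η p').1 := e.symm.trans (by
      unfold dev; rw [quotient_map_map]; rfl)
    exact (congrArg Subtype.val (dev_trans (f.restrict Y.carrier) η b.2 p')).trans
      (dev_smul (f.restrict Y.carrier) b.2 hg e')

/-- A vertex, as a subgraph. -/
def FinGraph.vertexSub (X : FinGraph) (v : X.V) : X.Sub := ⟨{v}, ∅, nofun, nofun⟩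

theorem FinGraph.vertexSub_carrier (v : X.V) : (X.vertexSub v).carrier = {X.vertex v} := by
  simp [Sub.carrier, vertexSub]

theorem classLen_refl {T : Type} [TopologicalSpace T] (f : C(T, M.Carrier)) (x : T) :
    classLen f (.refl x) = 0 := by
  refine le_antisymm ((classLen_mk_le f (.refl x)).trans_eq ?_) zero_le
  obtain ⟨p⟩ := nonempty_fiber f x
  have hp : M.proj p.1 = f x := p.2
  rw [len_eq (γ := Path.refl x) (b := .const _ p.1) fun _ => hp]
  exact eVariationOn.constant_on (by rintro _ ⟨_, -, rfl⟩ _ ⟨_, -, rfl⟩; rfl)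

/-- All classes in a point are trivial. Such subgraphs serve as blocks at the vertices outside all
`Y i`. -/
theorem isTame_vertexSub (f : C(X.Space, M.Carrier)) (v : X.V) {A : ℝ} :
    IsTame f (X.vertexSub v) A := by
  have hs : Subsingleton (X.vertexSub v).carrier := by
    rw [vertexSub_carrier]; infer_instance
  have key : ∀ {a : (X.vertexSub v).carrier} (η : PClass a a), η = .refl a := fun {a} η => by
    obtain ⟨γ, rfl⟩ := η.exists_rep
    exact congrArg _ (Path.ext (funext fun t => Subsingleton.elim _ _))
  refine ⟨fun {a z} η => ?_, fun η hη => (hη (key η)).elim⟩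
  obtain rfl := Subsingleton.elim a z
  rw [key η, classLen_refl]
  exact zero_le

/-! ### The conclusion -/

theorem exists_class_to_vertex (f : C(X.Space, M.Carrier)) (x : X.Space) :
    ∃ v, ∃ ρ : PClass (X.vertex v) x, classLen f ρ ≤ graphLength f := by
  obtain ⟨v, rfl⟩ | ⟨e, t, -, -, rfl⟩ := space_cases x
  · exact ⟨v, .refl _, by rw [classLen_refl]; exact zero_le⟩
  · refine ⟨X.src e, cl((X.epath e).initial t), (classLen_mk_le f _).trans ?_⟩
    have h : edgeLength f e ≤ graphLength f :=
      Finset.single_le_sum (f := fun e => edgeLength f e) (fun _ _ => zero_le) (Finset.mem_univ e)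
    refine le_trans ?_ h
    rw [edgeLength_eq_len, ← len_initial_add_len_final f (X.epath e) t]
    exact le_self_add

theorem classLen_symm {T : Type} [TopologicalSpace T] (f : C(T, M.Carrier)) {x y : T}
    (δ : PClass x y) : classLen f δ.symm ≤ classLen f δ := by
  refine le_iInf₂ fun γ hγ => ?_
  subst hγ
  exact (classLen_mk_le f γ.symm).trans_eq (len_symm f γ)

/-- Every point is joined to a vertex by a path no longer than the graph. The new constant depends
on `f`, which the qualitative notion of quasi-isometric embedding allows. -/
theorem IsMinimalLength.exists_classLen_le (hf : IsMinimalLength f) {K B : ℝ} (hK : 0 < K)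
    (hB : 0 ≤ B) (h : ∀ v w (δ : PClass (X.vertex v) (X.vertex w)),
      classLen f δ ≤ ENNReal.ofReal (K * disp f δ + B)) :
    ∃ B', 0 ≤ B' ∧ ∀ x y (δ : PClass x y), classLen f δ ≤ ENNReal.ofReal (K * disp f δ + B') := by
  obtain ⟨ℓ, hℓ, hgl⟩ : ∃ ℓ : ℝ, 0 ≤ ℓ ∧ graphLength f = ENNReal.ofReal ℓ :=
    ⟨_, ENNReal.toReal_nonneg, (ENNReal.ofReal_toReal hf.graphLength_ne_top).symm⟩
  refine ⟨ℓ + (K * (ℓ + ℓ) + B) + ℓ, by positivity, fun x y δ => ?_⟩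
  obtain ⟨v, ρ, hρ⟩ := exists_class_to_vertex f x
  obtain ⟨w, τ, hτ⟩ := exists_class_to_vertex f y
  rw [hgl] at hρ hτ
  have dρ := (disp_le_classLen f ρ).trans hρ
  have dτ := (disp_le_classLen f τ).trans hτ
  rw [ENNReal.ofReal_le_ofReal_iff hℓ] at dρ dτ
  have e : (ρ.symm.trans ((ρ.trans δ).trans τ.symm)).trans τ = δ := by
    rw [← Path.Homotopic.Quotient.trans_assoc, quotient_symm_trans_cancel,
      Path.Homotopic.Quotient.trans_assoc, Path.Homotopic.Quotient.symm_trans,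
      Path.Homotopic.Quotient.trans_refl]
  have t1 := disp_trans_le f (ρ.trans δ) τ.symm
  have t2 := disp_trans_le f ρ δ
  rw [disp_symm] at t1
  have hd := disp_nonneg f ((ρ.trans δ).trans τ.symm)
  have hd' := disp_nonneg f δ
  calc classLen f δ = classLen f ((ρ.symm.trans ((ρ.trans δ).trans τ.symm)).trans τ) := by rw [e]
    _ ≤ ENNReal.ofReal ℓ + ENNReal.ofReal (K * disp f ((ρ.trans δ).trans τ.symm) + B) +
        ENNReal.ofReal ℓ :=
      (classLen_trans_le f _ _).trans (add_le_add ((classLen_trans_le f _ _).trans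
        (add_le_add ((classLen_symm f ρ).trans hρ) (h _ _ _))) hτ)
    _ = ENNReal.ofReal (ℓ + (K * disp f ((ρ.trans δ).trans τ.symm) + B) + ℓ) := by
      rw [ENNReal.ofReal_add (by positivity) hℓ, ENNReal.ofReal_add hℓ (by positivity)]
    _ ≤ _ := by
      refine ENNReal.ofReal_le_ofReal ?_
      have : K * disp f ((ρ.trans δ).trans τ.symm) ≤ K * (ℓ + disp f δ + ℓ) :=
        mul_le_mul_of_nonneg_left (by linarith) hK.le
      linarith

/-- The upper inequality is automatic, as displacements are at most lengths. -/
theorem liftIsQI_of_classLen_le {T : Type} [TopologicalSpace T] {f : C(T, M.Carrier)} {K B : ℝ}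
    (hB : 0 ≤ B) (h : ∀ x y (δ : PClass x y),
      classLen f δ ≤ ENNReal.ofReal (K * disp f δ + B)) : LiftIsQI f := by
  have hK : 0 < max K 1 := lt_max_of_lt_right one_pos
  refine ⟨max K 1, B, le_max_right _ _, hB, fun x₀ p a b => ?_⟩
  have hd : edist (univLift f p a) (univLift f p b) =
      ENNReal.ofReal (disp f (a.2.symm.trans b.2)) := by
    rw [edist_dist, disp_eq f _ (dev f a.2 p), dev_trans, dev_symm_dev]
    rfl
  have h0 := disp_nonneg f (a.2.symm.trans b.2)
  rw [hd, coverDist_eq]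
  constructor
  · refine (mul_le_mul_right (h _ _ _) _).trans ?_
    rw [← ENNReal.ofReal_mul (by positivity), ← ENNReal.ofReal_add h0 hB]
    refine ENNReal.ofReal_le_ofReal ?_
    rw [one_div, inv_mul_le_iff₀ hK]
    have h1 := mul_le_mul_of_nonneg_right (le_max_left K 1) h0
    have h2 := mul_le_mul_of_nonneg_right (le_max_right K 1) hB
    linarith
  · refine (disp_le_classLen f _).trans (le_trans ?_ le_self_add)
    refine le_mul_of_one_le_left zero_le ?_
    rw [ENNReal.one_le_ofReal]
    exact le_max_right _ _

instance (M : HypManifold) : PathConnectedSpace M.Carrier :=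
  M.isQuotientCoveringMap.surjective.pathConnectedSpace M.isCoveringMap.continuous

/-- A loop with trivial image lifts to a closed path and so has displacement zero. Hence `f` induces
an isomorphism onto the fundamental group of the manifold. -/
theorem IsCarrierGraph.isFreeGroup (hf : IsCarrierGraph f)
    (h : ∀ v (δ : PClass (X.vertex v) (X.vertex v)), disp f δ = 0 → δ = .refl _)
    (x : M.Carrier) : IsFreeGroup (FundamentalGroup M.Carrier x) := by
  have := hf.pathConnectedSpace
  obtain ⟨v⟩ : Nonempty X.V := by
    obtain ⟨v, -⟩ | ⟨e, -⟩ := space_cases (Classical.arbitrary X.Space)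
    exacts [⟨v⟩, ⟨X.src e⟩]
  have hinj : Function.Injective (FundamentalGroup.map f (X.vertex v)) := by
    refine (injective_iff_map_eq_one _).2 fun δ hδ => h v δ ?_
    obtain ⟨p⟩ := nonempty_fiber f (X.vertex v)
    have hδ' : Path.Homotopic.Quotient.map (FundamentalGroup.toPath δ) f = .refl _ := hδ
    rw [disp_eq f _ p]
    have : dev f (FundamentalGroup.toPath δ) p = p :=
      (congrArg (M.isCoveringMap.monodromy · p) hδ').trans (dev_refl f p)
    exact (congrArg (dist p.1) (congrArg Subtype.val this)).trans (dist_self _)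
  have := isFreeGroup_fundamentalGroup (X := X) v
  exact IsFreeGroup.ofMulEquiv ((MulEquiv.ofBijective _ ⟨hinj, hf.2 (X.vertex v)⟩).trans
    (FundamentalGroup.fundamentalGroupMulEquivOfPathConnected _ x))

theorem mainTheorem3 (A : ℝ) (hA : 0 < A) (s : ℕ) (hs : 0 < s) :
    ∃ L : ℝ, ∀ (M : HypManifold) (X : FinGraph) (f : C(X.Space, M.Carrier)),
      IsMinimalLength f → Fintype.card X.E = s →
      ∀ (k : ℕ) (Y : Fin k → X.Sub),
        (∀ i j, i ≠ j → Disjoint (Y i).carrier (Y j).carrier) →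
        (∀ i, IsQuasiConvexSub f (Y i) A) →
        (LiftIsQI f ∧ ∀ x : M.Carrier, IsFreeGroup (FundamentalGroup M.Carrier x)) ∨
        ∃ e : X.E, (∀ i, e ∉ (Y i).edges) ∧ edgeLength f e ≤ ENNReal.ofReal L := by
  obtain ⟨L, K, B, hK, hB, H⟩ := exists_long_edges_const A hA
  refine ⟨L, fun M X f hf _ k Y hdisj hY => or_iff_not_imp_right.2 fun hlong => ?_⟩
  -- One-point subgraphs at the remaining vertices make the blocks meet every vertex without adding
  -- any edge.
  let Z : Fin k ⊕ {v : X.V // ∀ i, X.vertex v ∉ (Y i).carrier} → X.Sub :=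
    Sum.elim Y fun v => X.vertexSub v
  have hcov : ∀ v, ∃ i, X.vertex v ∈ (Z i).carrier := fun v => by
    by_cases hv : ∃ i, X.vertex v ∈ (Y i).carrier
    · exact ⟨.inl hv.choose, hv.choose_spec⟩
    · exact ⟨.inr ⟨v, not_exists.1 hv⟩, (vertexSub_carrier v).ge rfl⟩
  have hdisj' : ∀ i j, i ≠ j → Disjoint (Z i).carrier (Z j).carrier := by
    rintro (i | v) (j | w) hij
    · exact hdisj i j fun h => hij (h ▸ rfl)
    · change Disjoint _ (X.vertexSub w).carrier
      rw [vertexSub_carrier, Set.disjoint_singleton_right]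
      exact w.2 i
    · change Disjoint (X.vertexSub v).carrier _
      rw [vertexSub_carrier, Set.disjoint_singleton_left]
      exact v.2 j
    · change Disjoint (X.vertexSub v).carrier (X.vertexSub w).carrier
      rw [vertexSub_carrier, vertexSub_carrier, Set.disjoint_singleton]
      exact fun h => hij (congrArg _ (Subtype.ext (vertex_injective h)))
  have htame : ∀ i, IsTame f (Z i) A := by
    rintro (i | v)
    exacts [(hY i).isTame hA, isTame_vertexSub f v]
  have hlong' : ∀ e, (∀ i, e ∉ (Z i).edges) → L ≤ edgeLen f e := fun e he => by
    by_contra! hlt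
    refine hlong ⟨e, fun i => he (.inl i), ?_⟩
    rw [← hf.ofReal_edgeLen]
    exact ENNReal.ofReal_le_ofReal hlt.le
  obtain ⟨h1, h2⟩ := H M X f hf _ Z hcov hdisj' htame hlong'
  obtain ⟨B', hB', h1⟩ := hf.exists_classLen_le hK hB h1
  exact ⟨liftIsQI_of_classLen_le hB' h1, hf.1.isFreeGroup h2⟩

end
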